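/- Let $a<0$, $c<0$, $b>0$ and $s>2$. For $0<\epsilon\le 1$ consider, for a real-valued function $\eta=\eta(x,t)$ and a vector field ${\bf v}=(v_1,v_2)(x,t)$ on $\mathbb R^2\times[0,\infty)$, the Boussinesq system $$ \left\{\begin{array}{l} \eta_t+\nabla\cdot{\bf v}+\epsilon\,[\nabla\cdot(\eta{\bf v})+a\,\nabla\cdot\Delta{\bf v}-b\,\Delta\eta_t]=0,\\ {\bf v}_t+\nabla\eta+\epsilon\,[\tfrac12\nabla|{\bf v}|^2+c\,\nabla\Delta\eta]=0, \end{array}\right. \qquad (\eta,{\bf v})|_{t=0}=(\eta_0,{\bf v}_0), $$ understood in the sense of distributions on $\mathbb R^2$. Here $H^r=H^r(\mathbb R^2)$ is the $L^2$-based Sobolev space of real-valued functions, and $\mathrm{curl}\,{\bf v}_0=\partial_{x_1}v_{0,2}-\partial_{x_2}v_{0,1}$. (i) Assume $a=c$. For all $R_1,R_2\ge 0$ there are $T>0$ and $C\ge0$, depending only on $R_1,R_2$ (and on $a,b,c,s$) and not on $\epsilon$, such that for every $\epsilon\in(0,1]$ and all $(\eta_0,{\bf v}_0)\in H^{s+1}\times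 (H^s)^2$ with $\mathrm{curl}\,{\bf v}_0=0$, $\|\eta_0\|_{H^{s+1}}\le R_1$ and $\|{\bf v}_0\|_{H^s}\le R_2$, the system has a unique solution $$(\eta,{\bf v})\in C([0,T\epsilon^{-1/2}];H^{s+1})\times C([0,T\epsilon^{-1/2}];(H^s)^2)$$ with initial data $(\eta_0,{\bf v}_0)$, and it is bounded uniformly in $\epsilon$ in the following sense: $$\|\eta(t)\|_{H^s}+\epsilon^{1/2}\|\eta(t)\|_{H^{s+1}}+\|{\bf v}(t)\|_{H^s}\le C\qquad\text{for all }t\in[0,T\epsilon^{-1/2}].$$ (ii) Assume $a\neq c$. The same holds with one more derivative: for all $R_1,R_2\ge 0$ there are $T>0$ and $C\ge0$, depending only on $R_1,R_2$ (and on $a,b,c,s$), such that for every $\epsilon\in(0,1]$ and all $(\eta_0,{\bf v}_0)\in H^{s+2}\times (H^{s+1})^2$ with $\mathrm{curl}\,{\bf v}_0=0$, $\|\eta_0\|_{H^{s+2}}\le R_1$ and $\|{\bf v}_0\|_{H^{s+1}}\le R_2$, the system has a unique solution $$(\eta,{\bf v})\in C([0,T\epsilon^{-1/2}];H^{s+2})\times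 C([0,T\epsilon^{-1/2}];(H^{s+1})^2)$$ with initial data $(\eta_0,{\bf v}_0)$, and $$\|\eta(t)\|_{H^{s+1}}+\epsilon^{1/2}\|\eta(t)\|_{H^{s+2}}+\|{\bf v}(t)\|_{H^{s+1}}\le C\qquad\text{for all }t\in[0,T\epsilon^{-1/2}].$$ -/

import Mathlib

open MeasureTheory Filter Topology FourierTransform LineDeriv Laplacian
open scoped ENNReal NNReal SchwartzMap

namespace Boussinesq

noncomputable section

/-- The Euclidean plane `ℝ²`. -/
abbrev Plane : Type := EuclideanSpace ℝ (Fin 2)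

/-- Real-valued `L²(ℝ²)`. -/
abbrev L2 : Type := Lp ℝ 2 (volume : Measure Plane)

/-- The `L²` Fourier transform (with the kernel `e^{-2πi x·ξ}`) of a real-valued `L²` function. -/
def fourierL2 (u : L2) : Lp ℂ 2 (volume : Measure Plane) :=
  𝓕 (Complex.ofRealCLM.compLp u : Lp ℂ 2 (volume : Measure Plane))

/-- The square of the norm of `H^r(ℝ²)`, that is `‖(1 + |D|²)^{r/2} u‖²_{L²}`, with value `∞` where
`u` is not in `H^r(ℝ²)`. The frequency variable of the symbol is `2πξ`, because of the
normalization of the Fourier transform. It is used only for `r ≥ 0`, where `H^r ⊆ L²`. -/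
def sobolevNormSq (r : ℝ) (u : L2) : ℝ≥0∞ :=
  ∫⁻ ξ : Plane, ENNReal.ofReal ((1 + (2 * Real.pi * ‖ξ‖) ^ 2) ^ r) * ‖fourierL2 u ξ‖ₑ ^ 2

/-- The norm of `H^r(ℝ²)`; a function `u` of `L²(ℝ²)` is in `H^r(ℝ²)` iff this is finite. -/
def sobolevNorm (r : ℝ) (u : L2) : ℝ≥0∞ := sobolevNormSq r u ^ (1 / 2 : ℝ)

/-- The norm of `H^r(ℝ²)²`. -/
def sobolevNormVec (r : ℝ) (v : Fin 2 → L2) : ℝ≥0∞ := (∑ j, sobolevNormSq r (v j)) ^ (1 / 2 : ℝ)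

/-- `u ∈ C([0, S]; H^r(ℝ²))`. -/
def ContinuousInSobolev (r S : ℝ) (u : ℝ → L2) : Prop :=
  ∀ t ∈ Set.Icc 0 S, sobolevNorm r (u t) < ∞ ∧
    Tendsto (fun τ => sobolevNorm r (u τ - u t)) (𝓝[Set.Icc 0 S] t) (𝓝 0)

/-- The partial derivative `∂_j` of a test function. -/
def pd (j : Fin 2) (φ : 𝓢(Plane, ℝ)) : 𝓢(Plane, ℝ) := ∂_{(EuclideanSpace.single j (1 : ℝ) : Plane)} φ

/-- `curl v = ∂₁ v₂ - ∂₂ v₁ = 0` in the sense of distributions. -/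
def CurlFree (v : Fin 2 → L2) : Prop :=
  ∀ φ : 𝓢(Plane, ℝ), ∫ x, (v 1 x * pd 0 φ x - v 0 x * pd 1 φ x) = 0

/-- `(η, v)` solves, on the time interval `[0, S]`, the system

`η_t + ∇·v + ε [∇·(η v) + a ∇·Δv - b Δη_t] = 0`,
`v_t + ∇η + ε [½ ∇|v|² + c ∇Δη] = 0`,

in the sense of tempered distributions on `ℝ²` at every time: after pairing with a Schwartz
function `φ` and moving all the space derivatives to `φ`, so that the first equation reads
`d/dt ⟨η, φ - ε b Δφ⟩ = ⟨v, ∇φ⟩ + ε (⟨η v, ∇φ⟩ + a ⟨v, ∇Δφ⟩)` and the `j`-th component of the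
second one reads `d/dt ⟨v_j, φ⟩ = ⟨η, ∂_j φ⟩ + ε (½ ⟨|v|², ∂_j φ⟩ + c ⟨η, ∂_j Δφ⟩)`. At the two
end points of the interval the time derivative is one-sided. -/
structure IsSolution (a b c ε S : ℝ) (η : ℝ → L2) (v : ℝ → Fin 2 → L2) : Prop where
  mass : ∀ φ : 𝓢(Plane, ℝ), ∀ t ∈ Set.Icc 0 S,
    HasDerivWithinAt (fun τ => ∫ x, η τ x * (φ x - ε * b * (Δ φ) x))
      ((∫ x, ∑ j, v t j x * pd j φ x) +
        ε * ((∫ x, ∑ j, η t x * v t j x * pd j φ x) + a * ∫ x, ∑ j, v t j x * pd j (Δ φ) x))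
      (Set.Icc 0 S) t
  momentum : ∀ φ : 𝓢(Plane, ℝ), ∀ j : Fin 2, ∀ t ∈ Set.Icc 0 S,
    HasDerivWithinAt (fun τ => ∫ x, v τ j x * φ x)
      ((∫ x, η t x * pd j φ x) +
        ε * ((1 / 2) * (∫ x, (∑ k, v t k x ^ 2) * pd j φ x) + c * ∫ x, η t x * pd j (Δ φ) x))
      (Set.Icc 0 S) t

/-- `(η, v)` is a solution on `[0, S]` with initial data `(η₀, v₀)` in the class
`C([0, S]; H^{r+1}(ℝ²)) × C([0, S]; H^r(ℝ²)²)`. -/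
structure IsSobolevSolution (a b c ε S r : ℝ) (η₀ : L2) (v₀ : Fin 2 → L2)
    (η : ℝ → L2) (v : ℝ → Fin 2 → L2) : Prop where
  continuous_eta : ContinuousInSobolev (r + 1) S η
  continuous_v : ∀ j, ContinuousInSobolev r S (fun t => v t j)
  solves : IsSolution a b c ε S η v
  initial_eta : η 0 = η₀
  initial_v : v 0 = v₀

end

end Boussinesq

open Boussinesq

namespace Boussinesq

noncomputable section

/-! The curl of the velocity is conserved, since both the linear and the nonlinear terms of the
momentum equation are gradients. A curl-free field has Fourier transform iρw, with ρ = ξ/|ξ| and a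
scalar amplitude w, so the unknowns reduce to the two scalar functions η̂ and w. With k = 2π|ξ|, α =
-a and γ = -c, put h = M η̂, where M² = (1+εγk²)(1+εbk²)/(1+εαk²). The system then reads h' = Ωw + ε
B₁(h,w), w' = -Ωh + ε B₂(w,w). The linear part is skew and remains so under any even or radial
Fourier weight, so only the quadratic terms contribute to the growth of an H^s energy.

The two quadratic terms behave differently. The kernel of B₁ contains k M(ξ)/(1+εbk²), and M² is
comparable with 1+εbk² uniformly in ε. The BBM smoothing therefore absorbs the derivative at the
price of ε^{-1/2}, and εB₁ has order zero and size ε^{1/2} (`Params.sqrt_mul_abs_kerH_le`). The term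
B₂ is the transport term (v·∇)v of a gradient field and has order one, with the full factor ε. In
the energy it is paired with w itself, so only the symmetric part of its kernel in (ξ, ζ) matters
(`tri_antisymm`). The symmetric part is a commutator: the derivative falls on the frequency
difference ξ-ζ or on the difference of the energy weights (`abs_transport_symm_le`,
`commutator_scalar`). Altogether E' ≤ C ε^{1/2} E^{3/2} for the square E of the energy norm
(`Params.abs_inner_field_le`), so E at most quadruples on a time interval of length T ε^{-1/2}.

All these bounds rest on one inequality, `abs_tri_le`: a trilinear form in frequency is bounded on
L² × L² × L² as soon as its kernel is dominated by ⟨·⟩^{1-s} at one of the three frequencies. That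
function is square-integrable in the plane because s > 2.

Solutions come from a Galerkin truncation in frequency, which is an ordinary differential equation
in a Hilbert space with the same energy estimate. Below a frequency m, two approximations of levels
at least m satisfy the same equations, and an L² estimate of their difference with error m^{1-s}
makes them Cauchy (`Params.norm_sub_sq_le`); the same estimate gives uniqueness. Uniform bounds put
the limit in H^s and make it weakly continuous. The energies, computed with the weight ⟨ξ⟩^s capped
at N, are Lipschitz in time uniformly in N and in the level, so the norm is continuous, and weak
continuity becomes strong continuity.

The equations on the Fourier side are multiplied by `damp` = ⟨ξ⟩^{-4}, which turns the vector field
into a continuous quadratic map on L². On the physical side this corresponds to testing with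
(1-Δ)²φ. The correspondence works in both directions, so every distributional solution in the class
becomes a Fourier solution and uniqueness applies to it. Finally M ≤ C⟨ξ⟩ and ε^{1/2}⟨ξ⟩ ≤ C M
translate bounds on h in H^s into the stated bounds on η. -/

/-! ### Differential equations in Banach and Hilbert spaces -/

/-- Grönwall's inequality on `[0, S]` with a constant forcing term. -/
theorem gronwall_Icc {f f' : ℝ → ℝ} {S K e : ℝ} (hK : 0 ≤ K) (he : 0 ≤ e)
    (hf : ∀ t ∈ Set.Icc 0 S, HasDerivWithinAt f (f' t) (Set.Icc 0 S) t)
    (hb : ∀ t ∈ Set.Icc 0 S, f' t ≤ K * f t + e) :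
    ∀ t ∈ Set.Icc 0 S, f t ≤ Real.exp (K * t) * (f 0 + e * t) := by
  intro t ht
  have hS : 0 ≤ S := ht.1.trans ht.2
  -- The integrating factor is at most 1 because `K` is nonnegative, so the forcing contributes at
  -- most `e * t`, and `g` is antitone.
  let g : ℝ → ℝ := fun t => Real.exp (-(K * t)) * f t - e * t
  have hg : ∀ x ∈ Set.Icc 0 S, HasDerivWithinAt g
      (Real.exp (-(K * x)) * (f' x - K * f x) - e) (Set.Icc 0 S) x := by
    intro x hx
    have h1 : HasDerivWithinAt (fun t : ℝ => Real.exp (-(K * t)))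
        (Real.exp (-(K * x)) * (-K)) (Set.Icc 0 S) x := by
      have := (((hasDerivAt_id x).const_mul K).neg).exp.hasDerivWithinAt (s := Set.Icc 0 S)
      simpa using this
    have h2 := (h1.mul (hf x hx)).sub (((hasDerivAt_id x).const_mul e).hasDerivWithinAt)
    refine h2.congr_deriv ?_
    ring
  have hanti : AntitoneOn g (Set.Icc 0 S) := by
    apply antitoneOn_of_deriv_nonpos (convex_Icc 0 S)
    · exact fun x hx => (hg x hx).continuousWithinAt
    · intro x hx
      rw [interior_Icc] at hx
      exact ((hg x (Set.Ioo_subset_Icc_self hx)).hasDerivAt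
        (Icc_mem_nhds hx.1 hx.2)).differentiableAt.differentiableWithinAt
    · intro x hx
      rw [interior_Icc] at hx
      have hx' := Set.Ioo_subset_Icc_self hx
      rw [((hg x hx').hasDerivAt (Icc_mem_nhds hx.1 hx.2)).deriv]
      have h1 : f' x - K * f x ≤ e := by linarith [hb x hx']
      have h2 : Real.exp (-(K * x)) ≤ 1 := Real.exp_le_one_iff.2 (by nlinarith [hx.1])
      nlinarith [Real.exp_pos (-(K * x))]
  have h := hanti (Set.left_mem_Icc.2 hS) ht ht.1
  have h0 : g 0 = f 0 := by simp [g]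
  rw [h0] at h
  have h3 : Real.exp (-(K * t)) * f t ≤ f 0 + e * t := by simp only [g] at h; linarith
  have h4 := mul_le_mul_of_nonneg_left h3 (Real.exp_pos (K * t)).le
  rwa [← mul_assoc, ← Real.exp_add, add_neg_cancel, Real.exp_zero, one_mul] at h4

/-- The radial retraction of a normed space onto its closed ball of radius `R`. -/
def radialRetract {E : Type*} [NormedAddCommGroup E] [NormedSpace ℝ E] (R : ℝ) (x : E) : E :=
  (R / max R ‖x‖) • x

section Retract

variable {E : Type*} [NormedAddCommGroup E] [NormedSpace ℝ E] {R : ℝ}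

theorem radialRetract_of_le (hR : 0 < R) {x : E} (hx : ‖x‖ ≤ R) : radialRetract R x = x := by
  rw [radialRetract, max_eq_left hx, div_self hR.ne', one_smul]

theorem norm_radialRetract_le (hR : 0 < R) (x : E) : ‖radialRetract R x‖ ≤ R := by
  have hm : 0 < max R ‖x‖ := lt_max_of_lt_left hR
  rw [radialRetract, norm_smul, Real.norm_of_nonneg (by positivity), div_mul_eq_mul_div,
    div_le_iff₀ hm]
  exact mul_le_mul_of_nonneg_left (le_max_right _ _) hR.le

/-- The difference splits into the scaled difference of the points and the change of the scaling
factor. Each is at most `‖x - y‖`, which gives the constant 2 in any normed space. -/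
theorem norm_radialRetract_sub_le (hR : 0 < R) (x y : E) :
    ‖radialRetract R x - radialRetract R y‖ ≤ 2 * ‖x - y‖ := by
  have hx : 0 < max R ‖x‖ := lt_max_of_lt_left hR
  have hy : 0 < max R ‖y‖ := lt_max_of_lt_left hR
  have h : radialRetract R x - radialRetract R y
      = (R / max R ‖x‖) • (x - y) + (R / max R ‖x‖ - R / max R ‖y‖) • y := by
    simp only [radialRetract, smul_sub, sub_smul]; abel
  have h1 : R / max R ‖x‖ ≤ 1 := (div_le_one hx).2 (le_max_left _ _)
  have h2 : |R / max R ‖x‖ - R / max R ‖y‖| * ‖y‖ ≤ ‖x - y‖ := by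
    have e : R / max R ‖x‖ - R / max R ‖y‖
        = (R / max R ‖x‖) * ((max R ‖y‖ - max R ‖x‖) / max R ‖y‖) := by
      field_simp
    rw [e, abs_mul, abs_of_pos (by positivity : 0 < R / max R ‖x‖), abs_div, abs_of_pos hy]
    have h3 : |max R ‖y‖ - max R ‖x‖| ≤ ‖x - y‖ := by
      rw [max_comm R, max_comm R]
      refine (abs_max_sub_max_le_abs _ _ _).trans ?_
      rw [norm_sub_rev]
      exact abs_norm_sub_norm_le y x
    calc R / max R ‖x‖ * (|max R ‖y‖ - max R ‖x‖| / max R ‖y‖) * ‖y‖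
        ≤ 1 * (|max R ‖y‖ - max R ‖x‖| / max R ‖y‖) * max R ‖y‖ := by
          gcongr; exact le_max_right _ _
      _ = |max R ‖y‖ - max R ‖x‖| := by field_simp
      _ ≤ _ := h3
  rw [h]
  refine (norm_add_le _ _).trans ?_
  rw [norm_smul, norm_smul, Real.norm_of_nonneg (by positivity), Real.norm_eq_abs]
  nlinarith [norm_nonneg (x - y)]

end Retract

/-- A function of one real variable into a Hilbert space solving `u' = L u + B(u, u)`, where the
linear part is skew and the quadratic part satisfies a cubic energy estimate. -/
theorem exists_solution_of_energy {E : Type*} [NormedAddCommGroup E] [InnerProductSpace ℝ E]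
    [CompleteSpace E] (L : E →L[ℝ] E) (B : E →L[ℝ] E →L[ℝ] E) {κ R S : ℝ} (hκ : 0 ≤ κ)
    (hR : 0 < R) (hS : 0 ≤ S) (hL : ∀ x, inner ℝ (L x) x = 0)
    (hB : ∀ x, inner ℝ (B x x) x ≤ κ * ‖x‖ ^ 3) (hT : 4 * κ * R * S ≤ Real.log 4)
    (x₀ : E) (hx₀ : ‖x₀‖ ≤ R) :
    ∃ u : ℝ → E, u 0 = x₀ ∧ (∀ t ∈ Set.Icc 0 S, ‖u t‖ ≤ 2 * R) ∧
      ∀ t ∈ Set.Icc 0 S, HasDerivWithinAt u (L (u t) + B (u t) (u t)) (Set.Icc 0 S) t := by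
  have hR2 : 0 < 2 * R := by linarith
  let F : E → E := fun x => L x + B x x
  -- Composition with the retraction makes the field globally bounded and Lipschitz, so
  -- Picard–Lindelöf covers all of `[0, S]` at once. The a priori bound then shows that the
  -- retraction is never active.
  let f : E → E := fun x => F (radialRetract (2 * R) x)
  let Kl : ℝ := (‖L‖ + ‖B‖ * (4 * R)) * 2
  let Bd : ℝ := ‖L‖ * (2 * R) + ‖B‖ * (2 * R) ^ 2
  have hKl : 0 ≤ Kl := by positivity
  have hBd : 0 ≤ Bd := by positivity
  have hf_lip : ∀ x y, ‖f x - f y‖ ≤ Kl * ‖x - y‖ := by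
    intro x y
    set X := radialRetract (2 * R) x
    set Y := radialRetract (2 * R) y
    have hX : ‖X‖ ≤ 2 * R := norm_radialRetract_le hR2 x
    have hY : ‖Y‖ ≤ 2 * R := norm_radialRetract_le hR2 y
    have e : f x - f y = L (X - Y) + (B X (X - Y) + B (X - Y) Y) := by
      simp only [f, F, map_sub, sub_apply]; abel
    have h1 : ‖f x - f y‖ ≤ ‖L‖ * ‖X - Y‖ + (‖B‖ * ‖X‖ * ‖X - Y‖ + ‖B‖ * ‖X - Y‖ * ‖Y‖) := by
      rw [e]
      exact (norm_add_le _ _).trans (add_le_add (L.le_opNorm _)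
        ((norm_add_le _ _).trans (add_le_add (B.le_opNorm₂ _ _) (B.le_opNorm₂ _ _))))
    have h2 : ‖X - Y‖ ≤ 2 * ‖x - y‖ := norm_radialRetract_sub_le hR2 x y
    calc ‖f x - f y‖ ≤ (‖L‖ + ‖B‖ * (‖X‖ + ‖Y‖)) * ‖X - Y‖ := by linarith
      _ ≤ (‖L‖ + ‖B‖ * (4 * R)) * (2 * ‖x - y‖) := by
          gcongr
          linarith
      _ = Kl * ‖x - y‖ := by ring
  have hf_bd : ∀ x, ‖f x‖ ≤ Bd := by
    intro x
    have hX := norm_radialRetract_le hR2 x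
    refine (norm_add_le _ _).trans (add_le_add ?_ ?_)
    · exact (L.le_opNorm _).trans (mul_le_mul_of_nonneg_left hX (norm_nonneg _))
    · refine (B.le_opNorm₂ _ _).trans ?_
      rw [mul_assoc, ← sq]
      gcongr
  have hPL : IsPicardLindelof (fun _ : ℝ => f) (⟨0, Set.left_mem_Icc.2 hS⟩ : Set.Icc (0:ℝ) S) x₀
      (⟨Bd * S, by positivity⟩ : ℝ≥0) 0 ⟨Bd, hBd⟩ ⟨Kl, hKl⟩ := by
    refine ⟨fun t _ => ?_, fun x _ => continuousOn_const, fun t _ x _ => hf_bd x, ?_⟩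
    · apply LipschitzOnWith.of_dist_le_mul
      intro x _ y _
      rw [dist_eq_norm, dist_eq_norm]
      exact hf_lip x y
    · simp only [sub_zero, sub_self, max_eq_left hS, NNReal.coe_zero]
      exact le_rfl
  obtain ⟨u, hu0, hu⟩ := hPL.exists_eq_forall_mem_Icc_hasDerivWithinAt₀
  simp only at hu0
  have hbound : ∀ t ∈ Set.Icc 0 S, ‖u t‖ ≤ 2 * R := by
    have hd : ∀ t ∈ Set.Icc 0 S, HasDerivWithinAt (fun t => ‖u t‖ ^ 2)
        (2 * inner ℝ (u t) (f (u t))) (Set.Icc 0 S) t := fun t ht => (hu t ht).norm_sq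
    -- At `x` the truncated field is `θ L x + θ² B x x`. Skewness survives, and one factor `θ ‖x‖ ≤
    -- 2 * R` turns the cubic bound into a quadratic one, to which the linear Grönwall inequality
    -- applies.
    have hle : ∀ t ∈ Set.Icc 0 S, 2 * inner ℝ (u t) (f (u t)) ≤ (4 * κ * R) * ‖u t‖ ^ 2 + 0 := by
      intro t _
      set x := u t
      set θ := 2 * R / max (2 * R) ‖x‖
      have hm : 0 < max (2 * R) ‖x‖ := lt_max_of_lt_left hR2
      have hθ0 : 0 < θ := by positivity
      have hθ1 : θ ≤ 1 := (div_le_one hm).2 (le_max_left _ _)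
      have hθx : θ * ‖x‖ ≤ 2 * R := by
        have := norm_radialRetract_le hR2 x
        rwa [radialRetract, norm_smul, Real.norm_of_nonneg hθ0.le] at this
      have e : inner ℝ x (f x) = θ * θ * inner ℝ (B x x) x := by
        have : f x = θ • L x + (θ * θ) • B x x := by
          simp only [f, F, radialRetract, map_smul, smul_apply, smul_smul]
          rfl
        rw [this, inner_add_right, inner_smul_right, inner_smul_right, real_inner_comm, hL,
          real_inner_comm]
        ring
      rw [e]
      have h1 : θ * θ * inner ℝ (B x x) x ≤ θ * θ * (κ * ‖x‖ ^ 3) :=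
        mul_le_mul_of_nonneg_left (hB x) (by positivity)
      have h2 : θ * θ * (κ * ‖x‖ ^ 3) = κ * ‖x‖ ^ 2 * (θ * (θ * ‖x‖)) := by ring
      have h3 : θ * (θ * ‖x‖) ≤ 1 * (2 * R) := by gcongr
      have h4 : κ * ‖x‖ ^ 2 * (θ * (θ * ‖x‖)) ≤ κ * ‖x‖ ^ 2 * (1 * (2 * R)) :=
        mul_le_mul_of_nonneg_left h3 (by positivity)
      linarith
    intro t ht
    have h := gronwall_Icc (by positivity) le_rfl hd hle t ht
    simp only [zero_mul, add_zero, hu0] at h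
    -- The number 4 is chosen so that `‖u‖²` at most quadruples, that is `‖u‖ ≤ 2 * R`, the radius
    -- of the retraction.
    have h1 : Real.exp (4 * κ * R * t) ≤ 4 := by
      rw [← Real.le_log_iff_exp_le (by norm_num)]
      refine le_trans ?_ hT
      gcongr
      exact ht.2
    have h2 : ‖u t‖ ^ 2 ≤ (2 * R) ^ 2 := by
      calc ‖u t‖ ^ 2 ≤ _ := h
        _ ≤ 4 * R ^ 2 := by gcongr
        _ = _ := by ring
    exact le_of_sq_le_sq h2 hR2.le
  refine ⟨u, hu0, hbound, fun t ht => ?_⟩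
  have := hu t ht
  simp only [f, F, radialRetract_of_le hR2 (hbound t ht)] at this
  exact this

/-- A continuous linear functional that kills the vector field is constant along solutions. -/
theorem clm_const_of_deriv {E G : Type*} [NormedAddCommGroup E] [NormedSpace ℝ E]
    [NormedAddCommGroup G] [NormedSpace ℝ G] {u u' : ℝ → E} {S : ℝ} (A : E →L[ℝ] G)
    (hu : ∀ t ∈ Set.Icc 0 S, HasDerivWithinAt u (u' t) (Set.Icc 0 S) t)
    (h : ∀ t ∈ Set.Icc 0 S, A (u' t) = 0) : ∀ t ∈ Set.Icc 0 S, A (u t) = A (u 0) := by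
  have hd : ∀ t ∈ Set.Icc 0 S, HasDerivWithinAt (fun t => A (u t)) 0 (Set.Icc 0 S) t := by
    intro t ht
    have := A.hasFDerivAt.comp_hasDerivWithinAt t (hu t ht)
    rwa [h t ht] at this
  apply constant_of_has_deriv_right_zero (fun t ht => (hd t ht).continuousWithinAt)
  intro x hx
  exact (hd x ⟨hx.1, hx.2.le⟩).mono_of_mem_nhdsWithin (Icc_mem_nhdsGE_of_mem hx)

/-! ### The L² space of Fourier transforms -/

/-- Complex-valued `L²(ℝ²)`, where the Fourier transforms live. -/
abbrev H : Type := Lp ℂ 2 (volume : Measure Plane)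

/-- All energies use the real inner product of this complex space, since conjugation, and with it
the restriction to transforms of real functions, is only real-linear. -/
theorem inner_eq_integral (f g : H) :
    inner ℝ f g = ∫ x, (f x * (starRingEnd ℂ) (g x)).re := by
  rw [L2.inner_def]
  congr 1 with x
  simp [Complex.inner]
  ring

theorem integrable_inner_re (f g : H) :
    Integrable (fun x => (f x * (starRingEnd ℂ) (g x)).re) := by
  refine (L2.integrable_inner (𝕜 := ℝ) f g).congr (ae_of_all _ fun x => ?_)
  simp [Complex.inner]
  ring

theorem norm_sq_eq_lintegral (f : H) : ENNReal.ofReal (‖f‖ ^ 2) = ∫⁻ x, ‖f x‖ₑ ^ 2 := by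
  rw [ENNReal.ofReal_pow (norm_nonneg _), ofReal_norm, Lp.enorm_def,
    eLpNorm_eq_lintegral_rpow_enorm_toReal (by norm_num) (by norm_num), ← ENNReal.rpow_natCast,
    ← ENNReal.rpow_mul]
  norm_num

/-! ### Bounded real Fourier multipliers -/

section Multiplier

/-- Bounded measurable real multipliers. -/
def IsMultiplier (m : Plane → ℝ) : Prop := Measurable m ∧ ∃ C, ∀ x, |m x| ≤ C

theorem IsMultiplier.mul {m n : Plane → ℝ} (hm : IsMultiplier m) (hn : IsMultiplier n) :
    IsMultiplier (fun x => m x * n x) := by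
  obtain ⟨h1, C, hC⟩ := hm
  obtain ⟨h2, D, hD⟩ := hn
  refine ⟨h1.mul h2, C * D, fun x => ?_⟩
  rw [abs_mul]
  exact mul_le_mul (hC x) (hD x) (abs_nonneg _) ((abs_nonneg _).trans (hC x))

theorem IsMultiplier.memLp {m : Plane → ℝ} (hm : IsMultiplier m) (f : H) :
    MemLp (fun x => (m x : ℂ) * f x) 2 volume := by
  obtain ⟨h1, C, hC⟩ := hm
  refine (Lp.memLp f).of_le_mul (c := C)
    ((Complex.measurable_ofReal.comp h1).aestronglyMeasurable.mul (Lp.aestronglyMeasurable f))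
    (ae_of_all _ fun x => ?_)
  rw [norm_mul, Complex.norm_real]
  exact mul_le_mul_of_nonneg_right (hC x) (norm_nonneg _)

/-- The multiplication operator by a bounded measurable real function on `L²`. -/
def mulLin {m : Plane → ℝ} (hm : IsMultiplier m) : H →ₗ[ℝ] H where
  toFun f := (hm.memLp f).toLp
  map_add' f g := by
    rw [← MemLp.toLp_add]
    apply MemLp.toLp_congr
    filter_upwards [Lp.coeFn_add f g] with x hx
    change (m x : ℂ) * (f + g : H) x = m x * f x + m x * g x
    rw [hx, Pi.add_apply, mul_add]
  map_smul' c f := by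
    rw [RingHom.id_apply, ← MemLp.toLp_const_smul]
    apply MemLp.toLp_congr
    filter_upwards [Lp.coeFn_smul c f] with x hx
    change (m x : ℂ) * (c • f : H) x = c • (m x * f x)
    rw [hx, Pi.smul_apply, mul_smul_comm]

open Classical in
/-- The multiplication operator by a bounded measurable real function on `L²`
(zero if the multiplier is not admissible). -/
def mulL (m : Plane → ℝ) : H →L[ℝ] H :=
  if hm : IsMultiplier m then
    (mulLin hm).mkContinuous hm.2.choose (fun f => by
      have hC := hm.2.choose_spec
      apply Lp.norm_le_mul_norm_of_ae_le_mul
      filter_upwards [(hm.memLp f).coeFn_toLp] with x hx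
      change ‖(hm.memLp f).toLp _ x‖ ≤ _
      rw [hx, norm_mul, Complex.norm_real]
      exact mul_le_mul_of_nonneg_right (hC x) (norm_nonneg _))
  else 0

theorem mulL_coe {m : Plane → ℝ} (hm : IsMultiplier m) (f : H) :
    mulL m f =ᵐ[volume] fun x => (m x : ℂ) * f x := by
  rw [mulL, dif_pos hm]
  exact (hm.memLp f).coeFn_toLp

theorem norm_mulL_le {m : Plane → ℝ} (hm : IsMultiplier m) {C : ℝ} (hC : ∀ x, |m x| ≤ C) (f : H) :
    ‖mulL m f‖ ≤ C * ‖f‖ := by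
  apply Lp.norm_le_mul_norm_of_ae_le_mul
  filter_upwards [mulL_coe hm f] with x hx
  rw [hx, norm_mul, Complex.norm_real]
  exact mul_le_mul_of_nonneg_right (hC x) (norm_nonneg _)

theorem mulL_mulL {m n : Plane → ℝ} (hm : IsMultiplier m) (hn : IsMultiplier n) (f : H) :
    mulL m (mulL n f) = mulL (fun x => m x * n x) f := by
  apply Lp.ext
  filter_upwards [mulL_coe hm (mulL n f), mulL_coe hn f, mulL_coe (hm.mul hn) f] with x h1 h2 h3
  rw [h1, h2, h3]
  push_cast
  ring

theorem mulL_congr {m n : Plane → ℝ} (h : ∀ x, m x = n x) (f : H) : mulL m f = mulL n f := by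
  rw [funext h]

/-- Real symbols give self-adjoint operators. This lets weights be moved freely onto the last factor
of a trilinear form. -/
theorem inner_mulL {m : Plane → ℝ} (hm : IsMultiplier m) (f g : H) :
    inner ℝ (mulL m f) g = inner ℝ f (mulL m g) := by
  rw [inner_eq_integral, inner_eq_integral]
  apply integral_congr_ae
  filter_upwards [mulL_coe hm f, mulL_coe hm g] with x h1 h2
  rw [h1, h2]
  simp
  ring

theorem mulL_one (f : H) : mulL (fun _ => 1) f = f := by
  apply Lp.ext
  filter_upwards [mulL_coe (m := fun _ => 1) ⟨measurable_const, 1, fun _ => by norm_num⟩ f]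
    with x hx
  rw [hx]; simp

theorem mulL_sub {m n : Plane → ℝ} (hm : IsMultiplier m) (hn : IsMultiplier n)
    (hmn : IsMultiplier fun x => m x - n x) (f : H) :
    mulL (fun x => m x - n x) f = mulL m f - mulL n f := by
  apply Lp.ext
  filter_upwards [mulL_coe hm f, mulL_coe hn f, mulL_coe hmn f,
    Lp.coeFn_sub (mulL m f) (mulL n f)] with x h1 h2 h3 h4
  rw [h4, Pi.sub_apply, h1, h2, h3]
  push_cast
  ring

end Multiplier

/-! ### Hermitian symmetry of transforms of real functions -/

section Reflection

/-- The Fourier-side expression of complex conjugation: `(σ f)(ξ)` is the conjugate of `f(-ξ)`. -/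
def reflect : H →L[ℝ] H :=
  (Complex.conjCLE.toContinuousLinearMap.compLpL 2 volume).comp
    (Lp.compMeasurePreservingₗᵢ ℝ (Neg.neg : Plane → Plane)
      (Measure.measurePreserving_neg volume)).toContinuousLinearMap

theorem ae_comp_neg {p : Plane → Prop} (h : ∀ᵐ x, p x) : ∀ᵐ x, p (-x) :=
  (Measure.measurePreserving_neg (volume : Measure Plane)).quasiMeasurePreserving.ae h

theorem reflect_coe (f : H) : reflect f =ᵐ[volume] fun x => (starRingEnd ℂ) (f (-x)) := by
  have h1 := Complex.conjCLE.toContinuousLinearMap.coeFn_compLpL (p := 2)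
    (Lp.compMeasurePreserving (Neg.neg : Plane → Plane) (Measure.measurePreserving_neg volume) f)
  have h2 := Lp.coeFn_compMeasurePreserving f (Measure.measurePreserving_neg (volume : Measure Plane))
  filter_upwards [h1, h2] with x hx1 hx2
  rw [hx2] at hx1
  exact hx1

theorem reflect_reflect (f : H) : reflect (reflect f) = f := by
  apply Lp.ext
  filter_upwards [reflect_coe (reflect f), ae_comp_neg (reflect_coe f)] with x h1 h2
  rw [h1, h2]
  simp

theorem reflect_eq_iff (f : H) : reflect f = f ↔ ∀ᵐ x, f (-x) = (starRingEnd ℂ) (f x) := by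
  constructor
  · intro h
    filter_upwards [reflect_coe f] with x hx
    rw [h] at hx
    rw [hx]
    simp
  · intro h
    apply Lp.ext
    filter_upwards [reflect_coe f, h] with x h1 h2
    rw [h1, h2]
    simp

theorem inner_reflect (f g : H) : inner ℝ (reflect f) g = inner ℝ f (reflect g) := by
  rw [inner_eq_integral, inner_eq_integral, ← integral_neg_eq_self]
  apply integral_congr_ae
  filter_upwards [ae_comp_neg (reflect_coe f), reflect_coe g] with x h1 h2
  rw [h1, h2]
  simp

/-- The symbol is real, so conjugation does not affect it; evenness takes care of the change of sign
of the frequency. -/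
theorem reflect_mulL {m : Plane → ℝ} (hm : IsMultiplier m) (he : ∀ x, m (-x) = m x) (f : H) :
    reflect (mulL m f) = mulL m (reflect f) := by
  apply Lp.ext
  filter_upwards [reflect_coe (mulL m f), ae_comp_neg (mulL_coe hm f), mulL_coe hm (reflect f),
    reflect_coe f] with x h1 h2 h3 h4
  rw [h1, h2, h3, h4, he]
  simp

/-- The real-linear projection onto the Fourier transforms of real functions. -/
def realProj : H →L[ℝ] H := (1 / 2 : ℝ) • (ContinuousLinearMap.id ℝ H + reflect)

theorem realProj_apply (f : H) : realProj f = (1 / 2 : ℝ) • (f + reflect f) := rfl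

theorem realProj_of_reflect {f : H} (hf : reflect f = f) : realProj f = f := by
  rw [realProj_apply, hf, ← two_smul ℝ f, smul_smul]
  norm_num

theorem reflect_realProj (f : H) : reflect (realProj f) = realProj f := by
  rw [realProj_apply, map_smul, map_add, reflect_reflect, add_comm]

theorem inner_realProj (f g : H) : inner ℝ (realProj f) g = inner ℝ f (realProj g) := by
  rw [realProj_apply, realProj_apply, inner_smul_left, inner_smul_right, inner_add_left,
    inner_add_right, inner_reflect]
  rfl

theorem norm_reflect (f : H) : ‖reflect f‖ = ‖f‖ := by
  have h : inner ℝ (reflect f) (reflect f) = inner ℝ f f := by rw [inner_reflect, reflect_reflect]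
  rw [real_inner_self_eq_norm_sq, real_inner_self_eq_norm_sq] at h
  exact (sq_eq_sq₀ (norm_nonneg _) (norm_nonneg _)).1 h

theorem norm_realProj_le (f : H) : ‖realProj f‖ ≤ ‖f‖ := by
  rw [realProj_apply, norm_smul]
  have := norm_add_le f (reflect f)
  rw [norm_reflect] at this
  norm_num
  linarith

theorem realProj_mulL {m : Plane → ℝ} (hm : IsMultiplier m) (he : ∀ x, m (-x) = m x) (f : H) :
    realProj (mulL m f) = mulL m (realProj f) := by
  rw [realProj_apply, realProj_apply, reflect_mulL hm he, map_smul, map_add]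

end Reflection

/-! ### Trilinear forms on the Fourier side -/

section Trilinear

/-- The `L²` norm of a nonnegative function, as an extended nonnegative real. -/
def sqNorm (f : Plane → ℝ≥0∞) : ℝ≥0∞ := (∫⁻ x, f x ^ (2:ℝ)) ^ (1 / 2 : ℝ)

theorem lintegral_mul_le_sqNorm {f g : Plane → ℝ≥0∞} (hf : Measurable f) (hg : Measurable g) :
    ∫⁻ x, f x * g x ≤ sqNorm f * sqNorm g :=
  ENNReal.lintegral_mul_le_Lp_mul_Lq volume Real.HolderConjugate.two_two hf.aemeasurable
    hg.aemeasurable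

/-- The convolution of two L² functions is bounded pointwise by the product of their norms, by
Cauchy–Schwarz in ζ. It remains to integrate `a`. -/
theorem lintegral_conv_le {a F G : Plane → ℝ≥0∞} (ha : Measurable a) (hF : Measurable F)
    (hG : Measurable G) :
    ∫⁻ ξ, ∫⁻ ζ, a ξ * (F (ξ - ζ) * G ζ) ≤ (∫⁻ ξ, a ξ) * (sqNorm F * sqNorm G) := by
  calc ∫⁻ ξ, ∫⁻ ζ, a ξ * (F (ξ - ζ) * G ζ)
      ≤ ∫⁻ ξ, a ξ * (sqNorm F * sqNorm G) := by
        apply lintegral_mono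
        intro ξ
        have hm : Measurable fun ζ => F (ξ - ζ) := hF.comp (measurable_const.sub measurable_id)
        change ∫⁻ ζ, a ξ * ((fun ζ => F (ξ - ζ)) * G) ζ ≤ _
        rw [lintegral_const_mul _ (hm.mul hG)]
        refine mul_le_mul' le_rfl ((lintegral_mul_le_sqNorm hm hG).trans_eq ?_)
        rw [sqNorm, lintegral_sub_left_eq_self (fun x => F x ^ (2:ℝ)) ξ, sqNorm, sqNorm]
    _ = _ := lintegral_mul_const _ ha

/-- This lemma and its two companions put the weight at each of the three frequencies. The weight
and the factor at the same frequency multiply to an integrable function, and the other two factors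
are convolved. -/
theorem lintegral_tri_fst_le {g F G E : Plane → ℝ≥0∞} (hg : Measurable g) (hF : Measurable F)
    (hG : Measurable G) (hE : Measurable E) :
    ∫⁻ ξ, ∫⁻ ζ, g ξ * (F (ξ - ζ) * G ζ * E ξ) ≤ sqNorm g * (sqNorm F * sqNorm G * sqNorm E) := by
  calc ∫⁻ ξ, ∫⁻ ζ, g ξ * (F (ξ - ζ) * G ζ * E ξ)
      = ∫⁻ ξ, ∫⁻ ζ, (g ξ * E ξ) * (F (ξ - ζ) * G ζ) := by
        congr with ξ; congr with ζ; ring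
    _ ≤ _ := lintegral_conv_le (hg.mul hE) hF hG
    _ ≤ (sqNorm g * sqNorm E) * (sqNorm F * sqNorm G) := by
        gcongr; exact lintegral_mul_le_sqNorm hg hE
    _ = _ := by ring

theorem lintegral_tri_snd_le {g F G E : Plane → ℝ≥0∞} (hg : Measurable g) (hF : Measurable F)
    (hG : Measurable G) (hE : Measurable E) :
    ∫⁻ ξ, ∫⁻ ζ, g ζ * (F (ξ - ζ) * G ζ * E ξ) ≤ sqNorm g * (sqNorm F * sqNorm G * sqNorm E) := by
  have hF' : Measurable fun x => F (-x) := hF.comp measurable_neg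
  calc ∫⁻ ξ, ∫⁻ ζ, g ζ * (F (ξ - ζ) * G ζ * E ξ)
      = ∫⁻ ζ, ∫⁻ ξ, g ζ * (F (ξ - ζ) * G ζ * E ξ) := by
        apply lintegral_lintegral_swap
        apply Measurable.aemeasurable
        exact (hg.comp measurable_snd).mul (((hF.comp (measurable_fst.sub measurable_snd)).mul
          (hG.comp measurable_snd)).mul (hE.comp measurable_fst))
    _ = ∫⁻ ζ, ∫⁻ ξ, (g ζ * G ζ) * ((fun x => F (-x)) (ζ - ξ) * E ξ) := by
        congr with ζ; congr with ξ; simp only [neg_sub]; ring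
    _ ≤ _ := lintegral_conv_le (hg.mul hG) hF' hE
    _ ≤ (sqNorm g * sqNorm G) * (sqNorm F * sqNorm E) := by
        have e : sqNorm (fun x => F (-x)) = sqNorm F := by
          rw [sqNorm, sqNorm, lintegral_neg_eq_self (fun x => F x ^ (2:ℝ))]
        rw [e]
        gcongr; exact lintegral_mul_le_sqNorm hg hG
    _ = _ := by ring

theorem lintegral_tri_sub_le {g F G E : Plane → ℝ≥0∞} (hg : Measurable g) (hF : Measurable F)
    (hG : Measurable G) (hE : Measurable E) :
    ∫⁻ ξ, ∫⁻ ζ, g (ξ - ζ) * (F (ξ - ζ) * G ζ * E ξ) ≤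
      sqNorm g * (sqNorm F * sqNorm G * sqNorm E) := by
  calc ∫⁻ ξ, ∫⁻ ζ, g (ξ - ζ) * (F (ξ - ζ) * G ζ * E ξ)
      = ∫⁻ ξ, ∫⁻ ζ, g ζ * (G (ξ - ζ) * F ζ * E ξ) := by
        congr with ξ
        rw [← lintegral_sub_left_eq_self (fun ζ => g ζ * (G (ξ - ζ) * F ζ * E ξ)) ξ]
        congr with ζ
        rw [sub_sub_cancel]
        ring
    _ ≤ _ := lintegral_tri_snd_le hg hG hF hE
    _ = _ := by ring

/-- Square-integrable nonnegative weights. -/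
structure IsWeight (g : Plane → ℝ) : Prop where
  measurable : Measurable g
  nonneg : ∀ x, 0 ≤ g x
  memLp : MemLp g 2 volume

/-- The `L²` norm of a weight. -/
def wnorm (g : Plane → ℝ) : ℝ := (eLpNorm g 2 volume).toReal

theorem wnorm_nonneg (g : Plane → ℝ) : 0 ≤ wnorm g := ENNReal.toReal_nonneg

theorem sqNorm_enorm {F : Type*} [NormedAddCommGroup F] (f : Plane → F) :
    sqNorm (fun x => ‖f x‖ₑ) = eLpNorm f 2 volume := by
  rw [eLpNorm_eq_lintegral_rpow_enorm_toReal (by norm_num) (by norm_num)]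
  norm_num [sqNorm]

/-- A kernel `s(ξ, ζ)` dominated by `C (g(ξ) + g(ζ) + g(ξ - ζ))`. -/
structure Dominated (s : Plane → Plane → ℝ) (C : ℝ) (g : Plane → ℝ) : Prop where
  measurable : Measurable fun z : Plane × Plane => s z.1 z.2
  bound : ∀ ξ ζ, |s ξ ζ| ≤ C * (g ξ + g ζ + g (ξ - ζ))

/-- The integrand of the trilinear form with kernel `s`. -/
def triIntegrand (s : Plane → Plane → ℝ) (f g e : Plane → ℂ) (z : Plane × Plane) : ℝ :=
  s z.1 z.2 * (f (z.1 - z.2) * g z.2 * (starRingEnd ℂ) (e z.1)).re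

/-- The trilinear form `∬ s(ξ, ζ) Re (f(ξ - ζ) g(ζ) conj(e(ξ))) dζ dξ`. -/
def tri (s : Plane → Plane → ℝ) (f g e : Plane → ℂ) : ℝ := ∫ z, triIntegrand s f g e z

variable {s : Plane → Plane → ℝ} {C : ℝ} {w : Plane → ℝ}

theorem measurable_coe (f : H) : Measurable (f : Plane → ℂ) := (Lp.stronglyMeasurable f).measurable

theorem measurable_triIntegrand (hs : Measurable fun z : Plane × Plane => s z.1 z.2) (f g e : H) :
    Measurable (triIntegrand s f g e) := by
  have h1 := (measurable_coe f).comp (measurable_fst.sub measurable_snd :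
    Measurable fun z : Plane × Plane => z.1 - z.2)
  have h2 := (measurable_coe g).comp (measurable_snd : Measurable fun z : Plane × Plane => z.2)
  have h3 := (measurable_coe e).comp (measurable_fst : Measurable fun z : Plane × Plane => z.1)
  exact hs.mul (Complex.measurable_re.comp
    ((h1.mul h2).mul (Complex.continuous_conj.measurable.comp h3)))

/-- The factor 3 counts the three places at which the weight can sit. -/
theorem lintegral_triIntegrand_le (hC : 0 ≤ C) (hs : Dominated s C w) (hw : IsWeight w)
    (f g e : H) :
    ∫⁻ z, ‖triIntegrand s f g e z‖ₑ ≤ ENNReal.ofReal (3 * C * wnorm w * ‖f‖ * ‖g‖ * ‖e‖) := by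
  have mw : Measurable fun x => ‖w x‖ₑ := hw.measurable.enorm
  have mf : Measurable fun x => ‖f x‖ₑ := (measurable_coe f).enorm
  have mg : Measurable fun x => ‖g x‖ₑ := (measurable_coe g).enorm
  have me : Measurable fun x => ‖e x‖ₑ := (measurable_coe e).enorm
  let P : Plane × Plane → ℝ≥0∞ := fun z => ‖f (z.1 - z.2)‖ₑ * ‖g z.2‖ₑ * ‖e z.1‖ₑ
  have mP : Measurable P := ((mf.comp (measurable_fst.sub measurable_snd)).mul
    (mg.comp measurable_snd)).mul (me.comp measurable_fst)
  have m1 : Measurable fun z : Plane × Plane => ‖w z.1‖ₑ * P z := (mw.comp measurable_fst).mul mP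
  have m2 : Measurable fun z : Plane × Plane => ‖w z.2‖ₑ * P z := (mw.comp measurable_snd).mul mP
  have m3 : Measurable fun z : Plane × Plane => ‖w (z.1 - z.2)‖ₑ * P z :=
    (mw.comp (measurable_fst.sub measurable_snd)).mul mP
  have hpt : ∀ z, ‖triIntegrand s f g e z‖ₑ ≤
      ENNReal.ofReal C * (‖w z.1‖ₑ * P z + ‖w z.2‖ₑ * P z + ‖w (z.1 - z.2)‖ₑ * P z) := by
    intro z
    have e1 : ‖s z.1 z.2‖ₑ ≤ ENNReal.ofReal C * (‖w z.1‖ₑ + ‖w z.2‖ₑ + ‖w (z.1 - z.2)‖ₑ) := by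
      simp only [Real.enorm_eq_ofReal_abs, abs_of_nonneg (hw.nonneg _)]
      rw [← ENNReal.ofReal_add (hw.nonneg _) (hw.nonneg _),
        ← ENNReal.ofReal_add (add_nonneg (hw.nonneg _) (hw.nonneg _)) (hw.nonneg _),
        ← ENNReal.ofReal_mul hC]
      exact ENNReal.ofReal_le_ofReal (hs.bound _ _)
    have e2 : ‖(f (z.1 - z.2) * g z.2 * (starRingEnd ℂ) (e z.1)).re‖ₑ ≤ P z := by
      have : P z = ‖f (z.1 - z.2) * g z.2 * (starRingEnd ℂ) (e z.1)‖ₑ := by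
        simp [P, enorm_mul]
      rw [this, ← ofReal_norm, ← ofReal_norm]
      exact ENNReal.ofReal_le_ofReal (Complex.abs_re_le_norm _)
    rw [triIntegrand, enorm_mul, ← add_mul, ← add_mul, ← mul_assoc]
    exact mul_le_mul' e1 e2
  have hwn : sqNorm (fun x => ‖w x‖ₑ) = ENNReal.ofReal (wnorm w) := by
    rw [sqNorm_enorm, wnorm, ENNReal.ofReal_toReal hw.memLp.eLpNorm_ne_top]
  have hN : ∀ u : H, sqNorm (fun x => ‖u x‖ₑ) = ENNReal.ofReal ‖u‖ := by
    intro u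
    rw [sqNorm_enorm, ofReal_norm, Lp.enorm_def]
  calc ∫⁻ z, ‖triIntegrand s f g e z‖ₑ
      ≤ ∫⁻ z, ENNReal.ofReal C * (‖w z.1‖ₑ * P z + ‖w z.2‖ₑ * P z + ‖w (z.1 - z.2)‖ₑ * P z) :=
        lintegral_mono hpt
    _ = ENNReal.ofReal C * ((∫⁻ z, ‖w z.1‖ₑ * P z) + (∫⁻ z, ‖w z.2‖ₑ * P z) +
          ∫⁻ z, ‖w (z.1 - z.2)‖ₑ * P z) := by
        rw [lintegral_const_mul' _ _ ENNReal.ofReal_ne_top, lintegral_add_right _ m3,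
          lintegral_add_right _ m2]
    _ ≤ ENNReal.ofReal C * (ENNReal.ofReal (wnorm w) * (ENNReal.ofReal ‖f‖ * ENNReal.ofReal ‖g‖ *
          ENNReal.ofReal ‖e‖) + ENNReal.ofReal (wnorm w) * (ENNReal.ofReal ‖f‖ * ENNReal.ofReal ‖g‖ *
          ENNReal.ofReal ‖e‖) + ENNReal.ofReal (wnorm w) * (ENNReal.ofReal ‖f‖ *
          ENNReal.ofReal ‖g‖ * ENNReal.ofReal ‖e‖)) := by
        rw [← hwn, ← hN f, ← hN g, ← hN e]
        gcongr
        · refine (lintegral_prod _ m1.aemeasurable).trans_le ?_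
          exact lintegral_tri_fst_le mw mf mg me
        · refine (lintegral_prod _ m2.aemeasurable).trans_le ?_
          exact lintegral_tri_snd_le mw mf mg me
        · refine (lintegral_prod _ m3.aemeasurable).trans_le ?_
          exact lintegral_tri_sub_le mw mf mg me
    _ = _ := by
        have h0 := wnorm_nonneg w
        rw [← ENNReal.ofReal_mul (norm_nonneg _), ← ENNReal.ofReal_mul (by positivity),
          ← ENNReal.ofReal_mul h0, ← ENNReal.ofReal_add (by positivity) (by positivity),
          ← ENNReal.ofReal_add (by positivity) (by positivity), ← ENNReal.ofReal_mul hC]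
        congr 1
        ring

theorem integrable_triIntegrand (hC : 0 ≤ C) (hs : Dominated s C w) (hw : IsWeight w) (f g e : H) :
    Integrable (triIntegrand s f g e) :=
  ⟨(measurable_triIntegrand hs.measurable f g e).aestronglyMeasurable,
    (lintegral_triIntegrand_le hC hs hw f g e).trans_lt ENNReal.ofReal_lt_top⟩

/-- The central inequality: every nonlinear estimate below reduces to a pointwise domination of a
kernel and an appeal to this bound. -/
theorem abs_tri_le (hC : 0 ≤ C) (hs : Dominated s C w) (hw : IsWeight w) (f g e : H) :
    |tri s f g e| ≤ 3 * C * wnorm w * ‖f‖ * ‖g‖ * ‖e‖ := by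
  have h0 := wnorm_nonneg w
  have h := (enorm_integral_le_lintegral_enorm (triIntegrand s f g e)).trans
    (lintegral_triIntegrand_le hC hs hw f g e)
  rw [Real.enorm_eq_ofReal_abs] at h
  exact (ENNReal.ofReal_le_ofReal_iff (by positivity)).1 h

theorem tri_add {s' : Plane → Plane → ℝ} {C' : ℝ} {w' : Plane → ℝ} (hC : 0 ≤ C)
    (hs : Dominated s C w) (hw : IsWeight w) (hC' : 0 ≤ C') (hs' : Dominated s' C' w')
    (hw' : IsWeight w') (f g e : H) :
    tri (fun ξ ζ => s ξ ζ + s' ξ ζ) f g e = tri s f g e + tri s' f g e := by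
  rw [tri, tri, tri, ← integral_add (integrable_triIntegrand hC hs hw f g e)
    (integrable_triIntegrand hC' hs' hw' f g e)]
  congr 1 with z
  simp only [triIntegrand]
  ring

theorem tri_const_mul (c : ℝ) (f g e : Plane → ℂ) :
    tri (fun ξ ζ => c * s ξ ζ) f g e = c * tri s f g e := by
  rw [tri, tri, ← integral_const_mul]
  congr 1 with z
  simp only [triIntegrand]
  ring

theorem tri_congr {s' : Plane → Plane → ℝ} (h : ∀ ξ ζ, s ξ ζ = s' ξ ζ) (f g e : Plane → ℂ) :
    tri s f g e = tri s' f g e := by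
  rw [funext fun ξ => funext (h ξ)]

theorem measurePreserving_fst_sub :
    MeasurePreserving (fun z : Plane × Plane => (z.1, z.1 - z.2)) volume volume := by
  have h1 := measurePreserving_prod_sub (volume : Measure Plane) (volume : Measure Plane)
  have h2 := (MeasurePreserving.id (volume : Measure Plane)).prod
    (Measure.measurePreserving_neg (volume : Measure Plane))
  have e : (fun z : Plane × Plane => (z.1, z.1 - z.2))
      = Prod.map id Neg.neg ∘ fun z : Plane × Plane => (z.1, z.2 - z.1) := by
    funext z
    simp
  rw [e]
  exact h2.comp h1

theorem measurePreserving_swap_plane :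
    MeasurePreserving (Prod.swap : Plane × Plane → Plane × Plane) volume volume :=
  Measure.measurePreserving_swap

/-- The involution `(ξ, ζ) ↦ (ξ, ξ - ζ)`. -/
def fstSubEquiv : Plane × Plane ≃ᵐ Plane × Plane where
  toFun z := (z.1, z.1 - z.2)
  invFun z := (z.1, z.1 - z.2)
  left_inv z := by simp
  right_inv z := by simp
  measurable_toFun := measurable_fst.prodMk (measurable_fst.sub measurable_snd)
  measurable_invFun := measurable_fst.prodMk (measurable_fst.sub measurable_snd)

/-- The measure-preserving involution ζ ↦ ξ-ζ exchanges the roles of the first two factors. -/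
theorem tri_swap_factors (f g e : Plane → ℂ) :
    tri s f g e = tri (fun ξ ζ => s ξ (ξ - ζ)) g f e := by
  rw [tri, tri, ← measurePreserving_fst_sub.integral_comp fstSubEquiv.measurableEmbedding]
  congr 1 with z
  simp only [triIntegrand, sub_sub_cancel]
  congr 3
  ring

theorem ae_comp_sub {p : Plane → Prop} (h : ∀ᵐ x, p x) : ∀ᵐ z : Plane × Plane, p (z.1 - z.2) :=
  (quasiMeasurePreserving_sub (volume : Measure Plane) (volume : Measure Plane)).ae h

theorem ae_comp_fst {p : Plane → Prop} (h : ∀ᵐ x, p x) : ∀ᵐ z : Plane × Plane, p z.1 :=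
  (Measure.quasiMeasurePreserving_fst (μ := (volume : Measure Plane))
    (ν := (volume : Measure Plane))).ae h

theorem ae_comp_snd {p : Plane → Prop} (h : ∀ᵐ x, p x) : ∀ᵐ z : Plane × Plane, p z.2 :=
  (Measure.quasiMeasurePreserving_snd (μ := (volume : Measure Plane))
    (ν := (volume : Measure Plane))).ae h

/-- Exchanging ξ and ζ replaces f(ξ-ζ) by f(ζ-ξ), which is its conjugate by Hermitian symmetry.
Hence the whole product is conjugated and its real part is unchanged. -/
theorem tri_transpose {f : H} (hf : reflect f = f) (g e : Plane → ℂ) :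
    tri s f g e = tri (fun ξ ζ => s ζ ξ) f e g := by
  rw [tri, tri, ← measurePreserving_swap_plane.integral_comp
    MeasurableEquiv.prodComm.measurableEmbedding]
  apply integral_congr_ae
  filter_upwards [ae_comp_sub ((reflect_eq_iff f).1 hf)] with z hz
  simp only [triIntegrand, Prod.fst_swap, Prod.snd_swap]
  rw [neg_sub] at hz
  rw [hz]
  congr 1
  simp
  ring

/-- The Fourier form of integration by parts: when the last two arguments coincide, only the
symmetric part of the kernel matters. The domination of `s` itself serves only to ensure
integrability, so its constant may be arbitrarily bad. -/
theorem tri_antisymm (hC : 0 ≤ C) (hs : Dominated s C w) (hw : IsWeight w) {f : H}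
    (hf : reflect f = f) (e : H) :
    tri s f e e = (1 / 2) * tri (fun ξ ζ => s ξ ζ + s ζ ξ) f e e := by
  have hs' : Integrable (triIntegrand (fun ξ ζ => s ζ ξ) f e e) := by
    have h := measurePreserving_swap_plane.integrable_comp_emb
        MeasurableEquiv.prodComm.measurableEmbedding |>.2 (integrable_triIntegrand hC hs hw f e e)
    refine h.congr ?_
    filter_upwards [ae_comp_sub ((reflect_eq_iff f).1 hf)] with z hz
    simp only [triIntegrand, Function.comp, Prod.fst_swap, Prod.snd_swap]
    rw [neg_sub] at hz
    rw [hz]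
    congr 1
    simp
    ring
  have h : tri (fun ξ ζ => s ξ ζ + s ζ ξ) f e e
      = tri s f e e + tri (fun ξ ζ => s ζ ξ) f e e := by
    rw [tri, tri, tri, ← integral_add (integrable_triIntegrand hC hs hw f e e) hs']
    congr 1 with z
    simp only [triIntegrand]
    ring
  rw [h, ← tri_transpose hf]
  ring

theorem tri_mulL {a b c : Plane → ℝ} (ha : IsMultiplier a) (hb : IsMultiplier b)
    (hc : IsMultiplier c) (f g e : H) :
    tri s (mulL a f) (mulL b g) (mulL c e)
      = tri (fun ξ ζ => s ξ ζ * (a (ξ - ζ) * b ζ * c ξ)) f g e := by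
  rw [tri, tri]
  apply integral_congr_ae
  filter_upwards [ae_comp_sub (mulL_coe ha f), ae_comp_snd (mulL_coe hb g),
    ae_comp_fst (mulL_coe hc e)] with z h1 h2 h3
  simp only [triIntegrand, h1, h2, h3]
  simp
  ring

end Trilinear

/-! ### Bilinear operators with a frequency kernel -/

section Convolution

/-- Kernels `κ(ξ, ζ)` with `|κ(ξ, ζ)| ≤ m(ξ)` for some square-integrable `m`. -/
def IsConvKernel (κ : Plane → Plane → ℝ) : Prop :=
  Measurable (fun z : Plane × Plane => κ z.1 z.2) ∧ ∃ m, IsWeight m ∧ ∀ ξ ζ, |κ ξ ζ| ≤ m ξ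

theorem IsConvKernel.dominated {κ : Plane → Plane → ℝ} (h : Measurable (fun z : Plane × Plane => κ z.1 z.2))
    {m : Plane → ℝ} (hm : IsWeight m) (hb : ∀ ξ ζ, |κ ξ ζ| ≤ m ξ) : Dominated κ 1 m :=
  ⟨h, fun ξ ζ => by linarith [hb ξ ζ, hm.nonneg ζ, hm.nonneg (ξ - ζ)]⟩

/-- `∫ κ(ξ, ζ) f(ξ - ζ) g(ζ) dζ`. -/
def convFun (κ : Plane → Plane → ℝ) (f g : Plane → ℂ) (ξ : Plane) : ℂ :=
  ∫ ζ, (κ ξ ζ : ℂ) * (f (ξ - ζ) * g ζ)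

theorem memLp_comp_sub_left (f : H) (ξ : Plane) : MemLp (fun ζ => f (ξ - ζ)) 2 volume :=
  (Lp.memLp f).comp_measurePreserving (Measure.measurePreserving_sub_left volume ξ)

theorem integrable_conv (f g : H) (ξ : Plane) : Integrable fun ζ => f (ξ - ζ) * g ζ :=
  (memLp_comp_sub_left f ξ).integrable_mul (Lp.memLp g)

theorem integral_norm_conv_le (f g : H) (ξ : Plane) : ∫ ζ, ‖f (ξ - ζ) * g ζ‖ ≤ ‖f‖ * ‖g‖ := by
  have mf : Measurable fun ζ => ‖f (ξ - ζ)‖ₑ :=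
    ((measurable_coe f).comp (measurable_const.sub measurable_id)).enorm
  have mg : Measurable fun x => ‖g x‖ₑ := (measurable_coe g).enorm
  rw [integral_norm_eq_lintegral_enorm (integrable_conv f g ξ).aestronglyMeasurable]
  apply ENNReal.toReal_le_of_le_ofReal (by positivity)
  simp only [enorm_mul]
  refine (lintegral_mul_le_sqNorm mf mg).trans_eq ?_
  rw [sqNorm_enorm g, sqNorm_enorm fun ζ => f (ξ - ζ), ENNReal.ofReal_mul (norm_nonneg _),
    ofReal_norm, ofReal_norm, Lp.enorm_def, Lp.enorm_def]
  congr 1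
  exact eLpNorm_comp_measurePreserving (Lp.aestronglyMeasurable f)
    (Measure.measurePreserving_sub_left volume ξ)

variable {κ : Plane → Plane → ℝ}

theorem integrable_kernel_conv {m : ℝ} {k : Plane → ℝ} (hk : Measurable k) (hb : ∀ ζ, |k ζ| ≤ m)
    (f g : H) (ξ : Plane) : Integrable fun ζ => (k ζ : ℂ) * (f (ξ - ζ) * g ζ) := by
  refine (integrable_conv f g ξ).bdd_mul (c := m)
    (Complex.measurable_ofReal.comp hk).aestronglyMeasurable (ae_of_all _ fun ζ => ?_)
  change ‖((k ζ : ℝ) : ℂ)‖ ≤ m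
  rw [Complex.norm_real]
  exact hb ζ

theorem norm_convFun_le {m : Plane → ℝ} (hb : ∀ ξ ζ, |κ ξ ζ| ≤ m ξ) (f g : H) (ξ : Plane) :
    ‖convFun κ f g ξ‖ ≤ m ξ * (‖f‖ * ‖g‖) := by
  have hm : 0 ≤ m ξ := (abs_nonneg _).trans (hb ξ 0)
  calc ‖convFun κ f g ξ‖ ≤ ∫ ζ, m ξ * ‖f (ξ - ζ) * g ζ‖ := by
        apply norm_integral_le_of_norm_le ((integrable_conv f g ξ).norm.const_mul _)
        refine ae_of_all _ fun ζ => ?_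
        rw [norm_mul, Complex.norm_real]
        exact mul_le_mul_of_nonneg_right (hb ξ ζ) (norm_nonneg _)
    _ = m ξ * ∫ ζ, ‖f (ξ - ζ) * g ζ‖ := integral_const_mul _ _
    _ ≤ _ := mul_le_mul_of_nonneg_left (integral_norm_conv_le f g ξ) hm

theorem aestronglyMeasurable_convFun (hκ : Measurable fun z : Plane × Plane => κ z.1 z.2)
    (f g : H) : AEStronglyMeasurable (convFun κ f g) volume := by
  have h : Measurable fun z : Plane × Plane => (κ z.1 z.2 : ℂ) * (f (z.1 - z.2) * g z.2) :=
    (Complex.measurable_ofReal.comp hκ).mul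
      (((measurable_coe f).comp (measurable_fst.sub measurable_snd)).mul
        ((measurable_coe g).comp measurable_snd))
  exact h.aestronglyMeasurable.integral_prod_right'

/-- Since the convolution of two L² functions is bounded, square-integrability of the majorant in
the output frequency is all that is needed. -/
theorem memLp_convFun (hκ : IsConvKernel κ) (f g : H) : MemLp (convFun κ f g) 2 volume := by
  obtain ⟨h1, m, hm, hb⟩ := hκ
  refine hm.memLp.of_le_mul (c := ‖f‖ * ‖g‖) (aestronglyMeasurable_convFun h1 f g)
    (ae_of_all _ fun ξ => ?_)
  rw [Real.norm_of_nonneg (hm.nonneg ξ), mul_comm]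
  exact norm_convFun_le hb f g ξ

theorem convFun_congr_left (κ : Plane → Plane → ℝ) {f f' : Plane → ℂ} (h : f =ᵐ[volume] f')
    (g : Plane → ℂ) (ξ : Plane) : convFun κ f g ξ = convFun κ f' g ξ := by
  apply integral_congr_ae
  filter_upwards [(quasiMeasurePreserving_sub_left (volume : Measure Plane) ξ).ae h] with ζ hζ
  rw [hζ]

theorem convFun_congr_right (κ : Plane → Plane → ℝ) (f : Plane → ℂ) {g g' : Plane → ℂ}
    (h : g =ᵐ[volume] g') (ξ : Plane) : convFun κ f g ξ = convFun κ f g' ξ := by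
  apply integral_congr_ae
  filter_upwards [h] with ζ hζ
  rw [hζ]

theorem convFun_add_left (hκ : IsConvKernel κ) (f f' g : H) (ξ : Plane) :
    convFun κ (f + f' : H) g ξ = convFun κ f g ξ + convFun κ f' g ξ := by
  obtain ⟨h1, m, hm, hb⟩ := hκ
  have hk : Measurable (κ ξ) := h1.comp measurable_prodMk_left
  rw [convFun_congr_left κ (Lp.coeFn_add f f'), convFun, convFun, convFun,
    ← integral_add (integrable_kernel_conv hk (hb ξ) f g ξ)
      (integrable_kernel_conv hk (hb ξ) f' g ξ)]
  congr 1 with ζ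
  rw [Pi.add_apply]
  ring

theorem convFun_add_right (hκ : IsConvKernel κ) (f g g' : H) (ξ : Plane) :
    convFun κ f (g + g' : H) ξ = convFun κ f g ξ + convFun κ f g' ξ := by
  obtain ⟨h1, m, hm, hb⟩ := hκ
  have hk : Measurable (κ ξ) := h1.comp measurable_prodMk_left
  rw [convFun_congr_right κ f (Lp.coeFn_add g g'), convFun, convFun, convFun,
    ← integral_add (integrable_kernel_conv hk (hb ξ) f g ξ)
      (integrable_kernel_conv hk (hb ξ) f g' ξ)]
  congr 1 with ζ
  rw [Pi.add_apply]
  ring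

theorem convFun_smul_left (c : ℝ) (f g : H) (ξ : Plane) :
    convFun κ (c • f : H) g ξ = c • convFun κ f g ξ := by
  rw [convFun_congr_left κ (Lp.coeFn_smul c f), convFun, convFun, ← integral_smul]
  congr 1 with ζ
  simp
  ring

theorem convFun_smul_right (c : ℝ) (f g : H) (ξ : Plane) :
    convFun κ f (c • g : H) ξ = c • convFun κ f g ξ := by
  rw [convFun_congr_right κ f (Lp.coeFn_smul c g), convFun, convFun, ← integral_smul]
  congr 1 with ζ
  simp
  ring

/-- The bilinear operator with kernel `κ`, as an algebraic bilinear map. -/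
def convLin (hκ : IsConvKernel κ) : H →ₗ[ℝ] H →ₗ[ℝ] H :=
  LinearMap.mk₂ ℝ (fun f g => (memLp_convFun hκ f g).toLp)
    (fun f f' g => by
      rw [← MemLp.toLp_add]
      exact MemLp.toLp_congr _ _ (ae_of_all _ (convFun_add_left hκ f f' g)))
    (fun c f g => by
      rw [← MemLp.toLp_const_smul]
      exact MemLp.toLp_congr _ _ (ae_of_all _ (convFun_smul_left c f g)))
    (fun f g g' => by
      rw [← MemLp.toLp_add]
      exact MemLp.toLp_congr _ _ (ae_of_all _ (convFun_add_right hκ f g g')))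
    (fun c f g => by
      rw [← MemLp.toLp_const_smul]
      exact MemLp.toLp_congr _ _ (ae_of_all _ (convFun_smul_right c f g)))

theorem norm_convLin_le (hκ : IsConvKernel κ) :
    ∃ C, ∀ f g, ‖convLin hκ f g‖ ≤ C * ‖f‖ * ‖g‖ := by
  have hκ' := hκ
  obtain ⟨h1, m, hm, hb⟩ := hκ'
  refine ⟨‖hm.memLp.toLp‖, fun f g => ?_⟩
  rw [mul_assoc, mul_comm]
  apply Lp.norm_le_mul_norm_of_ae_le_mul
  filter_upwards [(memLp_convFun hκ f g).coeFn_toLp, hm.memLp.coeFn_toLp] with ξ e1 e2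
  change ‖(memLp_convFun hκ f g).toLp _ ξ‖ ≤ _
  rw [e1, e2, Real.norm_of_nonneg (hm.nonneg ξ), mul_comm]
  exact norm_convFun_le hb f g ξ

open Classical in
/-- The bilinear operator with kernel `κ` on `L²` (zero if the kernel is not admissible). -/
def conv (κ : Plane → Plane → ℝ) : H →L[ℝ] H →L[ℝ] H :=
  if hκ : IsConvKernel κ then
    (convLin hκ).mkContinuous₂ (norm_convLin_le hκ).choose (norm_convLin_le hκ).choose_spec
  else 0

theorem conv_coe (hκ : IsConvKernel κ) (f g : H) : conv κ f g =ᵐ[volume] convFun κ f g := by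
  rw [conv, dif_pos hκ]
  exact (memLp_convFun hκ f g).coeFn_toLp

/-- Fubini, justified because the majorant of an admissible kernel is a weight, so that the
trilinear integrand is integrable. -/
theorem inner_conv (hκ : IsConvKernel κ) (f g e : H) : inner ℝ (conv κ f g) e = tri κ f g e := by
  have hκ' := hκ
  obtain ⟨h1, m, hm, hb⟩ := hκ'
  have hint := integrable_triIntegrand zero_le_one (IsConvKernel.dominated h1 hm hb) hm f g e
  rw [inner_eq_integral, tri]
  refine Eq.trans ?_ (integral_prod _ hint).symm
  apply integral_congr_ae
  filter_upwards [conv_coe hκ f g] with ξ hξ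
  rw [hξ, convFun]
  have hk : Measurable (κ ξ) := h1.comp measurable_prodMk_left
  have hi := integrable_kernel_conv hk (hb ξ) f g ξ
  rw [← integral_mul_const]
  have := integral_re (hi.mul_const ((starRingEnd ℂ) (e ξ)))
  simp only [RCLike.re_eq_complex_re] at this
  rw [← this]
  congr 1 with ζ
  simp only [triIntegrand, mul_assoc, Complex.re_ofReal_mul]

theorem conv_swap {κ' : Plane → Plane → ℝ} (hκ : IsConvKernel κ) (hκ' : IsConvKernel κ')
    (h : ∀ ξ ζ, κ' ξ ζ = κ ξ (ξ - ζ)) (f g : H) : conv κ f g = conv κ' g f := by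
  apply Lp.ext
  filter_upwards [conv_coe hκ f g, conv_coe hκ' g f] with ξ h1 h2
  rw [h1, h2, convFun, convFun, ← integral_sub_left_eq_self _ volume ξ]
  congr 1 with ζ
  rw [h, sub_sub_cancel]
  ring

/-- An even real kernel maps transforms of real functions to transforms of real functions. -/
theorem reflect_conv (hκ : IsConvKernel κ) (h : ∀ ξ ζ, κ (-ξ) (-ζ) = κ ξ ζ) (f g : H) :
    reflect (conv κ f g) = conv κ (reflect f) (reflect g) := by
  apply Lp.ext
  filter_upwards [reflect_coe (conv κ f g), ae_comp_neg (conv_coe hκ f g),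
    conv_coe hκ (reflect f) (reflect g)] with ξ h1 h2 h3
  rw [h1, h2, h3, convFun, convFun, ← integral_neg_eq_self, ← integral_conj]
  apply integral_congr_ae
  filter_upwards [(quasiMeasurePreserving_sub_left (volume : Measure Plane) ξ).ae (reflect_coe f),
    reflect_coe g] with ζ e1 e2
  rw [e1, e2, h, neg_sub]
  simp only [map_mul, Complex.conj_ofReal]
  rw [show -ξ - -ζ = ζ - ξ by abel]

end Convolution

/-! ### Brackets, angles and frequency cutoffs -/

section Symbols

/-- The length of the frequency variable `2πξ`. -/
def freq (ξ : Plane) : ℝ := 2 * Real.pi * ‖ξ‖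

/-- The Japanese bracket of the frequency variable. -/
def jap (ξ : Plane) : ℝ := Real.sqrt (1 + freq ξ ^ 2)

/-- The cosine of the angle between two vectors (zero if one of them vanishes). -/
def cosine (x y : Plane) : ℝ := inner ℝ x y / (‖x‖ * ‖y‖)

theorem freq_nonneg (ξ : Plane) : 0 ≤ freq ξ := by unfold freq; positivity

theorem freq_neg (ξ : Plane) : freq (-ξ) = freq ξ := by simp [freq]

theorem jap_neg (ξ : Plane) : jap (-ξ) = jap ξ := by simp [jap, freq_neg]

theorem jap_sq (ξ : Plane) : jap ξ ^ 2 = 1 + freq ξ ^ 2 := Real.sq_sqrt (by positivity)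

theorem one_le_jap (ξ : Plane) : 1 ≤ jap ξ := by
  rw [jap, Real.one_le_sqrt]; nlinarith [sq_nonneg (freq ξ)]

theorem jap_pos (ξ : Plane) : 0 < jap ξ := zero_lt_one.trans_le (one_le_jap ξ)

theorem freq_le_jap (ξ : Plane) : freq ξ ≤ jap ξ :=
  Real.le_sqrt_of_sq_le (by linarith)

theorem jap_sub_comm (ξ ζ : Plane) : jap (ξ - ζ) = jap (ζ - ξ) := by
  rw [← jap_neg, neg_sub]

theorem freq_le_add (ξ ζ : Plane) : freq ξ ≤ freq (ξ - ζ) + freq ζ := by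
  have h : ‖ξ‖ ≤ ‖ξ - ζ‖ + ‖ζ‖ := by simpa using norm_add_le (ξ - ζ) ζ
  unfold freq
  nlinarith [Real.pi_pos]

theorem jap_le_freq_add (ξ ζ : Plane) : jap ξ ≤ freq (ξ - ζ) + jap ζ := by
  have h := freq_le_add ξ ζ
  have h1 := freq_nonneg (ξ - ζ)
  have h2 := freq_nonneg ζ
  have h3 := freq_le_jap ζ
  apply Real.sqrt_le_iff.2
  refine ⟨by linarith [jap_pos ζ], ?_⟩
  nlinarith [jap_sq ζ, freq_nonneg ξ, mul_nonneg h1 (sub_nonneg.2 h3)]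

theorem jap_le_add (ξ ζ : Plane) : jap ξ ≤ jap (ξ - ζ) + jap ζ :=
  (jap_le_freq_add ξ ζ).trans (add_le_add_left (freq_le_jap _) _)

theorem abs_cosine_le (x y : Plane) : |cosine x y| ≤ 1 := abs_real_inner_div_norm_mul_norm_le_one x y

theorem cosine_comm (x y : Plane) : cosine x y = cosine y x := by
  rw [cosine, cosine, real_inner_comm, mul_comm]

theorem cosine_neg_left (x y : Plane) : cosine (-x) y = -cosine x y := by
  simp [cosine, neg_div]

theorem cosine_neg_right (x y : Plane) : cosine x (-y) = -cosine x y := by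
  simp [cosine, neg_div]

theorem freq_mul_cosine (x y : Plane) : freq y * cosine x y = 2 * Real.pi * (inner ℝ x y / ‖x‖) := by
  rcases eq_or_ne y 0 with rfl | hy
  · simp [freq]
  · have : ‖y‖ ≠ 0 := norm_ne_zero_iff.2 hy
    simp only [freq, cosine]
    field_simp

/-- The projection of `ξ = ζ + (ξ - ζ)` onto its own direction. -/
theorem freq_eq_add (ξ ζ : Plane) :
    freq ξ = freq ζ * cosine ξ ζ + freq (ξ - ζ) * cosine ξ (ξ - ζ) := by
  rw [freq_mul_cosine, freq_mul_cosine, ← mul_add, ← add_div, ← inner_add_right]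
  rcases eq_or_ne ξ 0 with rfl | h
  · simp [freq]
  · have : ‖ξ‖ ≠ 0 := norm_ne_zero_iff.2 h
    rw [add_sub_cancel, real_inner_self_eq_norm_sq, freq]
    field_simp

theorem measurable_freq : Measurable freq := by unfold freq; fun_prop

theorem measurable_jap : Measurable jap := by
  unfold jap
  have := measurable_freq
  fun_prop

theorem measurable_cosine {X : Type*} [MeasurableSpace X] {f g : X → Plane} (hf : Measurable f)
    (hg : Measurable g) : Measurable fun x => cosine (f x) (g x) :=
  (hf.inner hg).div (hf.norm.mul hg.norm)

theorem measurable_jap_rpow (r : ℝ) : Measurable fun ξ => jap ξ ^ r := measurable_jap.pow_const r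

theorem jap_rpow_pos (r : ℝ) (ξ : Plane) : 0 < jap ξ ^ r := Real.rpow_pos_of_pos (jap_pos ξ) r

theorem jap_rpow_le_one {r : ℝ} (hr : r ≤ 0) (ξ : Plane) : jap ξ ^ r ≤ 1 :=
  Real.rpow_le_one_of_one_le_of_nonpos (one_le_jap ξ) hr

theorem jap_rpow_mono {q r : ℝ} (h : q ≤ r) (ξ : Plane) : jap ξ ^ q ≤ jap ξ ^ r :=
  Real.rpow_le_rpow_of_exponent_le (one_le_jap ξ) h

theorem jap_rpow_add (q r : ℝ) (ξ : Plane) : jap ξ ^ (q + r) = jap ξ ^ q * jap ξ ^ r :=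
  Real.rpow_add (jap_pos ξ) q r

theorem jap_rpow_neg_mul (r : ℝ) (ξ : Plane) : jap ξ ^ (-r) * jap ξ ^ r = 1 := by
  rw [← jap_rpow_add, neg_add_cancel, Real.rpow_zero]

theorem isMultiplier_jap {r : ℝ} (hr : r ≤ 0) : IsMultiplier fun ξ => jap ξ ^ r :=
  ⟨measurable_jap_rpow r, 1, fun ξ => by
    rw [abs_of_pos (jap_rpow_pos r ξ)]; exact jap_rpow_le_one hr ξ⟩

/-- In the plane ⟨ξ⟩^{2q} is integrable when 2q < -2. Used with q = 1-s, this is where s > 2 enters.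
-/
theorem isWeight_jap {q : ℝ} (hq : q < -1) : IsWeight fun ξ => jap ξ ^ q := by
  refine ⟨measurable_jap_rpow q, fun ξ => (jap_rpow_pos q ξ).le, ?_⟩
  rw [memLp_two_iff_integrable_sq (measurable_jap_rpow q).aestronglyMeasurable]
  have hfin : (Module.finrank ℝ Plane : ℝ) < -(2 * q) := by
    simp; linarith
  refine (integrable_rpow_neg_one_add_norm_sq (μ := (volume : Measure Plane)) hfin).mono'
    ((measurable_jap_rpow q).pow_const 2).aestronglyMeasurable (ae_of_all _ fun ξ => ?_)
  rw [Real.norm_of_nonneg (by positivity)]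
  have e : (jap ξ ^ q) ^ 2 = (1 + freq ξ ^ 2) ^ q := by
    rw [← jap_sq, ← Real.rpow_natCast, ← Real.rpow_natCast, ← Real.rpow_mul (jap_pos ξ).le,
      ← Real.rpow_mul (jap_pos ξ).le, mul_comm]
  rw [e, show -(-(2 * q)) / 2 = q by ring]
  apply Real.rpow_le_rpow_of_nonpos (by positivity) _ (by linarith)
  have : (1:ℝ) ≤ 2 * Real.pi := by linarith [Real.pi_gt_three]
  have h2 : ‖ξ‖ ≤ freq ξ := by
    unfold freq
    nlinarith [norm_nonneg ξ]
  gcongr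

/-- The indicator of the frequencies of length at most `n`. -/
def cut (n : ℝ) (ξ : Plane) : ℝ := if freq ξ ≤ n then 1 else 0

theorem cut_neg (n : ℝ) (ξ : Plane) : cut n (-ξ) = cut n ξ := by simp [cut, freq_neg]

theorem measurable_cut (n : ℝ) : Measurable (cut n) :=
  Measurable.ite (measurableSet_le measurable_freq measurable_const) measurable_const
    measurable_const

theorem cut_nonneg (n : ℝ) (ξ : Plane) : 0 ≤ cut n ξ := by unfold cut; split_ifs <;> norm_num

theorem cut_le_one (n : ℝ) (ξ : Plane) : cut n ξ ≤ 1 := by unfold cut; split_ifs <;> norm_num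

theorem abs_cut_le (n : ℝ) (ξ : Plane) : |cut n ξ| ≤ 1 := by
  rw [abs_of_nonneg (cut_nonneg n ξ)]; exact cut_le_one n ξ

theorem cut_mul_cut {m n : ℝ} (h : m ≤ n) (ξ : Plane) : cut m ξ * cut n ξ = cut m ξ := by
  unfold cut
  split_ifs with h1 h2
  · norm_num
  · exact absurd (h1.trans h) h2
  all_goals norm_num

theorem isMultiplier_cut (n : ℝ) : IsMultiplier (cut n) := ⟨measurable_cut n, 1, abs_cut_le n⟩

theorem isMultiplier_one_sub_cut (n : ℝ) : IsMultiplier fun ξ => 1 - cut n ξ :=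
  ⟨measurable_const.sub (measurable_cut n), 1, fun ξ => by
    rw [abs_of_nonneg (by linarith [cut_le_one n ξ])]; linarith [cut_nonneg n ξ]⟩

theorem isMultiplier_cut_mul (n : ℝ) {m : Plane → ℝ} (hm : Measurable m) {C : ℝ}
    (hC : ∀ ξ, freq ξ ≤ n → |m ξ| ≤ C) : IsMultiplier fun ξ => cut n ξ * m ξ := by
  refine ⟨(measurable_cut n).mul hm, max C 0, fun ξ => ?_⟩
  change |cut n ξ * m ξ| ≤ max C 0
  unfold cut
  split_ifs with h
  · rw [one_mul]; exact (hC ξ h).trans (le_max_left _ _)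
  · simp

theorem jap_le_of_freq_le {n : ℝ} {ξ : Plane} (h : freq ξ ≤ n) : jap ξ ≤ Real.sqrt (1 + n ^ 2) := by
  have := freq_nonneg ξ
  unfold jap
  gcongr

theorem isMultiplier_cut_jap (n r : ℝ) : IsMultiplier fun ξ => cut n ξ * jap ξ ^ r := by
  refine isMultiplier_cut_mul n (measurable_jap_rpow r)
    (C := max 1 (Real.sqrt (1 + n ^ 2) ^ r)) fun ξ h => ?_
  rw [abs_of_pos (jap_rpow_pos r ξ)]
  rcases le_total r 0 with hr | hr
  · exact (jap_rpow_le_one hr ξ).trans (le_max_left _ _)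
  · exact (Real.rpow_le_rpow (jap_pos ξ).le (jap_le_of_freq_le h) hr).trans (le_max_right _ _)

/-- Beyond the cutoff ⟨ξ⟩ ≥ n, so a negative power of the bracket turns regularity into a rate in
`n`. -/
theorem one_sub_cut_mul_jap_le {n r : ℝ} (hn : 1 ≤ n) (hr : r ≤ 0) (ξ : Plane) :
    (1 - cut n ξ) * jap ξ ^ r ≤ n ^ r := by
  unfold cut
  split_ifs with h
  · simp; positivity
  · rw [sub_zero, one_mul]
    exact Real.rpow_le_rpow_of_nonpos (by linarith) ((not_le.1 h).le.trans (freq_le_jap ξ)) hr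

end Symbols

/-! ### The commutator estimate for the transport term -/

section Commutator

/-- Convexity of the power function, in the form of Bernoulli's inequality applied to `y / z`. -/
theorem rpow_sub_rpow_le {s x y z : ℝ} (hs : 1 ≤ s) (hy : 0 < y) (hyz : y ≤ z) (hx : z - y ≤ x) :
    z ^ s - y ^ s ≤ s * z ^ (s - 1) * x := by
  have hz : 0 < z := hy.trans_le hyz
  have h := one_add_mul_self_le_rpow_one_add (s := y / z - 1) (by linarith [div_pos hy hz]) hs
  rw [add_sub_cancel, Real.div_rpow hy.le hz.le, le_div_iff₀ (Real.rpow_pos_of_pos hz s)] at h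
  have e : z ^ s = z ^ (s - 1) * z := by
    rw [← Real.rpow_add_one hz.ne', sub_add_cancel]
  have e2 : (1 + s * (y / z - 1)) * z ^ s = z ^ s - s * z ^ (s - 1) * (z - y) := by
    rw [e]; field_simp; ring
  have h3 : s * z ^ (s - 1) * (z - y) ≤ s * z ^ (s - 1) * x :=
    mul_le_mul_of_nonneg_left hx (by positivity)
  linarith

theorem rpow_le_two_rpow_mul {r x y z : ℝ} (hr : 0 ≤ r) (hx : 0 < x) (hy : 0 < y) (hz : 0 < z)
    (h : z ≤ x + y) : z ^ r ≤ 2 ^ r * (x ^ r + y ^ r) := by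
  have h1 : 0 < x ^ r := Real.rpow_pos_of_pos hx r
  have h2 : 0 < y ^ r := Real.rpow_pos_of_pos hy r
  rcases le_total x y with hxy | hxy
  · calc z ^ r ≤ (2 * y) ^ r := Real.rpow_le_rpow hz.le (by linarith) hr
      _ = 2 ^ r * y ^ r := Real.mul_rpow (by norm_num) hy.le
      _ ≤ _ := by gcongr; linarith
  · calc z ^ r ≤ (2 * x) ^ r := Real.rpow_le_rpow hz.le (by linarith) hr
      _ = 2 ^ r * x ^ r := Real.mul_rpow (by norm_num) hx.le
      _ ≤ _ := by gcongr; linarith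

/-- The constant of the commutator estimate. -/
def commConst (s : ℝ) : ℝ := 1 + s + s * 2 ^ (s - 1)

theorem commConst_pos {s : ℝ} (hs : 1 ≤ s) : 0 < commConst s := by
  unfold commConst; positivity

/-- A scalar form of the Kato–Ponce commutator estimate. Here `x`, `y`, `z` stand for the brackets
of ξ-ζ, ζ and ξ, and `p`, `q` for the energy weights at ξ and ζ. The difference of the weights gains
a factor `x` at the cost of `z ^ (s - 1)`, which is distributed over `x` and `y`. On the right, each
term is the product of the three `s`-th powers with a weight at a single frequency, ready for
`abs_tri_le`. -/
theorem commutator_scalar_of_le {s x y z p q : ℝ} (hs : 1 ≤ s) (hx : 0 < x) (hy : 0 < y)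
    (hyz : y ≤ z) (hzxy : z ≤ x + y) (hp0 : 0 ≤ p) (hq0 : 0 ≤ q) (hp : p ≤ z ^ s) (hq : q ≤ y ^ s)
    (hpq : |p - q| ≤ |z ^ s - y ^ s|) :
    p * q * x + |p - q| * (p * y + q * z) ≤
      commConst s * (x ^ s * y ^ s * z ^ s) * (z ^ (1 - s) + y ^ (1 - s) + x ^ (1 - s)) := by
  have hz : 0 < z := hy.trans_le hyz
  have X : 0 < x ^ s := Real.rpow_pos_of_pos hx s
  have Y : 0 < y ^ s := Real.rpow_pos_of_pos hy s
  have Z : 0 < z ^ s := Real.rpow_pos_of_pos hz s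
  have ex : x ^ s * x ^ (1 - s) = x := by
    rw [← Real.rpow_add hx, add_sub_cancel, Real.rpow_one]
  have ey : y ^ s * y ^ (1 - s) = y := by
    rw [← Real.rpow_add hy, add_sub_cancel, Real.rpow_one]
  have ez : z ^ s = z ^ (s - 1) * z := by
    rw [← Real.rpow_add_one hz.ne', sub_add_cancel]
  have ex2 : x ^ s = x ^ (s - 1) * x := by
    rw [← Real.rpow_add_one hx.ne', sub_add_cancel]
  have ey2 : y ^ s = y ^ (s - 1) * y := by
    rw [← Real.rpow_add_one hy.ne', sub_add_cancel]
  have h1 : |p - q| ≤ s * z ^ (s - 1) * x := by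
    refine hpq.trans ?_
    rw [abs_of_nonneg (sub_nonneg.2 (Real.rpow_le_rpow hy.le hyz (by linarith)))]
    exact rpow_sub_rpow_le hs hy hyz (by linarith)
  have h2 : z ^ (s - 1) ≤ 2 ^ (s - 1) * (x ^ (s - 1) + y ^ (s - 1)) :=
    rpow_le_two_rpow_mul (by linarith) hx hy hz hzxy
  have Zm : 0 < z ^ (s - 1) := Real.rpow_pos_of_pos hz _
  have two : (0:ℝ) < 2 ^ (s - 1) := by positivity
  have t1 : p * q * x ≤ z ^ s * y ^ s * x := by gcongr
  have t2 : |p - q| * (p * y + q * z) ≤ s * z ^ (s - 1) * x * (z ^ s * y + y ^ s * z) := by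
    gcongr
  have t3 : s * z ^ (s - 1) * x * (z ^ s * y) ≤
      s * 2 ^ (s - 1) * (x ^ s * y + x * y ^ s) * z ^ s := by
    calc s * z ^ (s - 1) * x * (z ^ s * y)
        ≤ s * (2 ^ (s - 1) * (x ^ (s - 1) + y ^ (s - 1))) * x * (z ^ s * y) := by gcongr
      _ = _ := by rw [ex2, ey2]; ring
  have t4 : s * z ^ (s - 1) * x * (y ^ s * z) = s * (x * y ^ s * z ^ s) := by
    rw [ez]; ring
  have r1 : 0 < x ^ (1 - s) := Real.rpow_pos_of_pos hx _
  have r2 : 0 < y ^ (1 - s) := Real.rpow_pos_of_pos hy _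
  have r3 : 0 < z ^ (1 - s) := Real.rpow_pos_of_pos hz _
  -- In the coefficient of `x * y ^ s * z ^ s`, the summand 1 comes from `t1`, `s` from `t4`, and `s
  -- * 2 ^ (s - 1)` from `t3`; the other half of `t3` gives the last term.
  have key : p * q * x + |p - q| * (p * y + q * z) ≤
      (1 + s + s * 2 ^ (s - 1)) * (x * y ^ s * z ^ s) + s * 2 ^ (s - 1) * (x ^ s * y * z ^ s) := by
    nlinarith
  have a1 : x * y ^ s * z ^ s = (x ^ s * y ^ s * z ^ s) * x ^ (1 - s) := by
    nth_rewrite 1 [← ex]; ring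
  have a2 : x ^ s * y * z ^ s = (x ^ s * y ^ s * z ^ s) * y ^ (1 - s) := by
    nth_rewrite 1 [← ey]; ring
  rw [a1, a2] at key
  refine key.trans ?_
  have P : 0 < x ^ s * y ^ s * z ^ s := by positivity
  unfold commConst
  have s0 : 0 < s := by linarith
  have b1 : s * 2 ^ (s - 1) * ((x ^ s * y ^ s * z ^ s) * y ^ (1 - s)) ≤
      (1 + s + s * 2 ^ (s - 1)) * ((x ^ s * y ^ s * z ^ s) * y ^ (1 - s)) := by
    gcongr; linarith
  have b2 : 0 ≤ (1 + s + s * 2 ^ (s - 1)) * ((x ^ s * y ^ s * z ^ s) * z ^ (1 - s)) := by positivity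
  nlinarith

/-- Both sides are invariant under exchanging (y, q) with (z, p), so the larger of `y` and `z` may
be called `z`. -/
theorem commutator_scalar {s x y z p q : ℝ} (hs : 1 ≤ s) (hx : 0 < x) (hy : 0 < y) (hz : 0 < z)
    (hzxy : z ≤ x + y) (hyxz : y ≤ x + z) (hp0 : 0 ≤ p) (hq0 : 0 ≤ q) (hp : p ≤ z ^ s)
    (hq : q ≤ y ^ s) (hpq : |p - q| ≤ |z ^ s - y ^ s|) :
    p * q * x + |p - q| * (p * y + q * z) ≤
      commConst s * (x ^ s * y ^ s * z ^ s) * (z ^ (1 - s) + y ^ (1 - s) + x ^ (1 - s)) := by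
  rcases le_total y z with h | h
  · exact commutator_scalar_of_le hs hx hy h hzxy hp0 hq0 hp hq hpq
  · have := commutator_scalar_of_le hs hx hz h hyxz hq0 hp0 hq hp
      (by rwa [abs_sub_comm, abs_sub_comm (y ^ s)])
    rw [abs_sub_comm] at this
    linarith

/-- Energy weights below the weight `⟨ξ⟩^s` of `H^s` that do not oscillate more than it. -/
structure IsEnergyWeight (s : ℝ) (p : Plane → ℝ) : Prop where
  measurable : Measurable p
  nonneg : ∀ ξ, 0 ≤ p ξ
  le : ∀ ξ, p ξ ≤ jap ξ ^ s
  abs_sub_le : ∀ ξ ζ, |p ξ - p ζ| ≤ |jap ξ ^ s - jap ζ ^ s|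

theorem isEnergyWeight_jap (s : ℝ) : IsEnergyWeight s fun ξ => jap ξ ^ s :=
  ⟨measurable_jap_rpow s, fun ξ => (jap_rpow_pos s ξ).le, fun _ => le_rfl, fun _ _ => le_rfl⟩

/-- Capping at `N` does not increase oscillation. The capped energies therefore obey the same
estimate with a constant independent of `N`, which is what gives continuity in time with values in
H^s. -/
theorem isEnergyWeight_min (s : ℝ) {N : ℝ} (hN : 0 ≤ N) :
    IsEnergyWeight s fun ξ => min (jap ξ ^ s) N :=
  ⟨(measurable_jap_rpow s).min measurable_const, fun ξ => le_min (jap_rpow_pos s ξ).le hN,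
    fun _ => min_le_left _ _, fun _ _ => by
      simpa using abs_min_sub_min_le_max _ N _ N⟩

/-- The kernel of the transport part `v · ∇v` of `½ ∇|v|²`. -/
def transport (ξ ζ : Plane) : ℝ := freq ζ * cosine ξ ζ * cosine (ξ - ζ) ζ

/-- The Fourier form of ½∇|v|² = (v·∇)v for gradient fields: |ξ| is the sum of the projections of ζ
and ξ-ζ on ξ, which yields two halves with the derivative on one factor each. -/
theorem half_freq_mul_cosine (ξ ζ : Plane) :
    1 / 2 * freq ξ * cosine (ξ - ζ) ζ = 1 / 2 * (transport ξ ζ + transport ξ (ξ - ζ)) := by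
  have h := freq_eq_add ξ ζ
  rw [transport, transport, sub_sub_cancel, cosine_comm ζ (ξ - ζ)]
  linear_combination (1 / 2 * cosine (ξ - ζ) ζ) * h

theorem abs_transport_le (ξ ζ : Plane) : |transport ξ ζ| ≤ freq ζ := by
  rw [transport, abs_mul, abs_mul, abs_of_nonneg (freq_nonneg ζ)]
  have h := mul_le_one₀ (abs_cosine_le ξ ζ) (abs_nonneg _) (abs_cosine_le (ξ - ζ) ζ)
  calc freq ζ * |cosine ξ ζ| * |cosine (ξ - ζ) ζ| = freq ζ * (|cosine ξ ζ| * |cosine (ξ - ζ) ζ|) := by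
        ring
    _ ≤ freq ζ * 1 := mul_le_mul_of_nonneg_left h (freq_nonneg ζ)
    _ = _ := mul_one _

theorem measurable_transport : Measurable fun z : Plane × Plane => transport z.1 z.2 :=
  ((measurable_freq.comp measurable_snd).mul (measurable_cosine measurable_fst measurable_snd)).mul
    (measurable_cosine (measurable_fst.sub measurable_snd) measurable_snd)

/-- Symmetrizing the transport kernel gains one derivative. -/
theorem abs_transport_symm_le (ξ ζ : Plane) {p q : ℝ} (hp : 0 ≤ p) (hq : 0 ≤ q) :
    |p ^ 2 * transport ξ ζ + q ^ 2 * transport ζ ξ| ≤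
      p * q * freq (ξ - ζ) + |p - q| * (p * freq ζ + q * freq ξ) := by
  have e : p ^ 2 * transport ξ ζ + q ^ 2 * transport ζ ξ = cosine ξ ζ * (2 * Real.pi *
      (inner ℝ (ξ - ζ) (p ^ 2 • ζ - q ^ 2 • ξ) / ‖ξ - ζ‖)) := by
    have h1 := freq_mul_cosine (ξ - ζ) ζ
    have h2 := freq_mul_cosine (ξ - ζ) ξ
    rw [transport, transport, cosine_comm ζ ξ, ← neg_sub ξ ζ, cosine_neg_left, inner_sub_right,
      inner_smul_right, inner_smul_right]
    simp only [sub_div, mul_sub]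
    linear_combination (p ^ 2 * cosine ξ ζ) * h1 - (q ^ 2 * cosine ξ ζ) * h2
  -- Each summand contains a difference, of frequencies or of weights, so no uncompensated
  -- derivative remains on the high-frequency factors.
  have e2 : p ^ 2 • ζ - q ^ 2 • ξ = (p * q) • (ζ - ξ) + (p - q) • (p • ζ + q • ξ) := by
    module
  have h3 : ‖p ^ 2 • ζ - q ^ 2 • ξ‖ ≤ p * q * ‖ξ - ζ‖ + |p - q| * (p * ‖ζ‖ + q * ‖ξ‖) := by
    rw [e2]
    refine (norm_add_le _ _).trans ?_
    rw [norm_smul, norm_smul, Real.norm_of_nonneg (mul_nonneg hp hq), norm_sub_rev,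
      Real.norm_eq_abs]
    gcongr
    refine (norm_add_le _ _).trans ?_
    rw [norm_smul, norm_smul, Real.norm_of_nonneg hp, Real.norm_of_nonneg hq]
  have h4 : |inner ℝ (ξ - ζ) (p ^ 2 • ζ - q ^ 2 • ξ) / ‖ξ - ζ‖| ≤ ‖p ^ 2 • ζ - q ^ 2 • ξ‖ := by
    rw [abs_div, abs_norm]
    apply div_le_of_le_mul₀ (norm_nonneg _) (norm_nonneg _)
    rw [mul_comm]
    exact abs_real_inner_le_norm _ _
  rw [e, abs_mul, abs_mul, abs_of_pos Real.two_pi_pos]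
  calc |cosine ξ ζ| * (2 * Real.pi * |inner ℝ (ξ - ζ) (p ^ 2 • ζ - q ^ 2 • ξ) / ‖ξ - ζ‖|)
      ≤ 1 * (2 * Real.pi * (p * q * ‖ξ - ζ‖ + |p - q| * (p * ‖ζ‖ + q * ‖ξ‖))) := by
        have := Real.pi_pos
        gcongr
        · exact abs_cosine_le ξ ζ
        · exact h4.trans h3
    _ = _ := by simp only [freq]; ring

/-- The symmetrized transport kernel after each of the three factors has been normalized from H^s to
L²: the commutator estimate in the shape required by `Dominated`. -/
theorem abs_weighted_transport_symm_le {s : ℝ} (hs : 1 ≤ s) {p : Plane → ℝ}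
    (hp : IsEnergyWeight s p) (ξ ζ : Plane) :
    |p ξ ^ 2 * transport ξ ζ + p ζ ^ 2 * transport ζ ξ| *
        (jap (ξ - ζ) ^ (-s) * jap ζ ^ (-s) * jap ξ ^ (-s)) ≤
      commConst s * (jap ξ ^ (1 - s) + jap ζ ^ (1 - s) + jap (ξ - ζ) ^ (1 - s)) := by
  have h1 := abs_transport_symm_le ξ ζ (hp.nonneg ξ) (hp.nonneg ζ)
  have h2 := commutator_scalar hs (jap_pos (ξ - ζ)) (jap_pos ζ) (jap_pos ξ) (jap_le_add ξ ζ)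
    (by rw [jap_sub_comm]; exact jap_le_add ζ ξ) (hp.nonneg ξ) (hp.nonneg ζ) (hp.le ξ) (hp.le ζ)
    (hp.abs_sub_le ξ ζ)
  have h3 : p ξ * p ζ * freq (ξ - ζ) + |p ξ - p ζ| * (p ξ * freq ζ + p ζ * freq ξ) ≤
      p ξ * p ζ * jap (ξ - ζ) + |p ξ - p ζ| * (p ξ * jap ζ + p ζ * jap ξ) := by
    have := hp.nonneg ξ
    have := hp.nonneg ζ
    gcongr <;> exact freq_le_jap _
  have h := mul_le_mul_of_nonneg_right ((h1.trans h3).trans h2)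
    (mul_pos (mul_pos (jap_rpow_pos (-s) (ξ - ζ)) (jap_rpow_pos (-s) ζ)) (jap_rpow_pos (-s) ξ)).le
  refine h.trans_eq ?_
  have ex := jap_rpow_neg_mul s (ξ - ζ)
  have ey := jap_rpow_neg_mul s ζ
  have ez := jap_rpow_neg_mul s ξ
  calc _ = commConst s * (jap ξ ^ (1 - s) + jap ζ ^ (1 - s) + jap (ξ - ζ) ^ (1 - s)) *
        ((jap (ξ - ζ) ^ (-s) * jap (ξ - ζ) ^ s) * (jap ζ ^ (-s) * jap ζ ^ s) *
          (jap ξ ^ (-s) * jap ξ ^ s)) := by ring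
    _ = _ := by rw [ex, ey, ez]; ring

end Commutator

/-! ### Symmetrizer, dispersion relation and kernel of the first equation -/

/-- The parameters of the Boussinesq system: `α = -a`, `γ = -c`, `b` and the Sobolev exponent. -/
structure Params where
  α : ℝ
  γ : ℝ
  b : ℝ
  s : ℝ
  α_pos : 0 < α
  γ_pos : 0 < γ
  b_pos : 0 < b
  two_lt_s : 2 < s

namespace Params

variable (P : Params) (ε : ℝ)

/-- The symbol of the operator that symmetrizes the linear part. -/
def symM (ξ : Plane) : ℝ :=
  Real.sqrt ((1 + ε * P.γ * freq ξ ^ 2) * (1 + ε * P.b * freq ξ ^ 2) / (1 + ε * P.α * freq ξ ^ 2))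

/-- The dispersion relation of the linearized system. -/
def symΩ (ξ : Plane) : ℝ :=
  freq ξ *
    Real.sqrt ((1 + ε * P.γ * freq ξ ^ 2) * (1 + ε * P.α * freq ξ ^ 2) / (1 + ε * P.b * freq ξ ^ 2))

/-- The kernel of the term `∇ · (η v)` in the symmetrized variables. -/
def kerH (ξ ζ : Plane) : ℝ :=
  P.symM ε ξ / (1 + ε * P.b * freq ξ ^ 2) * freq ξ * cosine ξ ζ / P.symM ε (ξ - ζ)

/-- Lower constant in the comparison of `symM ^ 2` with `1 + ε b k²`. -/
def cM : ℝ := min 1 (P.γ / P.α)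

/-- Upper constant in the comparison of `symM ^ 2` with `1 + ε b k²`. -/
def CM : ℝ := max 1 (P.γ / P.α)

theorem cM_pos : 0 < P.cM := lt_min one_pos (div_pos P.γ_pos P.α_pos)

theorem CM_pos : 0 < P.CM := lt_max_of_lt_left one_pos

variable {P ε}

theorem symM_neg (ξ : Plane) : P.symM ε (-ξ) = P.symM ε ξ := by simp [symM, freq_neg]

theorem symΩ_neg (ξ : Plane) : P.symΩ ε (-ξ) = P.symΩ ε ξ := by simp [symΩ, freq_neg]

theorem one_add_pos (hε : 0 < ε) {c : ℝ} (hc : 0 < c) (ξ : Plane) : 0 < 1 + ε * c * freq ξ ^ 2 := by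
  positivity

theorem symM_sq (hε : 0 < ε) (ξ : Plane) : P.symM ε ξ ^ 2 =
    (1 + ε * P.γ * freq ξ ^ 2) * (1 + ε * P.b * freq ξ ^ 2) / (1 + ε * P.α * freq ξ ^ 2) := by
  have h1 := one_add_pos hε P.γ_pos ξ
  have h2 := one_add_pos hε P.b_pos ξ
  have h3 := one_add_pos hε P.α_pos ξ
  exact Real.sq_sqrt (by positivity)

theorem symM_pos (hε : 0 < ε) (ξ : Plane) : 0 < P.symM ε ξ := by
  have h1 := one_add_pos hε P.γ_pos ξ
  have h2 := one_add_pos hε P.b_pos ξ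
  have h3 := one_add_pos hε P.α_pos ξ
  exact Real.sqrt_pos.2 (by positivity)

/-- The quotient (1+εγk²)/(1+εαk²) stays between the minimum and the maximum of 1 and γ/α. Hence M²
is comparable with 1+εbk², uniformly in ε and in the frequency. -/
theorem le_symM_sq (hε : 0 < ε) (ξ : Plane) :
    P.cM * (1 + ε * P.b * freq ξ ^ 2) ≤ P.symM ε ξ ^ 2 := by
  have h2 := one_add_pos hε P.b_pos ξ
  have h3 := one_add_pos hε P.α_pos ξ
  rw [symM_sq hε, le_div_iff₀ h3, mul_right_comm]
  apply mul_le_mul_of_nonneg_right _ h2.le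
  have e1 : P.cM ≤ 1 := min_le_left _ _
  have e2 : P.cM * P.α ≤ P.γ := by
    rw [← le_div_iff₀ P.α_pos]; exact min_le_right _ _
  have h4 : 0 ≤ ε * freq ξ ^ 2 := by positivity
  nlinarith

theorem symM_sq_le (hε : 0 < ε) (ξ : Plane) :
    P.symM ε ξ ^ 2 ≤ P.CM * (1 + ε * P.b * freq ξ ^ 2) := by
  have h2 := one_add_pos hε P.b_pos ξ
  have h3 := one_add_pos hε P.α_pos ξ
  rw [symM_sq hε, div_le_iff₀ h3, mul_right_comm P.CM]
  apply mul_le_mul_of_nonneg_right _ h2.le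
  have e1 : 1 ≤ P.CM := le_max_left _ _
  have e2 : P.γ ≤ P.CM * P.α := by
    rw [← div_le_iff₀ P.α_pos]; exact le_max_right _ _
  have h4 : 0 ≤ ε * freq ξ ^ 2 := by positivity
  nlinarith

theorem sqrt_cM_le_symM (hε : 0 < ε) (ξ : Plane) : Real.sqrt P.cM ≤ P.symM ε ξ := by
  rw [Real.sqrt_le_left (symM_pos hε ξ).le]
  refine le_trans ?_ (le_symM_sq hε ξ)
  have : 0 ≤ ε * P.b * freq ξ ^ 2 := by have := P.b_pos; positivity
  nlinarith [P.cM_pos]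

theorem measurable_symM : Measurable (P.symM ε) := by
  unfold symM
  have := measurable_freq
  fun_prop

theorem measurable_symΩ : Measurable (P.symΩ ε) := by
  unfold symΩ
  have := measurable_freq
  fun_prop

theorem measurable_kerH : Measurable fun z : Plane × Plane => P.kerH ε z.1 z.2 := by
  have h1 : Measurable fun ξ => P.symM ε ξ / (1 + ε * P.b * freq ξ ^ 2) * freq ξ := by
    have := measurable_freq
    have := measurable_symM (P := P) (ε := ε)
    fun_prop
  exact ((h1.comp measurable_fst).mul (measurable_cosine measurable_fst measurable_snd)).div
    (measurable_symM.comp (measurable_fst.sub measurable_snd))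

theorem kerH_neg (ξ ζ : Plane) : P.kerH ε (-ξ) (-ζ) = P.kerH ε ξ ζ := by
  rw [kerH, kerH, symM_neg, freq_neg, cosine_neg_left, cosine_neg_right, neg_neg,
    show -ξ - -ζ = -(ξ - ζ) by abel, symM_neg]

variable (P) in
/-- The constant in the bound of `kerH`. -/
def Ch : ℝ := Real.sqrt P.CM / (Real.sqrt P.b * Real.sqrt P.cM)

theorem Ch_pos : 0 < P.Ch := by
  have h1 := Real.sqrt_pos.2 P.CM_pos
  have h2 := Real.sqrt_pos.2 P.cM_pos
  have h3 := Real.sqrt_pos.2 P.b_pos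
  unfold Ch
  positivity

/-- Since M/(1+εbk²) is at most a constant times (1+εbk²)^{-1/2}, the derivative k is absorbed,
because (εb)^{1/2} k ≤ (1+εbk²)^{1/2}. The price is ε^{-1/2}, and this price fixes the time scale of
the theorem. -/
theorem sqrt_mul_abs_kerH_le (hε : 0 < ε) (ξ ζ : Plane) : Real.sqrt ε * |P.kerH ε ξ ζ| ≤ P.Ch := by
  have hM := symM_pos (P := P) hε ξ
  have hM' := symM_pos (P := P) hε (ξ - ζ)
  have hE := one_add_pos hε P.b_pos ξ
  have hk := freq_nonneg ξ
  have hcm := Real.sqrt_pos.2 P.cM_pos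
  have hb := Real.sqrt_pos.2 P.b_pos
  have hCM := Real.sqrt_pos.2 P.CM_pos
  set E := 1 + ε * P.b * freq ξ ^ 2
  have hsE := Real.sqrt_pos.2 hE
  have h1 : P.symM ε ξ ≤ Real.sqrt P.CM * Real.sqrt E := by
    rw [← Real.sqrt_mul P.CM_pos.le]
    exact Real.le_sqrt_of_sq_le (symM_sq_le hε ξ)
  have h2 : Real.sqrt ε * Real.sqrt P.b * freq ξ ≤ Real.sqrt E := by
    apply Real.le_sqrt_of_sq_le
    rw [mul_pow, mul_pow, Real.sq_sqrt hε.le, Real.sq_sqrt P.b_pos.le]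
    linarith
  have hEE : E = Real.sqrt E * Real.sqrt E := (Real.mul_self_sqrt hE.le).symm
  have h3 : |P.kerH ε ξ ζ| ≤ P.symM ε ξ / E * freq ξ * 1 / Real.sqrt P.cM := by
    rw [kerH, abs_div, abs_mul, abs_of_pos hM', abs_of_nonneg (by positivity)]
    gcongr
    · exact abs_cosine_le ξ ζ
    · exact sqrt_cM_le_symM hε _
  calc Real.sqrt ε * |P.kerH ε ξ ζ|
      ≤ Real.sqrt ε * ((Real.sqrt P.CM * Real.sqrt E) / E * freq ξ * 1 / Real.sqrt P.cM) := by
        refine mul_le_mul_of_nonneg_left (h3.trans ?_) (Real.sqrt_nonneg _)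
        gcongr
    _ = (Real.sqrt P.CM / (Real.sqrt P.b * Real.sqrt P.cM)) *
          ((Real.sqrt ε * Real.sqrt P.b * freq ξ) / Real.sqrt E) := by
        rw [hEE, Real.sqrt_mul_self (Real.sqrt_nonneg E)]
        field_simp
    _ ≤ P.Ch * 1 := by
        rw [Ch]
        gcongr
        rwa [div_le_one hsE]
    _ = _ := mul_one _

theorem eps_mul_abs_kerH_le (hε : 0 < ε) (ξ ζ : Plane) :
    ε * |P.kerH ε ξ ζ| ≤ P.Ch * Real.sqrt ε := by
  have h := mul_le_mul_of_nonneg_left (sqrt_mul_abs_kerH_le (P := P) hε ξ ζ) (Real.sqrt_nonneg ε)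
  rw [← mul_assoc, Real.mul_self_sqrt hε.le] at h
  linarith

/-- A crude bound, obtained by dropping the denominator. It needs only to be polynomial and uniform
in ε, since the damping absorbs it. -/
theorem symΩ_le (hε : 0 < ε) (hε1 : ε ≤ 1) (ξ : Plane) :
    P.symΩ ε ξ ≤ Real.sqrt ((1 + P.γ) * (1 + P.α)) * jap ξ ^ 3 := by
  have hk := freq_nonneg ξ
  have hj := jap_pos ξ
  have hγ := P.γ_pos
  have hα := P.α_pos
  have hb := P.b_pos
  have h : ∀ c : ℝ, 0 < c → 1 + ε * c * freq ξ ^ 2 ≤ (1 + c) * jap ξ ^ 2 := by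
    intro c hc
    rw [jap_sq]
    have : ε * c * freq ξ ^ 2 ≤ 1 * c * freq ξ ^ 2 := by gcongr
    nlinarith [sq_nonneg (freq ξ)]
  have h1 : (1 + ε * P.γ * freq ξ ^ 2) * (1 + ε * P.α * freq ξ ^ 2) / (1 + ε * P.b * freq ξ ^ 2)
      ≤ (1 + P.γ) * (1 + P.α) * (jap ξ ^ 2) ^ 2 := by
    have hE := one_add_pos hε P.b_pos ξ
    rw [div_le_iff₀ hE]
    have e : (1:ℝ) ≤ 1 + ε * P.b * freq ξ ^ 2 := by
      have : 0 ≤ ε * P.b * freq ξ ^ 2 := by positivity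
      linarith
    calc _ ≤ ((1 + P.γ) * jap ξ ^ 2) * ((1 + P.α) * jap ξ ^ 2) :=
          mul_le_mul (h _ hγ) (h _ hα) (one_add_pos hε hα ξ).le (by positivity)
      _ = (1 + P.γ) * (1 + P.α) * (jap ξ ^ 2) ^ 2 * 1 := by ring
      _ ≤ _ := by gcongr
  have h2 := Real.sqrt_le_sqrt h1
  rw [Real.sqrt_mul (by positivity), Real.sqrt_sq (by positivity)] at h2
  calc P.symΩ ε ξ ≤ jap ξ * (Real.sqrt ((1 + P.γ) * (1 + P.α)) * jap ξ ^ 2) := by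
        unfold symΩ
        gcongr
        exact freq_le_jap ξ
    _ = _ := by ring

end Params

/-! ### The damped vector field as a quadratic map on L² -/

/-- The decaying weight `⟨ξ⟩^{-4}` with which the equations are written in `L²`. -/
def damp (ξ : Plane) : ℝ := jap ξ ^ (-4 : ℝ)

theorem damp_pos (ξ : Plane) : 0 < damp ξ := jap_rpow_pos _ ξ

theorem damp_neg (ξ : Plane) : damp (-ξ) = damp ξ := by rw [damp, damp, jap_neg]

theorem measurable_damp : Measurable damp := measurable_jap_rpow _

theorem damp_mul_jap_pow (ξ : Plane) : damp ξ * jap ξ ^ 4 = 1 := by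
  have := jap_rpow_neg_mul 4 ξ
  rw [damp]
  exact_mod_cast this

theorem isMultiplier_damp : IsMultiplier damp := isMultiplier_jap (by norm_num)

/-- The kernel of the nonlinear term `½ |∇| |v|²` when `v` is a gradient. -/
def kerW (ξ ζ : Plane) : ℝ := 1 / 2 * freq ξ * cosine (ξ - ζ) ζ

theorem measurable_kerW : Measurable fun z : Plane × Plane => kerW z.1 z.2 :=
  ((measurable_const.mul measurable_freq).comp measurable_fst).mul
    (measurable_cosine (measurable_fst.sub measurable_snd) measurable_snd)

theorem abs_kerW_le (ξ ζ : Plane) : |kerW ξ ζ| ≤ jap ξ := by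
  have hk := freq_nonneg ξ
  rw [kerW, abs_mul, abs_of_nonneg (by positivity)]
  have h1 := abs_cosine_le (ξ - ζ) ζ
  have h2 := freq_le_jap ξ
  nlinarith [abs_nonneg (cosine (ξ - ζ) ζ)]

theorem kerW_neg (ξ ζ : Plane) : kerW (-ξ) (-ζ) = kerW ξ ζ := by
  rw [kerW, kerW, freq_neg, cosine_neg_right, show -ξ - -ζ = -(ξ - ζ) by abel, cosine_neg_left,
    neg_neg]

theorem kerW_swap (ξ ζ : Plane) : kerW ξ (ξ - ζ) = kerW ξ ζ := by
  rw [kerW, kerW, sub_sub_cancel, cosine_comm]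

theorem isConvKernel_damp_kerW : IsConvKernel fun ξ ζ => damp ξ * kerW ξ ζ := by
  refine ⟨(measurable_damp.comp measurable_fst).mul measurable_kerW, fun ξ => jap ξ ^ (-3 : ℝ),
    isWeight_jap (by norm_num), fun ξ ζ => ?_⟩
  rw [abs_mul, abs_of_pos (damp_pos ξ)]
  have e : jap ξ ^ (-3 : ℝ) = damp ξ * jap ξ := by
    rw [damp, ← Real.rpow_add_one (jap_pos ξ).ne']; norm_num
  change _ ≤ jap ξ ^ (-3 : ℝ)
  rw [e]
  exact mul_le_mul_of_nonneg_left (abs_kerW_le ξ ζ) (damp_pos ξ).le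

namespace Params

variable {P : Params} {ε : ℝ}

/-- The exponent 4 of `damp` exceeds the order 3 in `symΩ_le`, leaves room for square-integrability
of the damped kernels, and makes the inverse weight ⟨ξ⟩⁴ the symbol of a differential operator,
`quartic`, that acts on test functions. -/
theorem isMultiplier_damp_symΩ (hε : 0 < ε) (hε1 : ε ≤ 1) :
    IsMultiplier fun ξ => damp ξ * P.symΩ ε ξ := by
  refine ⟨measurable_damp.mul measurable_symΩ, Real.sqrt ((1 + P.γ) * (1 + P.α)), fun ξ => ?_⟩
  have h0 : 0 ≤ P.symΩ ε ξ := mul_nonneg (freq_nonneg ξ) (Real.sqrt_nonneg _)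
  have hd := damp_pos ξ
  have h1 := one_le_jap ξ
  have h3 : jap ξ ^ 3 ≤ jap ξ ^ 4 := pow_le_pow_right₀ h1 (by norm_num)
  rw [abs_of_nonneg (by positivity)]
  calc damp ξ * P.symΩ ε ξ ≤ damp ξ * (Real.sqrt ((1 + P.γ) * (1 + P.α)) * jap ξ ^ 4) := by
        gcongr
        refine (symΩ_le hε hε1 ξ).trans ?_
        gcongr
    _ = Real.sqrt ((1 + P.γ) * (1 + P.α)) * (damp ξ * jap ξ ^ 4) := by ring
    _ = _ := by rw [damp_mul_jap_pow, mul_one]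

theorem isConvKernel_damp_kerH (hε : 0 < ε) : IsConvKernel fun ξ ζ => damp ξ * P.kerH ε ξ ζ := by
  have hs := Real.sqrt_pos.2 hε
  have hC := P.Ch_pos
  have hw := isWeight_jap (q := -4) (by norm_num)
  refine ⟨(measurable_damp.comp measurable_fst).mul measurable_kerH,
    fun ξ => (P.Ch / Real.sqrt ε) * jap ξ ^ (-4 : ℝ),
    ⟨measurable_const.mul hw.measurable, fun ξ => ?_, hw.memLp.const_mul _⟩, fun ξ ζ => ?_⟩
  · have := hw.nonneg ξ
    positivity
  · rw [abs_mul, abs_of_pos (damp_pos ξ), mul_comm, damp]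
    refine mul_le_mul_of_nonneg_right ?_ (damp_pos ξ).le
    rw [le_div_iff₀ hs, mul_comm]
    exact sqrt_mul_abs_kerH_le hε ξ ζ

variable (P ε) in
/-- The first component of the damped vector field, in Fourier variables. -/
def fieldH (h w : H) : H :=
  mulL (fun ξ => damp ξ * P.symΩ ε ξ) w + ε • conv (fun ξ ζ => damp ξ * P.kerH ε ξ ζ) h w

variable (P ε) in
/-- The second component of the damped vector field, in Fourier variables. -/
def fieldW (h w : H) : H :=
  -mulL (fun ξ => damp ξ * P.symΩ ε ξ) h + ε • conv (fun ξ ζ => damp ξ * kerW ξ ζ) w w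

/-- Thanks to the damping, no Sobolev norm is involved: L² convergence alone suffices to pass to the
limit in the equations. -/
theorem continuous_fieldH : Continuous fun p : H × H => P.fieldH ε p.1 p.2 := by
  unfold fieldH
  fun_prop

theorem continuous_fieldW : Continuous fun p : H × H => P.fieldW ε p.1 p.2 := by
  unfold fieldW
  fun_prop

theorem reflect_fieldH (hε : 0 < ε) (hε1 : ε ≤ 1) {h w : H} (hh : reflect h = h)
    (hw : reflect w = w) : reflect (P.fieldH ε h w) = P.fieldH ε h w := by
  rw [fieldH, map_add, map_smul, reflect_mulL (isMultiplier_damp_symΩ hε hε1)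
    (fun ξ => by rw [damp_neg, symΩ_neg]), reflect_conv (isConvKernel_damp_kerH hε)
    (fun ξ ζ => by rw [damp_neg, kerH_neg]), hh, hw]

theorem reflect_fieldW (hε : 0 < ε) (hε1 : ε ≤ 1) {h w : H} (hh : reflect h = h)
    (hw : reflect w = w) : reflect (P.fieldW ε h w) = P.fieldW ε h w := by
  rw [fieldW, map_add, map_neg, map_smul, reflect_mulL (isMultiplier_damp_symΩ hε hε1)
    (fun ξ => by rw [damp_neg, symΩ_neg]), reflect_conv isConvKernel_damp_kerW
    (fun ξ ζ => by rw [damp_neg, kerW_neg]), hh, hw]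

/-! ### The energy estimate in H^s -/

variable (P) in
/-- The weight `⟨ξ⟩^{1-s}`, square-integrable because `s > 2`. -/
def wgt (ξ : Plane) : ℝ := jap ξ ^ (1 - P.s)

theorem isWeight_wgt : IsWeight P.wgt := isWeight_jap (by linarith [P.two_lt_s])

/-- The weight `p²⟨ξ⟩^{-s}⟨ξ⟩⁴` cut off at frequency `n`. -/
def energySym (s n : ℝ) (p : Plane → ℝ) (ξ : Plane) : ℝ :=
  cut n ξ * (p ξ ^ 2 * jap ξ ^ (-s) * jap ξ ^ 4)

theorem _root_.Boussinesq.IsEnergyWeight.sq_mul_le {s : ℝ} {p : Plane → ℝ} (hp : IsEnergyWeight s p) (ξ : Plane) :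
    p ξ ^ 2 * jap ξ ^ (-s) ≤ jap ξ ^ s := by
  have h := pow_le_pow_left₀ (hp.nonneg ξ) (hp.le ξ) 2
  calc p ξ ^ 2 * jap ξ ^ (-s) ≤ (jap ξ ^ s) ^ 2 * jap ξ ^ (-s) :=
        mul_le_mul_of_nonneg_right h (jap_rpow_pos _ ξ).le
    _ = jap ξ ^ s * (jap ξ ^ (-s) * jap ξ ^ s) := by ring
    _ = _ := by rw [jap_rpow_neg_mul, mul_one]

theorem isMultiplier_energySym {s : ℝ} (hs : 0 ≤ s) (n : ℝ) {p : Plane → ℝ}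
    (hp : IsEnergyWeight s p) : IsMultiplier (energySym s n p) := by
  refine isMultiplier_cut_mul n (((hp.measurable.pow_const 2).mul (measurable_jap_rpow _)).mul
    (measurable_jap.pow_const 4)) (C := Real.sqrt (1 + n ^ 2) ^ s * Real.sqrt (1 + n ^ 2) ^ 4)
    fun ξ h => ?_
  have h1 := hp.sq_mul_le ξ
  have h2 := jap_le_of_freq_le h
  have h3 := jap_pos ξ
  have h4 := jap_rpow_pos (-s) ξ
  rw [abs_of_nonneg (by positivity)]
  gcongr
  exact h1.trans (Real.rpow_le_rpow h3.le h2 hs)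

/-- The product estimate behind the algebra property of `H^s`. -/
theorem jap_rpow_mul_le {s : ℝ} (hs : 0 ≤ s) (ξ ζ : Plane) :
    jap ξ ^ s * (jap (ξ - ζ) ^ (-s) * jap ζ ^ (-s)) ≤
      2 ^ s * (jap (ξ - ζ) ^ (1 - s) + jap ζ ^ (1 - s)) := by
  have hx := jap_rpow_pos (-s) (ξ - ζ)
  have hy := jap_rpow_pos (-s) ζ
  have h := rpow_le_two_rpow_mul hs (jap_pos (ξ - ζ)) (jap_pos ζ) (jap_pos ξ) (jap_le_add ξ ζ)
  calc jap ξ ^ s * (jap (ξ - ζ) ^ (-s) * jap ζ ^ (-s))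
      ≤ 2 ^ s * (jap (ξ - ζ) ^ s + jap ζ ^ s) * (jap (ξ - ζ) ^ (-s) * jap ζ ^ (-s)) := by gcongr
    _ = 2 ^ s * ((jap (ξ - ζ) ^ (-s) * jap (ξ - ζ) ^ s) * jap ζ ^ (-s) +
          (jap ζ ^ (-s) * jap ζ ^ s) * jap (ξ - ζ) ^ (-s)) := by ring
    _ = 2 ^ s * (jap (ξ - ζ) ^ (-s) + jap ζ ^ (-s)) := by
        rw [jap_rpow_neg_mul, jap_rpow_neg_mul]; ring
    _ ≤ _ := by
        gcongr
        all_goals first | exact one_le_jap _ | linarith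

variable (P) in
/-- The constant of the `H^s` energy estimate. -/
def energyConst : ℝ := 3 * wnorm P.wgt * (P.Ch * 2 ^ P.s + commConst P.s)

theorem energyConst_nonneg : 0 ≤ P.energyConst := by
  have h1 := P.Ch_pos
  have h2 := commConst_pos (s := P.s) (by linarith [P.two_lt_s])
  have h3 := wnorm_nonneg P.wgt
  unfold energyConst
  positivity

end Params

/-- The weight `⟨ξ⟩^{-s}` cut off at frequency `n`. -/
def cutJap (s n : ℝ) (ξ : Plane) : ℝ := cut n ξ * jap ξ ^ (-s)

theorem isMultiplier_cutJap (s n : ℝ) : IsMultiplier (cutJap s n) := isMultiplier_cut_jap n (-s)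

theorem cut_sq (n : ℝ) (ξ : Plane) : cut n ξ * cut n ξ = cut n ξ := cut_mul_cut le_rfl ξ

namespace Params

variable {P : Params} {ε : ℝ}

theorem abs_cut_mul_le {n : ℝ} (ξ ζ : Plane) (x : ℝ) :
    |cut n ξ * cut n ζ * cut n (ξ - ζ) * x| ≤ |x| := by
  rw [abs_mul, abs_mul, abs_mul]
  have h1 := abs_cut_le n ξ
  have h2 := abs_cut_le n ζ
  have h3 := abs_cut_le n (ξ - ζ)
  have h12 := mul_le_one₀ h1 (abs_nonneg _) h2
  have h := mul_le_one₀ h12 (abs_nonneg _) h3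
  calc _ ≤ 1 * |x| := mul_le_mul_of_nonneg_right h (abs_nonneg _)
    _ = _ := one_mul _

theorem wgt_pos (ξ : Plane) : 0 < P.wgt ξ := jap_rpow_pos _ ξ

theorem measurable_cut_cut_cut (n : ℝ) :
    Measurable fun z : Plane × Plane => cut n z.1 * cut n z.2 * cut n (z.1 - z.2) :=
  (((measurable_cut n).comp measurable_fst).mul ((measurable_cut n).comp measurable_snd)).mul
    ((measurable_cut n).comp (measurable_fst.sub measurable_snd))

theorem measurable_jap_jap_jap (s : ℝ) : Measurable fun z : Plane × Plane =>
    jap (z.1 - z.2) ^ (-s) * jap z.2 ^ (-s) * jap z.1 ^ (-s) :=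
  (((measurable_jap_rpow (-s)).comp (measurable_fst.sub measurable_snd)).mul
    ((measurable_jap_rpow (-s)).comp measurable_snd)).mul
      ((measurable_jap_rpow (-s)).comp measurable_fst)

/-- Since p²⟨ξ⟩^{-s} ≤ ⟨ξ⟩^s, the algebra estimate `jap_rpow_mul_le` applies to every energy weight.
It suffices for kernels of order zero. -/
theorem sq_mul_jap_le {p : Plane → ℝ} (hp : IsEnergyWeight P.s p) (ξ ζ : Plane) :
    p ξ ^ 2 * (jap (ξ - ζ) ^ (-P.s) * jap ζ ^ (-P.s) * jap ξ ^ (-P.s)) ≤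
      2 ^ P.s * (P.wgt ξ + P.wgt ζ + P.wgt (ξ - ζ)) := by
  have h1 := hp.sq_mul_le ξ
  have hx := jap_rpow_pos (-P.s) (ξ - ζ)
  have hy := jap_rpow_pos (-P.s) ζ
  have h0 := wgt_pos (P := P) ξ
  calc p ξ ^ 2 * (jap (ξ - ζ) ^ (-P.s) * jap ζ ^ (-P.s) * jap ξ ^ (-P.s))
      = (p ξ ^ 2 * jap ξ ^ (-P.s)) * (jap (ξ - ζ) ^ (-P.s) * jap ζ ^ (-P.s)) := by ring
    _ ≤ jap ξ ^ P.s * (jap (ξ - ζ) ^ (-P.s) * jap ζ ^ (-P.s)) := by gcongr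
    _ ≤ 2 ^ P.s * (P.wgt (ξ - ζ) + P.wgt ζ) :=
        jap_rpow_mul_le (by linarith [P.two_lt_s]) ξ ζ
    _ ≤ _ := by gcongr 2 ^ P.s * ?_; linarith

/-- Energy estimate of the first nonlinear term. -/
theorem abs_energy_kerH_le (hε : 0 < ε) {p : Plane → ℝ} (hp : IsEnergyWeight P.s p) (n : ℝ)
    (f g : H) :
    |ε * inner ℝ (mulL (energySym P.s n p)
      (conv (fun ξ ζ => damp ξ * P.kerH ε ξ ζ) (mulL (cutJap P.s n) f) (mulL (cutJap P.s n) g))) f| ≤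
      3 * (P.Ch * 2 ^ P.s * Real.sqrt ε) * wnorm P.wgt * ‖f‖ * ‖g‖ * ‖f‖ := by
  have hs : 0 ≤ P.s := by linarith [P.two_lt_s]
  have hq := isMultiplier_energySym hs n hp
  have hc := isMultiplier_cutJap P.s n
  rw [inner_mulL hq, inner_conv (isConvKernel_damp_kerH hε), tri_mulL hc hc hq, ← tri_const_mul]
  -- The factor `damp` cancels against the ⟨ξ⟩⁴ inside `energySym`, and the cutoffs are gathered
  -- into one product of absolute value at most 1.
  rw [tri_congr (s' := fun ξ ζ => cut n ξ * cut n ζ * cut n (ξ - ζ) *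
      ((ε * P.kerH ε ξ ζ) * (p ξ ^ 2 *
        (jap (ξ - ζ) ^ (-P.s) * jap ζ ^ (-P.s) * jap ξ ^ (-P.s)))))]
  · have hCh := P.Ch_pos
    refine abs_tri_le (by positivity) ⟨?_, fun ξ ζ => ?_⟩ isWeight_wgt f g f
    · exact (measurable_cut_cut_cut n).mul ((measurable_const.mul measurable_kerH).mul
        (((hp.measurable.comp measurable_fst).pow_const 2).mul (measurable_jap_jap_jap P.s)))
    · refine (abs_cut_mul_le ξ ζ _).trans ?_
      have h1 := sq_mul_jap_le hp ξ ζ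
      have hx := jap_rpow_pos (-P.s) (ξ - ζ)
      have hy := jap_rpow_pos (-P.s) ζ
      have hz := jap_rpow_pos (-P.s) ξ
      rw [abs_mul, abs_mul, abs_of_pos hε, abs_of_nonneg (by positivity : 0 ≤ p ξ ^ 2 * _)]
      calc _ ≤ (P.Ch * Real.sqrt ε) * (2 ^ P.s * (P.wgt ξ + P.wgt ζ + P.wgt (ξ - ζ))) :=
            mul_le_mul (eps_mul_abs_kerH_le hε ξ ζ) h1 (by positivity) (by positivity)
        _ = _ := by ring
  · intro ξ ζ
    simp only [energySym, cutJap]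
    linear_combination (cut n ξ * cut n ζ * cut n (ξ - ζ) * ((ε * P.kerH ε ξ ζ) * (p ξ ^ 2 *
        (jap (ξ - ζ) ^ (-P.s) * jap ζ ^ (-P.s) * jap ξ ^ (-P.s))))) * damp_mul_jap_pow ξ

/-- The transport kernel with the weights of the energy estimate. -/
def energyKer (s n : ℝ) (p : Plane → ℝ) (ξ ζ : Plane) : ℝ :=
  cut n ξ * cut n ζ * cut n (ξ - ζ) *
    ((p ξ ^ 2 * transport ξ ζ) * (jap (ξ - ζ) ^ (-s) * jap ζ ^ (-s) * jap ξ ^ (-s)))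

/-- The derivative is bounded by the cutoff, so the constant grows with `n`. This is used only for
integrability before the symmetrization and does not enter the energy estimate. -/
theorem dominated_energyKer {p : Plane → ℝ} (hp : IsEnergyWeight P.s p) {n : ℝ} (hn : 0 ≤ n) :
    Dominated (energyKer P.s n p) (n * 2 ^ P.s) P.wgt := by
  refine ⟨(measurable_cut_cut_cut n).mul ((((hp.measurable.comp measurable_fst).pow_const 2).mul
      measurable_transport).mul (measurable_jap_jap_jap P.s)), fun ξ ζ => ?_⟩
  have hx := jap_rpow_pos (-P.s) (ξ - ζ)
  have hy := jap_rpow_pos (-P.s) ζ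
  have hz := jap_rpow_pos (-P.s) ξ
  have w1 := wgt_pos (P := P) ξ
  have w2 := wgt_pos (P := P) ζ
  have w3 := wgt_pos (P := P) (ξ - ζ)
  by_cases h : freq ζ ≤ n
  · refine (abs_cut_mul_le ξ ζ _).trans ?_
    rw [abs_mul, abs_mul, abs_of_nonneg (sq_nonneg (p ξ)),
      abs_of_pos (by positivity : 0 < jap (ξ - ζ) ^ (-P.s) * jap ζ ^ (-P.s) * jap ξ ^ (-P.s))]
    calc _ = |transport ξ ζ| * (p ξ ^ 2 *
          (jap (ξ - ζ) ^ (-P.s) * jap ζ ^ (-P.s) * jap ξ ^ (-P.s))) := by ring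
      _ ≤ n * (2 ^ P.s * (P.wgt ξ + P.wgt ζ + P.wgt (ξ - ζ))) :=
          mul_le_mul ((abs_transport_le ξ ζ).trans h) (sq_mul_jap_le hp ξ ζ) (by positivity) hn
      _ = _ := by ring
  · have : energyKer P.s n p ξ ζ = 0 := by simp [energyKer, cut, h]
    rw [this, abs_zero]
    positivity

theorem _root_.Boussinesq.Dominated.swap_factors {s : Plane → Plane → ℝ} {C : ℝ} {w : Plane → ℝ}
    (h : Dominated s C w) : Dominated (fun ξ ζ => s ξ (ξ - ζ)) C w := by
  refine ⟨h.measurable.comp (measurable_fst.prodMk (measurable_fst.sub measurable_snd)),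
    fun ξ ζ => ?_⟩
  have := h.bound ξ (ξ - ζ)
  rw [sub_sub_cancel] at this
  linarith

theorem measurable_transpose {s : Plane → Plane → ℝ}
    (h : Measurable fun z : Plane × Plane => s z.1 z.2) :
    Measurable fun z : Plane × Plane => s z.2 z.1 :=
  h.comp (measurable_snd.prodMk measurable_fst)

/-- The product of the three cutoffs and the product of the three brackets are invariant under
exchanging ξ and ζ, so they factor out of the symmetrization. The commutator estimate then gives a
constant independent of `n`. -/
theorem dominated_energyKer_symm {p : Plane → ℝ} (hp : IsEnergyWeight P.s p) {n : ℝ}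
    (hn : 0 ≤ n) : Dominated (fun ξ ζ => 1 / 2 * (energyKer P.s n p ξ ζ + energyKer P.s n p ζ ξ))
      (commConst P.s) P.wgt := by
  have hs1 : 1 ≤ P.s := by linarith [P.two_lt_s]
  have mk := (dominated_energyKer hp hn).measurable
  have mk' : Measurable fun z : Plane × Plane => energyKer P.s n p z.2 z.1 :=
    measurable_transpose mk
  have m : Measurable fun z : Plane × Plane =>
      1 / 2 * (energyKer P.s n p z.1 z.2 + energyKer P.s n p z.2 z.1) := by fun_prop
  refine ⟨m, fun ξ ζ => ?_⟩
  have hx := jap_rpow_pos (-P.s) (ξ - ζ)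
  have hy := jap_rpow_pos (-P.s) ζ
  have hz := jap_rpow_pos (-P.s) ξ
  have e : 1 / 2 * (energyKer P.s n p ξ ζ + energyKer P.s n p ζ ξ) =
      cut n ξ * cut n ζ * cut n (ξ - ζ) *
      (1 / 2 * ((p ξ ^ 2 * transport ξ ζ + p ζ ^ 2 * transport ζ ξ) *
        (jap (ξ - ζ) ^ (-P.s) * jap ζ ^ (-P.s) * jap ξ ^ (-P.s)))) := by
    simp only [energyKer]
    rw [← neg_sub ξ ζ, cut_neg, jap_neg]
    ring
  change |1 / 2 * (energyKer P.s n p ξ ζ + energyKer P.s n p ζ ξ)| ≤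
    commConst P.s * (jap ξ ^ (1 - P.s) + jap ζ ^ (1 - P.s) + jap (ξ - ζ) ^ (1 - P.s))
  have h := abs_weighted_transport_symm_le hs1 hp ξ ζ
  rw [e]
  apply (abs_cut_mul_le ξ ζ _).trans
  have h0 : 0 ≤ |p ξ ^ 2 * transport ξ ζ + p ζ ^ 2 * transport ζ ξ| *
    (jap (ξ - ζ) ^ (-P.s) * jap ζ ^ (-P.s) * jap ξ ^ (-P.s)) := by positivity
  rw [abs_mul, abs_mul, abs_of_pos (by norm_num : (0:ℝ) < 1 / 2),
    abs_of_pos (by positivity : 0 < jap (ξ - ζ) ^ (-P.s) * jap ζ ^ (-P.s) * jap ξ ^ (-P.s))]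
  linarith

/-- Energy estimate of the second nonlinear term: the loss of derivative cancels. -/
theorem abs_energy_kerW_le {p : Plane → ℝ} (hp : IsEnergyWeight P.s p) {n : ℝ}
    (hn : 0 ≤ n) {g : H} (hg : reflect g = g) :
    |inner ℝ (mulL (energySym P.s n p)
      (conv (fun ξ ζ => damp ξ * kerW ξ ζ) (mulL (cutJap P.s n) g) (mulL (cutJap P.s n) g))) g| ≤
      3 * commConst P.s * wnorm P.wgt * ‖g‖ * ‖g‖ * ‖g‖ := by
  have hs : 0 ≤ P.s := by linarith [P.two_lt_s]
  have hq := isMultiplier_energySym hs n hp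
  have hc := isMultiplier_cutJap P.s n
  have hCp := commConst_pos (s := P.s) (by linarith [P.two_lt_s])
  have hn0 : 0 ≤ n * 2 ^ P.s := by positivity
  have hk := dominated_energyKer hp hn
  rw [inner_mulL hq, inner_conv isConvKernel_damp_kerW, tri_mulL hc hc hq]
  -- The kernel is the mean of two transport kernels that differ by ζ ↦ ξ-ζ. Since both factors are
  -- `g`, the two contribute equally.
  have e1 : tri (fun ξ ζ => damp ξ * kerW ξ ζ * (cutJap P.s n (ξ - ζ) * cutJap P.s n ζ *
      energySym P.s n p ξ)) g g g = tri (energyKer P.s n p) g g g := by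
    rw [tri_congr (s' := fun ξ ζ => (1 / 2) * (energyKer P.s n p ξ ζ +
      energyKer P.s n p ξ (ξ - ζ))), tri_const_mul, tri_add hn0 hk isWeight_wgt hn0
      hk.swap_factors isWeight_wgt, ← tri_swap_factors]
    · ring
    · intro ξ ζ
      have h := half_freq_mul_cosine ξ ζ
      simp only [energySym, cutJap, energyKer, sub_sub_cancel, kerW]
      rw [h]
      linear_combination (1 / 2 * (transport ξ ζ + transport ξ (ξ - ζ)) *
        (cut n ξ * cut n ζ * cut n (ξ - ζ) * (p ξ ^ 2 *
        (jap (ξ - ζ) ^ (-P.s) * jap ζ ^ (-P.s) * jap ξ ^ (-P.s))))) * damp_mul_jap_pow ξ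
  rw [e1, tri_antisymm hn0 hk isWeight_wgt hg, ← tri_const_mul]
  exact abs_tri_le hCp.le (dominated_energyKer_symm hp hn) isWeight_wgt g g g

/-- The linear part of the vector field is skew. -/
theorem inner_energySym_symΩ (hε : 0 < ε) (hε1 : ε ≤ 1) {p : Plane → ℝ}
    (hp : IsEnergyWeight P.s p) (n : ℝ) (f g : H) :
    inner ℝ (mulL (energySym P.s n p) (mulL (fun ξ => damp ξ * P.symΩ ε ξ)
        (mulL (cutJap P.s n) g))) f =
      inner ℝ (mulL (energySym P.s n p) (mulL (fun ξ => damp ξ * P.symΩ ε ξ)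
        (mulL (cutJap P.s n) f))) g := by
  have hq := isMultiplier_energySym (by linarith [P.two_lt_s] : 0 ≤ P.s) n hp
  have hc := isMultiplier_cutJap P.s n
  have hΩ := isMultiplier_damp_symΩ (P := P) hε hε1
  rw [mulL_mulL hΩ hc, mulL_mulL hq (hΩ.mul hc), inner_mulL (hq.mul (hΩ.mul hc)),
    real_inner_comm, mulL_mulL hΩ hc, mulL_mulL hq (hΩ.mul hc)]

/-- The energy estimate for functions with bounded frequencies. -/
theorem abs_inner_field_le (hε : 0 < ε) (hε1 : ε ≤ 1) {p : Plane → ℝ}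
    (hp : IsEnergyWeight P.s p) {n : ℝ} (hn : 0 ≤ n) (f : H) {g : H} (hg : reflect g = g) :
    |inner ℝ (mulL (energySym P.s n p)
        (P.fieldH ε (mulL (cutJap P.s n) f) (mulL (cutJap P.s n) g))) f +
      inner ℝ (mulL (energySym P.s n p)
        (P.fieldW ε (mulL (cutJap P.s n) f) (mulL (cutJap P.s n) g))) g| ≤
      P.energyConst * Real.sqrt ε * ((‖f‖ ^ 2 + ‖g‖ ^ 2) * ‖g‖) := by
  have h1 := abs_energy_kerH_le hε hp n f g
  have h2 := abs_energy_kerW_le hp hn hg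
  have hskew := inner_energySym_symΩ hε hε1 hp n f g
  rw [fieldH, fieldW, map_add, map_add, map_neg, map_smul, map_smul, inner_add_left, inner_add_left,
    inner_neg_left, inner_smul_left, inner_smul_left, hskew]
  simp only [conj_trivial]
  set A := ε * inner ℝ (mulL (energySym P.s n p)
      (conv (fun ξ ζ => damp ξ * P.kerH ε ξ ζ) (mulL (cutJap P.s n) f) (mulL (cutJap P.s n) g))) f
  set B := inner ℝ (mulL (energySym P.s n p)
      (conv (fun ξ ζ => damp ξ * kerW ξ ζ) (mulL (cutJap P.s n) g) (mulL (cutJap P.s n) g))) g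
  -- The transport term carries the better factor ε, which is weakened to match the rate of the
  -- other term.
  have hεs : ε ≤ Real.sqrt ε := Real.le_sqrt_of_sq_le (by nlinarith)
  have hC := commConst_pos (s := P.s) (by linarith [P.two_lt_s])
  have hCh := P.Ch_pos
  have w0 := wnorm_nonneg P.wgt
  have h3 : |ε * B| ≤ Real.sqrt ε * (3 * commConst P.s * wnorm P.wgt * ‖g‖ * ‖g‖ * ‖g‖) := by
    rw [abs_mul, abs_of_pos hε]
    gcongr
  have e : ∀ x : ℝ, x + A + (-x + ε * B) = A + ε * B := fun x => by ring
  rw [e]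
  refine (abs_add_le _ _).trans ((add_le_add h1 h3).trans ?_)
  have t1 : 0 ≤ wnorm P.wgt * Real.sqrt ε * (commConst P.s * (‖f‖ ^ 2 * ‖g‖)) := by positivity
  have t2 : 0 ≤ wnorm P.wgt * Real.sqrt ε * (P.Ch * 2 ^ P.s * (‖g‖ ^ 2 * ‖g‖)) := by positivity
  unfold energyConst
  nlinarith

end Params

/-! ### The Galerkin system -/

/-- The Hilbert space of pairs of Fourier-side unknowns. -/
abbrev HH : Type := WithLp 2 (H × H)

/-- The inclusion of the first component. -/
def inlHH : H →L[ℝ] HH :=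
  (WithLp.prodContinuousLinearEquiv 2 ℝ H H).symm.toContinuousLinearMap.comp
    (ContinuousLinearMap.inl ℝ H H)

/-- The inclusion of the second component. -/
def inrHH : H →L[ℝ] HH :=
  (WithLp.prodContinuousLinearEquiv 2 ℝ H H).symm.toContinuousLinearMap.comp
    (ContinuousLinearMap.inr ℝ H H)

theorem inner_inl_add_inr (x y : H) (z : HH) :
    inner ℝ (inlHH x + inrHH y) z = inner ℝ x z.fst + inner ℝ y z.snd := by
  simp [inlHH, inrHH, WithLp.prod_inner_apply]

theorem fst_inl_add_inr (x y : H) : (inlHH x + inrHH y).fst = x := by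
  simp [inlHH, inrHH]

theorem snd_inl_add_inr (x y : H) : (inlHH x + inrHH y).snd = y := by
  simp [inlHH, inrHH]

namespace Params

variable {P : Params} {ε : ℝ}

variable (P) in
/-- The truncation in frequency followed by the projection onto Fourier transforms of real
functions, applied to a function with the weight of `H^s`. -/
def truncReal (n : ℝ) : H →L[ℝ] H := (mulL (cutJap P.s n)).comp realProj

variable (P) in
/-- The multiplier that returns the damped vector field to the weight of `H^s`. -/
def undamp (n : ℝ) : H →L[ℝ] H := mulL (energySym P.s n fun ξ => jap ξ ^ P.s)

variable (P ε) in
/-- The linear part of the Galerkin system. -/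
def galerkinLin (n : ℝ) : HH →L[ℝ] HH :=
  inlHH.comp ((P.undamp n).comp ((mulL fun ξ => damp ξ * P.symΩ ε ξ).comp
      ((P.truncReal n).comp (WithLp.sndL 2 ℝ H H)))) -
  inrHH.comp ((P.undamp n).comp ((mulL fun ξ => damp ξ * P.symΩ ε ξ).comp
      ((P.truncReal n).comp (WithLp.fstL 2 ℝ H H))))

variable (P ε) in
/-- The quadratic part of the Galerkin system. -/
def galerkinQuad (n : ℝ) : HH →L[ℝ] HH →L[ℝ] HH :=
  (ContinuousLinearMap.compL ℝ HH H HH (inlHH.comp (ε • P.undamp n))).comp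
    ((conv fun ξ ζ => damp ξ * P.kerH ε ξ ζ).bilinearComp
      ((P.truncReal n).comp (WithLp.fstL 2 ℝ H H)) ((P.truncReal n).comp (WithLp.sndL 2 ℝ H H))) +
  (ContinuousLinearMap.compL ℝ HH H HH (inrHH.comp (ε • P.undamp n))).comp
    ((conv fun ξ ζ => damp ξ * kerW ξ ζ).bilinearComp
      ((P.truncReal n).comp (WithLp.sndL 2 ℝ H H)) ((P.truncReal n).comp (WithLp.sndL 2 ℝ H H)))

theorem galerkinLin_apply (n : ℝ) (U : HH) : galerkinLin P ε n U =
    inlHH (P.undamp n (mulL (fun ξ => damp ξ * P.symΩ ε ξ) (P.truncReal n U.snd))) +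
      inrHH (-P.undamp n (mulL (fun ξ => damp ξ * P.symΩ ε ξ) (P.truncReal n U.fst))) := by
  rw [map_neg, ← sub_eq_add_neg]
  rfl

theorem galerkin_apply (n : ℝ) (U : HH) : galerkinLin P ε n U + galerkinQuad P ε n U U =
    inlHH (P.undamp n (P.fieldH ε (P.truncReal n U.fst) (P.truncReal n U.snd))) +
      inrHH (P.undamp n (P.fieldW ε (P.truncReal n U.fst) (P.truncReal n U.snd))) := by
  have e : galerkinQuad P ε n U U =
      inlHH (ε • P.undamp n (conv (fun ξ ζ => damp ξ * P.kerH ε ξ ζ) (P.truncReal n U.fst)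
        (P.truncReal n U.snd))) + inrHH (ε • P.undamp n (conv (fun ξ ζ => damp ξ * kerW ξ ζ)
        (P.truncReal n U.snd) (P.truncReal n U.snd))) := rfl
  rw [galerkinLin_apply, e, fieldH, fieldW]
  simp only [map_add, map_neg, map_smul]
  abel

theorem inner_galerkinLin (hε : 0 < ε) (hε1 : ε ≤ 1) (n : ℝ) (U : HH) :
    inner ℝ (galerkinLin P ε n U) U = 0 := by
  have hs : 0 ≤ P.s := by linarith [P.two_lt_s]
  have hp := isEnergyWeight_jap P.s
  have h := inner_energySym_symΩ (P := P) hε hε1 hp n (realProj U.fst) (realProj U.snd)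
  have hq := isMultiplier_energySym hs n hp
  have hc := isMultiplier_cutJap P.s n
  have hΩ := isMultiplier_damp_symΩ (P := P) hε hε1
  have key : ∀ f g : H, inner ℝ (P.undamp n (mulL (fun ξ => damp ξ * P.symΩ ε ξ)
      (P.truncReal n g))) f = inner ℝ (mulL (energySym P.s n fun ξ => jap ξ ^ P.s)
      (mulL (fun ξ => damp ξ * P.symΩ ε ξ) (mulL (cutJap P.s n) (realProj g)))) (realProj f) := by
    intro f g
    rw [← inner_realProj, realProj_mulL hq, realProj_mulL hΩ, realProj_mulL hc,
      realProj_of_reflect (reflect_realProj g)]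
    · rfl
    · intro ξ; rw [cutJap, cutJap, cut_neg, jap_neg]
    · intro ξ; rw [damp_neg, symΩ_neg]
    · intro ξ; rw [energySym, energySym, cut_neg, jap_neg]
  rw [galerkinLin_apply, inner_inl_add_inr, inner_neg_left, key, key, h]
  ring

theorem reflect_undamp {n : ℝ} {f : H} (hf : reflect f = f) :
    reflect (P.undamp n f) = P.undamp n f := by
  have hq := isMultiplier_energySym (by linarith [P.two_lt_s] : 0 ≤ P.s) n (isEnergyWeight_jap P.s)
  rw [undamp, reflect_mulL hq (fun ξ => by rw [energySym, energySym, cut_neg, jap_neg]), hf]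

theorem reflect_truncReal (n : ℝ) (f : H) : reflect (P.truncReal n f) = P.truncReal n f := by
  have hc := isMultiplier_cutJap P.s n
  change reflect (mulL (cutJap P.s n) (realProj f)) = mulL (cutJap P.s n) (realProj f)
  rw [reflect_mulL hc (fun ξ => by rw [cutJap, cutJap, cut_neg, jap_neg]), reflect_realProj]

/-- `exists_solution_of_energy` asks for the inequality on the whole Hilbert space, whereas the
transport estimate holds only for Hermitian functions. This is why `truncReal` contains `realProj`.
The output of the field is Hermitian, so the projection can be moved onto the element with which it
is paired. -/
theorem inner_galerkin_le (hε : 0 < ε) (hε1 : ε ≤ 1) {n : ℝ} (hn : 0 ≤ n) (U : HH) :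
    inner ℝ (galerkinQuad P ε n U U) U ≤ P.energyConst * Real.sqrt ε * ‖U‖ ^ 3 := by
  have h0 : inner ℝ (galerkinQuad P ε n U U) U =
      inner ℝ (galerkinLin P ε n U + galerkinQuad P ε n U U) U := by
    rw [inner_add_left, inner_galerkinLin hε hε1, zero_add]
  have hr1 := reflect_truncReal (P := P) n U.fst
  have hr2 := reflect_truncReal (P := P) n U.snd
  have h := (le_abs_self _).trans (abs_inner_field_le (P := P) hε hε1 (isEnergyWeight_jap P.s) hn
    (realProj U.fst) (g := realProj U.snd) (reflect_realProj _))
  rw [h0, galerkin_apply, inner_inl_add_inr,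
    ← realProj_of_reflect (reflect_undamp (n := n) (reflect_fieldH (P := P) hε hε1 hr1 hr2)),
    ← realProj_of_reflect (reflect_undamp (n := n) (reflect_fieldW (P := P) hε hε1 hr1 hr2)),
    inner_realProj, inner_realProj]
  refine h.trans ?_
  have hU := WithLp.prod_norm_sq_eq_of_L2 U
  have hC := mul_nonneg (P.energyConst_nonneg) (Real.sqrt_nonneg ε)
  have h1 := norm_realProj_le U.fst
  have h2 := norm_realProj_le U.snd
  have h3 : ‖U.snd‖ ≤ ‖U‖ := by
    apply le_of_sq_le_sq _ (norm_nonneg _)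
    rw [hU]
    nlinarith [sq_nonneg ‖U.fst‖]
  calc _ ≤ P.energyConst * Real.sqrt ε * ((‖U.fst‖ ^ 2 + ‖U.snd‖ ^ 2) * ‖U‖) := by
        gcongr
        exact h2.trans h3
    _ = _ := by rw [← hU]; ring

/-- The Galerkin approximations exist on the long time interval, with a bound in `H^s`. -/
theorem exists_galerkin (hε : 0 < ε) (hε1 : ε ≤ 1) {n R S : ℝ} (hn : 0 ≤ n) (hR : 0 < R)
    (hS : 0 ≤ S) (hT : 4 * (P.energyConst * Real.sqrt ε) * R * S ≤ Real.log 4) {f₀ g₀ : H}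
    (hf₀ : reflect f₀ = f₀) (hg₀ : reflect g₀ = g₀) (hfg : ‖f₀‖ ^ 2 + ‖g₀‖ ^ 2 ≤ R ^ 2) :
    ∃ f g : ℝ → H, f 0 = mulL (cut n) f₀ ∧ g 0 = mulL (cut n) g₀ ∧
      ∀ t ∈ Set.Icc 0 S, reflect (f t) = f t ∧ reflect (g t) = g t ∧
        mulL (cut n) (f t) = f t ∧ mulL (cut n) (g t) = g t ∧
        ‖f t‖ ^ 2 + ‖g t‖ ^ 2 ≤ (2 * R) ^ 2 ∧
        HasDerivWithinAt f (P.undamp n (P.fieldH ε (mulL (cutJap P.s n) (f t))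
          (mulL (cutJap P.s n) (g t)))) (Set.Icc 0 S) t ∧
        HasDerivWithinAt g (P.undamp n (P.fieldW ε (mulL (cutJap P.s n) (f t))
          (mulL (cutJap P.s n) (g t)))) (Set.Icc 0 S) t := by
  have hs : 0 ≤ P.s := by linarith [P.two_lt_s]
  have hcut := isMultiplier_cut n
  have hq := isMultiplier_energySym hs n (isEnergyWeight_jap P.s)
  let U₀ : HH := inlHH (mulL (cut n) f₀) + inrHH (mulL (cut n) g₀)
  have hU₀ : ‖U₀‖ ≤ R := by
    apply le_of_sq_le_sq _ hR.le
    rw [WithLp.prod_norm_sq_eq_of_L2, fst_inl_add_inr, snd_inl_add_inr]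
    have h1 := norm_mulL_le hcut (abs_cut_le n) f₀
    have h2 := norm_mulL_le hcut (abs_cut_le n) g₀
    rw [one_mul] at h1 h2
    refine le_trans ?_ hfg
    gcongr
  obtain ⟨U, hU0, hUb, hU⟩ := exists_solution_of_energy (galerkinLin P ε n) (galerkinQuad P ε n)
    (mul_nonneg P.energyConst_nonneg (Real.sqrt_nonneg ε)) hR hS (inner_galerkinLin hε hε1 n)
    (inner_galerkin_le hε hε1 hn) hT U₀ hU₀
  simp only [galerkin_apply] at hU
  have hd1 : ∀ t ∈ Set.Icc 0 S, HasDerivWithinAt (fun t => (U t).fst)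
      (P.undamp n (P.fieldH ε (P.truncReal n (U t).fst) (P.truncReal n (U t).snd)))
      (Set.Icc 0 S) t := by
    intro t ht
    have := (WithLp.fstL 2 ℝ H H).hasFDerivAt.comp_hasDerivWithinAt t (hU t ht)
    refine this.congr_deriv ?_
    exact fst_inl_add_inr _ _
  have hd2 : ∀ t ∈ Set.Icc 0 S, HasDerivWithinAt (fun t => (U t).snd)
      (P.undamp n (P.fieldW ε (P.truncReal n (U t).fst) (P.truncReal n (U t).snd)))
      (Set.Icc 0 S) t := by
    intro t ht
    have := (WithLp.sndL 2 ℝ H H).hasFDerivAt.comp_hasDerivWithinAt t (hU t ht)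
    refine this.congr_deriv ?_
    exact snd_inl_add_inr _ _
  have hcu : ∀ x, mulL (cut n) (P.undamp n x) = P.undamp n x := by
    intro x
    rw [undamp, mulL_mulL hcut hq]
    apply mulL_congr
    intro ξ
    rw [energySym, ← mul_assoc, cut_sq]
  -- Hermitian symmetry and frequency support are kernels of bounded linear maps that annihilate the
  -- vector field, so they persist from the initial data. Along the solution the real projection is
  -- then the identity.
  have hr1 : ∀ t ∈ Set.Icc 0 S, reflect (U t).fst = (U t).fst := by
    intro t ht
    have h := clm_const_of_deriv (reflect - ContinuousLinearMap.id ℝ H) hd1 (fun t _ => by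
      rw [sub_apply, ContinuousLinearMap.id_apply, reflect_undamp (reflect_fieldH hε hε1
        (reflect_truncReal _ _) (reflect_truncReal _ _)), sub_self]) t ht
    rw [sub_apply, sub_apply, hU0, fst_inl_add_inr, reflect_mulL hcut (cut_neg n), hf₀, ] at h
    simpa [sub_eq_zero] using h
  have hr2 : ∀ t ∈ Set.Icc 0 S, reflect (U t).snd = (U t).snd := by
    intro t ht
    have h := clm_const_of_deriv (reflect - ContinuousLinearMap.id ℝ H) hd2 (fun t _ => by
      rw [sub_apply, ContinuousLinearMap.id_apply, reflect_undamp (reflect_fieldW hε hε1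
        (reflect_truncReal _ _) (reflect_truncReal _ _)), sub_self]) t ht
    rw [sub_apply, sub_apply, hU0, snd_inl_add_inr, reflect_mulL hcut (cut_neg n), hg₀, ] at h
    simpa [sub_eq_zero] using h
  have hcc : ∀ x, mulL (cut n) (mulL (cut n) x) = mulL (cut n) x := by
    intro x
    rw [mulL_mulL hcut hcut]
    exact mulL_congr (cut_sq n) x
  have hc1 : ∀ t ∈ Set.Icc 0 S, mulL (cut n) (U t).fst = (U t).fst := by
    intro t ht
    have h := clm_const_of_deriv (mulL (cut n) - ContinuousLinearMap.id ℝ H) hd1 (fun t _ => by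
      rw [sub_apply, ContinuousLinearMap.id_apply, hcu, sub_self]) t ht
    rw [sub_apply, sub_apply, hU0, fst_inl_add_inr, hcc] at h
    simpa [sub_eq_zero] using h
  have hc2 : ∀ t ∈ Set.Icc 0 S, mulL (cut n) (U t).snd = (U t).snd := by
    intro t ht
    have h := clm_const_of_deriv (mulL (cut n) - ContinuousLinearMap.id ℝ H) hd2 (fun t _ => by
      rw [sub_apply, ContinuousLinearMap.id_apply, hcu, sub_self]) t ht
    rw [sub_apply, sub_apply, hU0, snd_inl_add_inr, hcc] at h
    simpa [sub_eq_zero] using h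
  have htr : ∀ x : H, reflect x = x → P.truncReal n x = mulL (cutJap P.s n) x := by
    intro x hx
    change mulL (cutJap P.s n) (realProj x) = _
    rw [realProj_of_reflect hx]
  refine ⟨fun t => (U t).fst, fun t => (U t).snd, ?_, ?_, fun t ht => ⟨hr1 t ht, hr2 t ht, hc1 t ht,
    hc2 t ht, ?_, ?_, ?_⟩⟩
  · simp only [hU0]; exact fst_inl_add_inr _ _
  · simp only [hU0]; exact snd_inl_add_inr _ _
  · rw [← WithLp.prod_norm_sq_eq_of_L2]
    exact pow_le_pow_left₀ (norm_nonneg _) (hUb t ht) 2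
  · have := hd1 t ht
    rwa [htr _ (hr1 t ht), htr _ (hr2 t ht)] at this
  · have := hd2 t ht
    rwa [htr _ (hr1 t ht), htr _ (hr2 t ht)] at this

end Params

/-! ### L² estimates of the nonlinear terms for differences of solutions -/

/-- The multiplier `⟨ξ⟩⁴` cut off at frequency `n`, the inverse of `damp` below `n`. -/
def cutQuartic (n : ℝ) (ξ : Plane) : ℝ := cut n ξ * jap ξ ^ 4

theorem isMultiplier_cutQuartic (n : ℝ) : IsMultiplier (cutQuartic n) :=
  isMultiplier_cut_mul n (measurable_jap.pow_const 4) (C := Real.sqrt (1 + n ^ 2) ^ 4)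
    fun ξ h => by
      have h2 := jap_le_of_freq_le h
      have h3 := jap_pos ξ
      rw [abs_of_nonneg (by positivity)]
      gcongr

theorem cutQuartic_mul_damp (n : ℝ) (ξ : Plane) : damp ξ * cutQuartic n ξ = cut n ξ := by
  rw [cutQuartic]
  linear_combination cut n ξ * damp_mul_jap_pow ξ

theorem jap_rpow_le_wgt {s : ℝ} (ξ : Plane) : jap ξ ^ (-s) ≤ jap ξ ^ (1 - s) :=
  jap_rpow_mono (by linarith) ξ

theorem jap_mul_rpow (s : ℝ) (ξ : Plane) : jap ξ * jap ξ ^ (-s) = jap ξ ^ (1 - s) := by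
  rw [sub_eq_add_neg, jap_rpow_add, Real.rpow_one]

/-- The part of the transport kernel that is antisymmetrized in the `L²` estimate of differences. -/
def diffKer (s n : ℝ) (ξ ζ : Plane) : ℝ :=
  cut n ξ * cut n ζ * (jap (ξ - ζ) ^ (-s) * transport ξ ζ)

/-- The part of the transport kernel in which the derivative is on the regular factor. -/
def diffKer' (s n : ℝ) (ξ ζ : Plane) : ℝ :=
  cut n ξ * cut n ζ * (jap (ξ - ζ) ^ (-s) * transport ξ (ξ - ζ))

theorem measurable_jap_sub (s : ℝ) : Measurable fun z : Plane × Plane => jap (z.1 - z.2) ^ (-s) :=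
  (measurable_jap_rpow (-s)).comp (measurable_fst.sub measurable_snd)

theorem measurable_cut_cut (n : ℝ) : Measurable fun z : Plane × Plane => cut n z.1 * cut n z.2 :=
  ((measurable_cut n).comp measurable_fst).mul ((measurable_cut n).comp measurable_snd)

theorem measurable_transport_sub :
    Measurable fun z : Plane × Plane => transport z.1 (z.1 - z.2) := by
  have h : Measurable fun z : Plane × Plane => (z.1, z.1 - z.2) :=
    measurable_fst.prodMk (measurable_fst.sub measurable_snd)
  have h2 := measurable_transport.comp h
  unfold Function.comp at h2
  exact h2

theorem measurable_diffKer (s n : ℝ) : Measurable fun z : Plane × Plane => diffKer s n z.1 z.2 :=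
  (measurable_cut_cut n).mul ((measurable_jap_sub s).mul measurable_transport)

theorem measurable_diffKer' (s n : ℝ) : Measurable fun z : Plane × Plane => diffKer' s n z.1 z.2 :=
  (measurable_cut_cut n).mul ((measurable_jap_sub s).mul measurable_transport_sub)

theorem abs_cut_cut_mul_le {n : ℝ} (ξ ζ : Plane) (x : ℝ) : |cut n ξ * cut n ζ * x| ≤ |x| := by
  rw [abs_mul, abs_mul]
  calc _ ≤ 1 * |x| := mul_le_mul_of_nonneg_right
        (mul_le_one₀ (abs_cut_le n ξ) (abs_nonneg _) (abs_cut_le n ζ)) (abs_nonneg _)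
    _ = _ := one_mul _

namespace Params

variable {P : Params} {ε : ℝ}

theorem dominated_of_le_wgt_sub {κ : Plane → Plane → ℝ}
    (hκ : Measurable fun z : Plane × Plane => κ z.1 z.2) {C : ℝ} (hC : 0 ≤ C)
    (h : ∀ ξ ζ, |κ ξ ζ| ≤ C * P.wgt (ξ - ζ)) : Dominated κ C P.wgt :=
  ⟨hκ, fun ξ ζ => (h ξ ζ).trans (mul_le_mul_of_nonneg_left
    (by linarith [wgt_pos (P := P) ξ, wgt_pos (P := P) ζ]) hC)⟩

/-- As for `dominated_energyKer`, the constant `n` serves only to justify the symmetrization. -/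
theorem dominated_diffKer {n : ℝ} (hn : 0 ≤ n) : Dominated (diffKer P.s n) n P.wgt := by
  refine dominated_of_le_wgt_sub (measurable_diffKer _ n) hn fun ξ ζ => ?_
  by_cases h : freq ζ ≤ n
  · refine (abs_cut_cut_mul_le ξ ζ _).trans ?_
    rw [abs_mul, abs_of_pos (jap_rpow_pos _ _), mul_comm]
    exact mul_le_mul ((abs_transport_le ξ ζ).trans h) (jap_rpow_le_wgt _) (jap_rpow_pos _ _).le hn
  · have : diffKer P.s n ξ ζ = 0 := by simp [diffKer, cut, h]
    rw [this, abs_zero]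
    exact mul_nonneg hn (wgt_pos _).le

/-- In L² both energy weights are 1, so the weight difference drops out of `abs_transport_symm_le`.
What remains is one derivative at frequency ξ-ζ, which the regular factor can afford. -/
theorem dominated_diffKer_symm (n : ℝ) :
    Dominated (fun ξ ζ => diffKer P.s n ξ ζ + diffKer P.s n ζ ξ) 1 P.wgt := by
  have m1 := measurable_diffKer P.s n
  have m2 : Measurable fun z : Plane × Plane => diffKer P.s n z.2 z.1 := measurable_transpose m1
  have m : Measurable fun z : Plane × Plane => diffKer P.s n z.1 z.2 + diffKer P.s n z.2 z.1 :=
    m1.add m2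
  refine dominated_of_le_wgt_sub m zero_le_one fun ξ ζ => ?_
  have e : diffKer P.s n ξ ζ + diffKer P.s n ζ ξ = cut n ξ * cut n ζ * (jap (ξ - ζ) ^ (-P.s) *
      (1 ^ 2 * transport ξ ζ + 1 ^ 2 * transport ζ ξ)) := by
    rw [diffKer, diffKer, jap_sub_comm ζ ξ]
    ring
  have h := abs_transport_symm_le ξ ζ zero_le_one zero_le_one
  change |diffKer P.s n ξ ζ + diffKer P.s n ζ ξ| ≤ 1 * jap (ξ - ζ) ^ (1 - P.s)
  rw [e]
  refine (abs_cut_cut_mul_le ξ ζ _).trans ?_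
  rw [abs_mul, abs_of_pos (jap_rpow_pos _ _), one_mul, ← jap_mul_rpow, mul_comm]
  refine mul_le_mul_of_nonneg_right (h.trans ?_) (jap_rpow_pos _ _).le
  rw [sub_self, abs_zero, zero_mul, add_zero, one_mul, one_mul]
  exact freq_le_jap _

theorem dominated_diffKer' (n : ℝ) : Dominated (diffKer' P.s n) 1 P.wgt := by
  refine dominated_of_le_wgt_sub (measurable_diffKer' _ n) zero_le_one fun ξ ζ => ?_
  refine (abs_cut_cut_mul_le ξ ζ _).trans ?_
  change _ ≤ 1 * jap (ξ - ζ) ^ (1 - P.s)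
  rw [abs_mul, abs_of_pos (jap_rpow_pos _ _), one_mul, ← jap_mul_rpow, mul_comm]
  exact mul_le_mul_of_nonneg_right ((abs_transport_le ξ _).trans (freq_le_jap _))
    (jap_rpow_pos _ _).le

/-- `L²` estimate of the transport term, for functions with bounded frequencies. -/
theorem abs_diff_kerW_le {n : ℝ} (hn : 0 ≤ n) {σ : H} (hσ : reflect σ = σ) (G : H) :
    |inner ℝ (mulL (cutQuartic n) (conv (fun ξ ζ => damp ξ * kerW ξ ζ)
      (mulL (fun ξ => jap ξ ^ (-P.s)) σ) (mulL (cut n) G))) (mulL (cut n) G)| ≤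
      3 * wnorm P.wgt * ‖σ‖ * ‖mulL (cut n) G‖ ^ 2 := by
  have hj : IsMultiplier fun ξ => jap ξ ^ (-P.s) := isMultiplier_jap (by linarith [P.two_lt_s])
  have hc := isMultiplier_cut n
  have hcc : mulL (cut n) G = mulL (cut n) (mulL (cut n) G) := by
    rw [mulL_mulL hc hc]; exact (mulL_congr (cut_sq n) G).symm
  have hk := dominated_diffKer (P := P) hn
  rw [inner_mulL (isMultiplier_cutQuartic n), inner_conv isConvKernel_damp_kerW]
  -- The cutoff is idempotent. One copy goes into the kernel, where it bounds the frequency ζ; the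
  -- other leaves the same function in the last two slots, as `tri_antisymm` requires.
  nth_rewrite 1 [hcc]
  rw [tri_mulL hj hc (isMultiplier_cutQuartic n)]
  set F := mulL (cut n) G
  rw [tri_congr (s' := fun ξ ζ => (1 / 2) * (diffKer P.s n ξ ζ + diffKer' P.s n ξ ζ)),
    tri_const_mul, tri_add hn hk isWeight_wgt zero_le_one (dominated_diffKer' n) isWeight_wgt,
    tri_antisymm hn hk isWeight_wgt hσ]
  · have h1 := abs_tri_le zero_le_one (dominated_diffKer_symm (P := P) n) isWeight_wgt σ F F
    have h2 := abs_tri_le zero_le_one (dominated_diffKer' (P := P) n) isWeight_wgt σ F F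
    rw [abs_le] at h1 h2 ⊢
    have w0 := wnorm_nonneg P.wgt
    have : 0 ≤ wnorm P.wgt * ‖σ‖ * ‖F‖ ^ 2 := by positivity
    constructor <;> linarith
  · intro ξ ζ
    have h := half_freq_mul_cosine ξ ζ
    have h2 := cutQuartic_mul_damp n ξ
    simp only [diffKer, diffKer', kerW]
    rw [h]
    linear_combination (1 / 2 * (transport ξ ζ + transport ξ (ξ - ζ)) * jap (ξ - ζ) ^ (-P.s) *
      cut n ζ) * h2

/-- `L²` estimate of the transport term, for functions with high frequencies. -/
theorem abs_diff_kerW_high_le {n : ℝ} (hn : 1 ≤ n) (σ g e : H) :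
    |inner ℝ (mulL (cutQuartic n) (conv (fun ξ ζ => damp ξ * kerW ξ ζ)
      (mulL (fun ξ => jap ξ ^ (-P.s)) σ)
        (mulL (fun ξ => 1 - cut n ξ) (mulL (fun ξ => jap ξ ^ (-P.s)) g)))) e| ≤
      3 * (2 * n ^ (1 - P.s)) * wnorm P.wgt * ‖σ‖ * ‖g‖ * ‖e‖ := by
  have hj : IsMultiplier fun ξ => jap ξ ^ (-P.s) := isMultiplier_jap (by linarith [P.two_lt_s])
  have hc := isMultiplier_one_sub_cut n
  have hδ : 0 < n ^ (1 - P.s) := Real.rpow_pos_of_pos (by linarith) _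
  rw [mulL_mulL hc hj, inner_mulL (isMultiplier_cutQuartic n), inner_conv isConvKernel_damp_kerW,
    tri_mulL hj (hc.mul hj) (isMultiplier_cutQuartic n)]
  refine abs_tri_le (by positivity) (dominated_of_le_wgt_sub ?_ (by positivity) fun ξ ζ => ?_)
    isWeight_wgt σ g e
  · exact ((measurable_damp.comp measurable_fst).mul measurable_kerW).mul (((measurable_jap_sub P.s).mul
      ((hc.mul hj).1.comp measurable_snd)).mul ((isMultiplier_cutQuartic n).1.comp measurable_fst))
  · have h1 := one_sub_cut_mul_jap_le hn (r := 1 - P.s) (by linarith [P.two_lt_s]) ζ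
    have hcut : 0 ≤ 1 - cut n ζ := by linarith [cut_le_one n ζ]
    have hcut2 := cut_nonneg n ξ
    have hx := jap_rpow_pos (-P.s) (ξ - ζ)
    have hy := jap_rpow_pos (-P.s) ζ
    have e1 : damp ξ * kerW ξ ζ * (jap (ξ - ζ) ^ (-P.s) * ((1 - cut n ζ) * jap ζ ^ (-P.s)) *
        cutQuartic n ξ) = cut n ξ * (kerW ξ ζ * (jap (ξ - ζ) ^ (-P.s) *
          ((1 - cut n ζ) * jap ζ ^ (-P.s)))) := by
      linear_combination (kerW ξ ζ * (jap (ξ - ζ) ^ (-P.s) *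
          ((1 - cut n ζ) * jap ζ ^ (-P.s)))) * cutQuartic_mul_damp n ξ
    rw [e1, abs_mul, abs_mul, abs_of_nonneg hcut2, abs_of_nonneg (by positivity :
      0 ≤ jap (ξ - ζ) ^ (-P.s) * ((1 - cut n ζ) * jap ζ ^ (-P.s)))]
    have j1 := one_le_jap (ξ - ζ)
    have j2 := one_le_jap ζ
    -- The derivative is charged to both factors, which are both regular. One power of ⟨ζ⟩ is spent
    -- and the high-frequency tail still yields `n ^ (1 - s)`.
    have h3 : |kerW ξ ζ| ≤ 2 * (jap (ξ - ζ) * jap ζ) := by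
      have := abs_kerW_le ξ ζ
      have := jap_le_add ξ ζ
      nlinarith
    calc _ ≤ 1 * (2 * (jap (ξ - ζ) * jap ζ) * (jap (ξ - ζ) ^ (-P.s) *
          ((1 - cut n ζ) * jap ζ ^ (-P.s)))) := by
          gcongr
          exact cut_le_one n ξ
      _ = 2 * (jap (ξ - ζ) * jap (ξ - ζ) ^ (-P.s)) *
          ((1 - cut n ζ) * (jap ζ * jap ζ ^ (-P.s))) := by ring
      _ ≤ 2 * P.wgt (ξ - ζ) * n ^ (1 - P.s) := by
          rw [jap_mul_rpow, jap_mul_rpow]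
          have := wgt_pos (P := P) (ξ - ζ)
          exact mul_le_mul_of_nonneg_left h1 (by positivity)
      _ = _ := by ring

/-- `L²` estimate of the first nonlinear term, with the second factor regular. -/
theorem abs_diff_kerH_right_le (hε : 0 < ε) (n : ℝ) (x g e : H) :
    |ε * inner ℝ (mulL (cutQuartic n) (conv (fun ξ ζ => damp ξ * P.kerH ε ξ ζ) x
      (mulL (fun ξ => jap ξ ^ (-P.s)) g))) e| ≤
      3 * (P.Ch * Real.sqrt ε) * wnorm P.wgt * ‖x‖ * ‖g‖ * ‖e‖ := by
  have hj : IsMultiplier fun ξ => jap ξ ^ (-P.s) := isMultiplier_jap (by linarith [P.two_lt_s])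
  have h1 : IsMultiplier fun _ => (1 : ℝ) := ⟨measurable_const, 1, fun _ => by simp⟩
  have hCh := P.Ch_pos
  rw [inner_mulL (isMultiplier_cutQuartic n), inner_conv (isConvKernel_damp_kerH hε)]
  nth_rewrite 1 [← mulL_one x]
  rw [tri_mulL h1 hj (isMultiplier_cutQuartic n), ← tri_const_mul]
  rw [tri_congr (s' := fun ξ ζ => cut n ξ * ((ε * P.kerH ε ξ ζ) * jap ζ ^ (-P.s)))]
  · refine abs_tri_le (by positivity) ⟨?_, fun ξ ζ => ?_⟩ isWeight_wgt x g e
    · exact ((measurable_cut n).comp measurable_fst).mul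
        ((measurable_const.mul measurable_kerH).mul (hj.1.comp measurable_snd))
    · have hy := jap_rpow_pos (-P.s) ζ
      have h2 := jap_rpow_le_wgt (s := P.s) ζ
      have hc0 := cut_nonneg n ξ
      rw [abs_mul, abs_mul, abs_mul, abs_of_pos hε, abs_of_pos hy, abs_of_nonneg hc0]
      calc _ ≤ 1 * (P.Ch * Real.sqrt ε * P.wgt ζ) := by
            refine mul_le_mul (cut_le_one n ξ) ?_ (by positivity) zero_le_one
            exact mul_le_mul (eps_mul_abs_kerH_le hε ξ ζ) h2 hy.le (by positivity)
        _ ≤ _ := by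
            rw [one_mul]
            refine mul_le_mul_of_nonneg_left ?_ (by positivity)
            linarith [wgt_pos (P := P) ξ, wgt_pos (P := P) (ξ - ζ)]
  · intro ξ ζ
    linear_combination (ε * P.kerH ε ξ ζ * jap ζ ^ (-P.s)) * cutQuartic_mul_damp n ξ

/-- `L²` estimate of the first nonlinear term, with the first factor regular. -/
theorem abs_diff_kerH_left_le (hε : 0 < ε) (n : ℝ) (f x e : H) :
    |ε * inner ℝ (mulL (cutQuartic n) (conv (fun ξ ζ => damp ξ * P.kerH ε ξ ζ)
      (mulL (fun ξ => jap ξ ^ (-P.s)) f) x)) e| ≤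
      3 * (P.Ch * Real.sqrt ε) * wnorm P.wgt * ‖f‖ * ‖x‖ * ‖e‖ := by
  have hj : IsMultiplier fun ξ => jap ξ ^ (-P.s) := isMultiplier_jap (by linarith [P.two_lt_s])
  have h1 : IsMultiplier fun _ => (1 : ℝ) := ⟨measurable_const, 1, fun _ => by simp⟩
  have hCh := P.Ch_pos
  rw [inner_mulL (isMultiplier_cutQuartic n), inner_conv (isConvKernel_damp_kerH hε)]
  nth_rewrite 1 [← mulL_one x]
  rw [tri_mulL hj h1 (isMultiplier_cutQuartic n), ← tri_const_mul]
  rw [tri_congr (s' := fun ξ ζ => cut n ξ * ((ε * P.kerH ε ξ ζ) * jap (ξ - ζ) ^ (-P.s)))]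
  · refine abs_tri_le (by positivity) (dominated_of_le_wgt_sub ?_ (by positivity) fun ξ ζ => ?_)
      isWeight_wgt f x e
    · exact ((measurable_cut n).comp measurable_fst).mul
        ((measurable_const.mul measurable_kerH).mul (measurable_jap_sub P.s))
    · have hy := jap_rpow_pos (-P.s) (ξ - ζ)
      have h2 := jap_rpow_le_wgt (s := P.s) (ξ - ζ)
      have hc0 := cut_nonneg n ξ
      rw [abs_mul, abs_mul, abs_mul, abs_of_pos hε, abs_of_pos hy, abs_of_nonneg hc0]
      calc _ ≤ 1 * (P.Ch * Real.sqrt ε * P.wgt (ξ - ζ)) := by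
            refine mul_le_mul (cut_le_one n ξ) ?_ (by positivity) zero_le_one
            exact mul_le_mul (eps_mul_abs_kerH_le hε ξ ζ) h2 hy.le (by positivity)
        _ = _ := one_mul _
  · intro ξ ζ
    linear_combination (ε * P.kerH ε ξ ζ * jap (ξ - ζ) ^ (-P.s)) * cutQuartic_mul_damp n ξ

end Params

/-! ### L² stability below a frequency -/

namespace Params

/-- Division by the weight `⟨ξ⟩^s` of `H^s`. -/
abbrev smooth (P : Params) : H →L[ℝ] H := mulL fun ξ => jap ξ ^ (-P.s)

variable {P : Params} {ε : ℝ}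

theorem isMultiplier_smooth : IsMultiplier fun ξ => jap ξ ^ (-P.s) :=
  isMultiplier_jap (by linarith [P.two_lt_s])

theorem norm_smooth_le (f : H) : ‖P.smooth f‖ ≤ ‖f‖ := by
  have h := norm_mulL_le (isMultiplier_smooth (P := P)) (C := 1) (fun ξ => by
    rw [abs_of_pos (jap_rpow_pos _ _)]
    exact jap_rpow_le_one (by linarith [P.two_lt_s]) ξ) f
  rwa [one_mul] at h

theorem reflect_smooth (f : H) : reflect (P.smooth f) = P.smooth (reflect f) :=
  reflect_mulL isMultiplier_smooth (fun ξ => by rw [jap_neg]) f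

/-- Below frequency `n`, `(h, w)` solves the system in Fourier variables, and it is bounded by `R`
in `H^s`. -/
structure CutSolution (P : Params) (ε S R n : ℝ) (h w : ℝ → H) : Prop where
  rep : ∀ t ∈ Set.Icc 0 S, ∃ f g : H, reflect f = f ∧ reflect g = g ∧
    h t = P.smooth f ∧ w t = P.smooth g ∧ ‖f‖ ≤ R ∧ ‖g‖ ≤ R
  deriv_h : ∀ t ∈ Set.Icc 0 S, HasDerivWithinAt (fun τ => mulL (cut n) (h τ))
    (mulL (cutQuartic n) (P.fieldH ε (h t) (w t))) (Set.Icc 0 S) t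
  deriv_w : ∀ t ∈ Set.Icc 0 S, HasDerivWithinAt (fun τ => mulL (cut n) (w τ))
    (mulL (cutQuartic n) (P.fieldW ε (h t) (w t))) (Set.Icc 0 S) t

theorem fieldH_sub (h w h' w' : H) : P.fieldH ε h w - P.fieldH ε h' w' =
    mulL (fun ξ => damp ξ * P.symΩ ε ξ) (w - w') +
      ε • (conv (fun ξ ζ => damp ξ * P.kerH ε ξ ζ) (h - h') w +
        conv (fun ξ ζ => damp ξ * P.kerH ε ξ ζ) h' (w - w')) := by
  simp only [fieldH, map_sub, sub_apply]
  module

/-- The kernel `kerW` is symmetric in its two factors, so B(w,w) - B(w',w') = B(w+w', w-w'): the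
difference is transported by the regular, Hermitian sum. -/
theorem fieldW_sub (h w h' w' : H) : P.fieldW ε h w - P.fieldW ε h' w' =
    -mulL (fun ξ => damp ξ * P.symΩ ε ξ) (h - h') +
      ε • conv (fun ξ ζ => damp ξ * kerW ξ ζ) (w + w') (w - w') := by
  have h1 := conv_swap isConvKernel_damp_kerW isConvKernel_damp_kerW
    (fun ξ ζ => by rw [kerW_swap]) w' w
  simp only [fieldW, map_sub, map_add, add_apply, h1]
  module

variable (P) in
/-- The constant in the estimate of the difference of two solutions. -/
def diffConst (R : ℝ) : ℝ := 96 * wnorm P.wgt * (P.Ch + 1) * (R + R ^ 3)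

theorem diffConst_nonneg {R : ℝ} (hR : 0 ≤ R) : 0 ≤ P.diffConst R := by
  have := P.Ch_pos
  have := wnorm_nonneg P.wgt
  unfold diffConst
  positivity

theorem norm_one_sub_cut_smooth_le {n : ℝ} (hn : 1 ≤ n) (f : H) :
    ‖mulL (fun ξ => 1 - cut n ξ) (P.smooth f)‖ ≤ n ^ (-P.s) * ‖f‖ := by
  rw [mulL_mulL (isMultiplier_one_sub_cut n) isMultiplier_smooth]
  refine norm_mulL_le ((isMultiplier_one_sub_cut n).mul isMultiplier_smooth) (fun ξ => ?_) f
  have h0 : 0 ≤ 1 - cut n ξ := by linarith [cut_le_one n ξ]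
  have h1 := jap_rpow_pos (-P.s) ξ
  rw [abs_of_nonneg (by positivity)]
  exact one_sub_cut_mul_jap_le hn (by linarith [P.two_lt_s]) ξ

theorem cut_add_one_sub_cut (n : ℝ) (x : H) :
    mulL (cut n) x + mulL (fun ξ => 1 - cut n ξ) x = x := by
  have h1 : IsMultiplier fun _ : Plane => (1 : ℝ) := ⟨measurable_const, 1, fun _ => by simp⟩
  have h := mulL_sub h1 (isMultiplier_cut n) (isMultiplier_one_sub_cut n) x
  rw [h, mulL_one]
  abel

theorem norm_le_cut_add {n : ℝ} (hn : 1 ≤ n) (f : H) :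
    ‖P.smooth f‖ ≤ ‖mulL (cut n) (P.smooth f)‖ + n ^ (1 - P.s) * ‖f‖ := by
  have h := norm_one_sub_cut_smooth_le (P := P) hn f
  have h1 := norm_add_le (mulL (cut n) (P.smooth f)) (mulL (fun ξ => 1 - cut n ξ) (P.smooth f))
  rw [cut_add_one_sub_cut] at h1
  have h2 : n ^ (-P.s) ≤ n ^ (1 - P.s) := Real.rpow_le_rpow_of_exponent_le hn (by linarith)
  have h3 := mul_le_mul_of_nonneg_right h2 (norm_nonneg f)
  linarith

theorem norm_cut_le (n : ℝ) (x : H) : ‖mulL (cut n) x‖ ≤ ‖x‖ := by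
  simpa using norm_mulL_le (isMultiplier_cut n) (abs_cut_le n) x

/-- Bookkeeping for `inner_field_sub_le`: `x` and `y` are the norms of the low frequencies of the
two differences, and `2 * R * δ` bounds their high-frequency tails. The constant 96 is generous. -/
theorem diff_scalar_le {x y δ R W C : ℝ} (hδ : 0 ≤ δ) (hR : 0 ≤ R)
    (hW : 0 ≤ W) (hC : 0 ≤ C) (hxR : x ≤ 2 * R) :
    2 * (3 * (C * 1) * W * (x + 2 * R * δ) * R * x + 3 * (C * 1) * W * R * (y + 2 * R * δ) * x +
      1 * (3 * W * (2 * R) * y ^ 2 + 3 * (2 * δ) * W * (2 * R) * (2 * R) * (2 * R))) ≤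
      96 * W * (C + 1) * (R + R ^ 3) * (x ^ 2 + y ^ 2) + 96 * W * (C + 1) * (R + R ^ 3) * δ := by
  have m1 : x * y ≤ x ^ 2 + y ^ 2 := by nlinarith [sq_nonneg (x - y)]
  have m2 : R * R * (δ * x) ≤ R * R * (δ * (2 * R)) := by gcongr
  have m3 : 0 ≤ R ^ 3 * (x ^ 2 + y ^ 2) := by positivity
  have m4 : 0 ≤ R * δ := by positivity
  have m5 : 0 ≤ R ^ 3 * δ := by positivity
  have m6 : R * (x * y) ≤ R * (x ^ 2 + y ^ 2) := by gcongr
  have m7 : 0 ≤ R * x ^ 2 := by positivity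
  have m8 : 0 ≤ R * y ^ 2 := by positivity
  have n1 : 6 * (x + 2 * R * δ) * R * x + 6 * R * (y + 2 * R * δ) * x ≤
      96 * (R + R ^ 3) * (x ^ 2 + y ^ 2 + δ) := by linarith
  have n2 : 6 * (2 * R) * y ^ 2 + 6 * (2 * δ) * (2 * R) * (2 * R) * (2 * R) ≤
      96 * (R + R ^ 3) * (x ^ 2 + y ^ 2 + δ) := by linarith
  have o1 := mul_le_mul_of_nonneg_left n1 (mul_nonneg hC hW)
  have o2 := mul_le_mul_of_nonneg_left n2 hW
  linarith

/-- The time derivative of the square of the low frequencies of a difference. -/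
theorem inner_field_sub_le (hε : 0 < ε) (hε1 : ε ≤ 1) {n R : ℝ} (hn : 1 ≤ n)
    {f g f' g' : H} (hg : reflect g = g) (hg' : reflect g' = g') (bf : ‖f‖ ≤ R) (bg : ‖g‖ ≤ R)
    (bf' : ‖f'‖ ≤ R) (bg' : ‖g'‖ ≤ R) :
    2 * (inner ℝ (mulL (cutQuartic n) (P.fieldH ε (P.smooth f) (P.smooth g) -
        P.fieldH ε (P.smooth f') (P.smooth g'))) (mulL (cut n) (P.smooth (f - f'))) +
      inner ℝ (mulL (cutQuartic n) (P.fieldW ε (P.smooth f) (P.smooth g) -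
        P.fieldW ε (P.smooth f') (P.smooth g'))) (mulL (cut n) (P.smooth (g - g')))) ≤
      P.diffConst R * (‖mulL (cut n) (P.smooth (f - f'))‖ ^ 2 +
        ‖mulL (cut n) (P.smooth (g - g'))‖ ^ 2) + P.diffConst R * n ^ (1 - P.s) := by
  have hn0 : 0 ≤ n := by linarith
  have hc := isMultiplier_cut n
  have hq := isMultiplier_cutQuartic n
  have hΩ := isMultiplier_damp_symΩ (P := P) hε hε1
  rw [fieldH_sub, fieldW_sub, ← map_sub, ← map_sub, ← map_add]
  set D := f - f'
  set G := g - g'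
  have bD : ‖D‖ ≤ 2 * R := (norm_sub_le _ _).trans (by linarith)
  have bG : ‖G‖ ≤ 2 * R := (norm_sub_le _ _).trans (by linarith)
  have bS : ‖g + g'‖ ≤ 2 * R := (norm_add_le _ _).trans (by linarith)
  have hskew : inner ℝ (mulL (cutQuartic n) (mulL (fun ξ => damp ξ * P.symΩ ε ξ) (P.smooth G)))
      (mulL (cut n) (P.smooth D)) = inner ℝ (mulL (cutQuartic n) (mulL
        (fun ξ => damp ξ * P.symΩ ε ξ) (P.smooth D))) (mulL (cut n) (P.smooth G)) := by
    rw [mulL_mulL hq hΩ, mulL_mulL hq hΩ, ← inner_mulL hc, mulL_mulL hc (hq.mul hΩ),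
      inner_mulL (hc.mul (hq.mul hΩ)), real_inner_comm, ← mulL_mulL hc (hq.mul hΩ), inner_mulL hc]
  have h1 := abs_diff_kerH_right_le (P := P) hε n (P.smooth D) g (mulL (cut n) (P.smooth D))
  have h2 := abs_diff_kerH_left_le (P := P) hε n f' (P.smooth G) (mulL (cut n) (P.smooth D))
  have h3 := abs_diff_kerW_le (P := P) hn0 (σ := g + g') (by rw [map_add, hg, hg']) (P.smooth G)
  have h4 := abs_diff_kerW_high_le (P := P) hn (g + g') G (mulL (cut n) (P.smooth G))
  simp only [map_add, map_neg, map_smul, inner_add_left, inner_neg_left, inner_smul_left,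
    conj_trivial] at hskew h1 h2 h3 h4 ⊢
  rw [hskew]
  -- The difference of the velocities is split at frequency `n`. The low part is estimated by
  -- symmetrization, and the high part is small because the difference is bounded in H^s.
  have e5 : conv (fun ξ ζ => damp ξ * kerW ξ ζ) (P.smooth g) (P.smooth G) +
      conv (fun ξ ζ => damp ξ * kerW ξ ζ) (P.smooth g') (P.smooth G) =
      (conv (fun ξ ζ => damp ξ * kerW ξ ζ) (P.smooth g) (mulL (cut n) (P.smooth G)) +
      conv (fun ξ ζ => damp ξ * kerW ξ ζ) (P.smooth g') (mulL (cut n) (P.smooth G))) +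
      (conv (fun ξ ζ => damp ξ * kerW ξ ζ) (P.smooth g) (mulL (fun ξ => 1 - cut n ξ) (P.smooth G)) +
      conv (fun ξ ζ => damp ξ * kerW ξ ζ) (P.smooth g')
        (mulL (fun ξ => 1 - cut n ξ) (P.smooth G))) := by
    nth_rewrite 1 2 [← cut_add_one_sub_cut n (P.smooth G)]
    simp only [map_add]
    abel
  have e6 := congrArg (fun z => inner ℝ (mulL (cutQuartic n) z) (mulL (cut n) (P.smooth G))) e5
  simp only [map_add, inner_add_left, add_apply] at e6 h3 h4 ⊢
  have nD := norm_le_cut_add (P := P) hn D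
  have nG := norm_le_cut_add (P := P) hn G
  have x0 := norm_cut_le n (P.smooth D)
  have y0 := norm_cut_le n (P.smooth G)
  have x1 := x0.trans (norm_smooth_le D)
  have y1 := y0.trans (norm_smooth_le G)
  set x := ‖mulL (cut n) (P.smooth D)‖
  set y := ‖mulL (cut n) (P.smooth G)‖
  have hx : 0 ≤ x := norm_nonneg _
  have hy : 0 ≤ y := norm_nonneg _
  have hR : 0 ≤ R := (norm_nonneg _).trans bf
  have hδ : 0 < n ^ (1 - P.s) := Real.rpow_pos_of_pos (by linarith) _
  set δ := n ^ (1 - P.s)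
  have hw := wnorm_nonneg P.wgt
  set W := wnorm P.wgt
  have hCh := P.Ch_pos
  have hs1 : Real.sqrt ε ≤ 1 := Real.sqrt_le_one.2 hε1
  have hs0 := Real.sqrt_nonneg ε
  have mD := mul_le_mul_of_nonneg_left bD hδ.le
  have mG := mul_le_mul_of_nonneg_left bG hδ.le
  have nD' : ‖P.smooth D‖ ≤ x + 2 * R * δ := by linarith
  have nG' : ‖P.smooth G‖ ≤ y + 2 * R * δ := by linarith
  have k1 : 3 * (P.Ch * Real.sqrt ε) * W * ‖P.smooth D‖ * ‖g‖ * x ≤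
      3 * (P.Ch * 1) * W * (x + 2 * R * δ) * R * x := by gcongr
  have k2 : 3 * (P.Ch * Real.sqrt ε) * W * ‖f'‖ * ‖P.smooth G‖ * x ≤
      3 * (P.Ch * 1) * W * R * (y + 2 * R * δ) * x := by gcongr
  have k3 : 3 * W * ‖g + g'‖ * y ^ 2 ≤ 3 * W * (2 * R) * y ^ 2 := by gcongr
  have k4 : 3 * (2 * δ) * W * ‖g + g'‖ * ‖G‖ * y ≤
      3 * (2 * δ) * W * (2 * R) * (2 * R) * (2 * R) := by
    gcongr
    exact y1.trans bG
  have l1 := (le_abs_self _).trans (h1.trans k1)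
  have l2 := (le_abs_self _).trans (h2.trans k2)
  have l3 := (le_abs_self _).trans (h3.trans k3)
  have l4 := (le_abs_self _).trans (h4.trans k4)
  have l5 := mul_le_mul_of_nonneg_left (add_le_add l3 l4) hε.le
  rw [← e6] at l5
  have l6 : ε * (3 * W * (2 * R) * y ^ 2 + 3 * (2 * δ) * W * (2 * R) * (2 * R) * (2 * R)) ≤
      1 * (3 * W * (2 * R) * y ^ 2 + 3 * (2 * δ) * W * (2 * R) * (2 * R) * (2 * R)) := by
    gcongr
  have hfin := diff_scalar_le (y := y) hδ.le hR hw hCh.le (x1.trans bD)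
  unfold diffConst
  linarith

/-- Stability in `L²` of solutions that are bounded in `H^s`. -/
theorem norm_cut_sub_sq_le (hε : 0 < ε) (hε1 : ε ≤ 1) {n R S : ℝ} (hn : 1 ≤ n) (hR : 0 ≤ R)
    {h w h' w' : ℝ → H} (H1 : CutSolution P ε S R n h w) (H2 : CutSolution P ε S R n h' w') :
    ∀ t ∈ Set.Icc 0 S, ‖mulL (cut n) (h t - h' t)‖ ^ 2 + ‖mulL (cut n) (w t - w' t)‖ ^ 2 ≤
      Real.exp (P.diffConst R * t) * (‖mulL (cut n) (h 0 - h' 0)‖ ^ 2 +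
        ‖mulL (cut n) (w 0 - w' 0)‖ ^ 2 + P.diffConst R * n ^ (1 - P.s) * t) := by
  have hK := diffConst_nonneg (P := P) hR
  have hδ : 0 < n ^ (1 - P.s) := Real.rpow_pos_of_pos (by linarith) _
  refine gronwall_Icc (f' := fun t => 2 * (inner ℝ (mulL (cutQuartic n) (P.fieldH ε (h t) (w t) -
        P.fieldH ε (h' t) (w' t))) (mulL (cut n) (h t - h' t)) +
      inner ℝ (mulL (cutQuartic n) (P.fieldW ε (h t) (w t) -
        P.fieldW ε (h' t) (w' t))) (mulL (cut n) (w t - w' t)))) hK (by positivity) ?_ ?_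
  · intro t ht
    have d1 := ((H1.deriv_h t ht).sub (H2.deriv_h t ht)).norm_sq
    have d2 := ((H1.deriv_w t ht).sub (H2.deriv_w t ht)).norm_sq
    simp only [map_sub]
    refine (d1.add d2).congr_deriv ?_
    rw [real_inner_comm, real_inner_comm (mulL (cutQuartic n) (P.fieldW ε (h t) (w t)) -
      mulL (cutQuartic n) (P.fieldW ε (h' t) (w' t)))]
    simp only [Pi.sub_apply]
    ring
  · intro t ht
    obtain ⟨f, g, rf, rg, ef, eg, bf, bg⟩ := H1.rep t ht
    obtain ⟨f', g', rf', rg', ef', eg', bf', bg'⟩ := H2.rep t ht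
    have := inner_field_sub_le (P := P) hε hε1 hn rg rg' bf bg bf' bg'
    simp only [map_sub] at this ⊢
    rw [ef, eg, ef', eg']
    exact this

/-- Stability in `L²` of solutions that are bounded in `H^s`, for all frequencies. -/
theorem norm_sub_sq_le (hε : 0 < ε) (hε1 : ε ≤ 1) {n R S : ℝ} (hn : 1 ≤ n) (hR : 0 ≤ R)
    {h w h' w' : ℝ → H} (H1 : CutSolution P ε S R n h w) (H2 : CutSolution P ε S R n h' w')
    (h0 : mulL (cut n) (h 0) = mulL (cut n) (h' 0)) (w0 : mulL (cut n) (w 0) = mulL (cut n) (w' 0))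
    {t : ℝ} (ht : t ∈ Set.Icc 0 S) : ‖h t - h' t‖ ^ 2 + ‖w t - w' t‖ ^ 2 ≤
      (2 * (Real.exp (P.diffConst R * S) * (P.diffConst R * S)) + 16 * R ^ 2) * n ^ (1 - P.s) := by
  have hK := diffConst_nonneg (P := P) hR
  have hδ : 0 < n ^ (1 - P.s) := Real.rpow_pos_of_pos (by linarith) _
  have hδ1 : n ^ (1 - P.s) ≤ 1 := Real.rpow_le_one_of_one_le_of_nonpos hn
    (by linarith [P.two_lt_s])
  have key := norm_cut_sub_sq_le hε hε1 hn hR H1 H2 t ht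
  obtain ⟨f, g, rf, rg, ef, eg, bf, bg⟩ := H1.rep t ht
  obtain ⟨f', g', rf', rg', ef', eg', bf', bg'⟩ := H2.rep t ht
  have n1 := norm_le_cut_add (P := P) hn (f - f')
  have n2 := norm_le_cut_add (P := P) hn (g - g')
  have bD : ‖f - f'‖ ≤ 2 * R := (norm_sub_le _ _).trans (by linarith)
  have bG : ‖g - g'‖ ≤ 2 * R := (norm_sub_le _ _).trans (by linarith)
  rw [map_sub, ← ef, ← ef'] at n1
  rw [map_sub, ← eg, ← eg'] at n2
  rw [map_sub (mulL (cut n)) (h 0), map_sub (mulL (cut n)) (w 0), h0, w0, sub_self, sub_self,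
    norm_zero] at key
  set x := ‖mulL (cut n) (h t - h' t)‖
  set y := ‖mulL (cut n) (w t - w' t)‖
  set δ := n ^ (1 - P.s)
  -- The full norm is recovered from the low frequencies and the tail `δ * d`. As `δ ≤ 1`, the
  -- square of the tail is still of order `δ`.
  have sq : ∀ {X x d : ℝ}, 0 ≤ X → X ≤ x + δ * d → 0 ≤ d → d ≤ 2 * R → X ^ 2 ≤ 2 * x ^ 2 +
      8 * R ^ 2 * δ := by
    intro X x d hX hXx hd hdR
    have h1 : X ≤ x + δ * (2 * R) := hXx.trans (by gcongr)
    have h2 := pow_le_pow_left₀ hX h1 2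
    have h3 : δ ^ 2 ≤ δ := by nlinarith
    nlinarith [sq_nonneg (x - δ * (2 * R)), mul_le_mul_of_nonneg_left h3 (sq_nonneg R)]
  have s1 := sq (norm_nonneg _) n1 (norm_nonneg _) bD
  have s2 := sq (norm_nonneg _) n2 (norm_nonneg _) bG
  have e1 : Real.exp (P.diffConst R * t) * (0 ^ 2 + 0 ^ 2 + P.diffConst R * δ * t) ≤
      Real.exp (P.diffConst R * S) * (P.diffConst R * S) * δ := by
    have t0 := ht.1
    calc _ = Real.exp (P.diffConst R * t) * (P.diffConst R * t) * δ := by ring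
      _ ≤ _ := by
        gcongr
        all_goals exact ht.2
  linarith

end Params

/-! ### Limits of multipliers and of differential equations -/

section LimitTools

theorem mulL_injective {m : Plane → ℝ} (hm : IsMultiplier m) (h0 : ∀ ξ, m ξ ≠ 0) {f g : H}
    (h : mulL m f = mulL m g) : f = g := by
  apply Lp.ext
  have h' : (mulL m f : Plane → ℂ) =ᵐ[volume] mulL m g := by rw [h]
  filter_upwards [mulL_coe hm f, mulL_coe hm g, h'] with ξ h1 h2 h3
  rw [h1, h2] at h3
  exact mul_left_cancel₀ (Complex.ofReal_ne_zero.2 (h0 ξ)) h3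

/-- Pointwise bounded convergence of multipliers implies strong convergence. -/
theorem tendsto_mulL {m : ℕ → Plane → ℝ} {m' : Plane → ℝ} {C : ℝ} (hm : ∀ n, IsMultiplier (m n))
    (hm' : IsMultiplier m') (hC : ∀ n ξ, |m n ξ| ≤ C)
    (hlim : ∀ ξ, Tendsto (fun n => m n ξ) atTop (𝓝 (m' ξ))) (f : H) :
    Tendsto (fun n => mulL (m n) f) atTop (𝓝 (mulL m' f)) := by
  have hC' : ∀ ξ, |m' ξ| ≤ C := fun ξ =>
    le_of_tendsto (hlim ξ).abs (Eventually.of_forall fun n => hC n ξ)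
  have e : ∀ n, ENNReal.ofReal (‖mulL (m n) f - mulL m' f‖ ^ 2) =
      ∫⁻ ξ, ‖((m n ξ - m' ξ : ℝ) : ℂ) * f ξ‖ₑ ^ 2 := by
    intro n
    rw [norm_sq_eq_lintegral]
    apply lintegral_congr_ae
    filter_upwards [mulL_coe (hm n) f, mulL_coe hm' f,
      Lp.coeFn_sub (mulL (m n) f) (mulL m' f)] with ξ h1 h2 h3
    rw [h3, Pi.sub_apply, h1, h2, Complex.ofReal_sub, sub_mul]
  have hfin : ∫⁻ ξ, ENNReal.ofReal (2 * C) ^ 2 * ‖f ξ‖ₑ ^ 2 ≠ ∞ := by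
    rw [lintegral_const_mul' _ _ (by finiteness), ← norm_sq_eq_lintegral]
    finiteness
  have h := tendsto_lintegral_of_dominated_convergence (μ := (volume : Measure Plane))
    (F := fun n ξ => ‖((m n ξ - m' ξ : ℝ) : ℂ) * f ξ‖ₑ ^ 2) (f := fun _ => 0)
    (fun ξ => ENNReal.ofReal (2 * C) ^ 2 * ‖f ξ‖ₑ ^ 2) (fun n => ?_) (fun n => ?_) hfin ?_
  · simp only [← e, lintegral_zero] at h
    have h2 := (ENNReal.tendsto_toReal ENNReal.zero_ne_top).comp h
    have h3 : Tendsto (fun n => ‖mulL (m n) f - mulL m' f‖ ^ 2) atTop (𝓝 0) := by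
      refine h2.congr fun n => ?_
      simp only [Function.comp]
      rw [ENNReal.toReal_ofReal (by positivity)]
    have h4 := h3.sqrt
    rw [Real.sqrt_zero] at h4
    rw [tendsto_iff_norm_sub_tendsto_zero]
    exact h4.congr fun n => Real.sqrt_sq (norm_nonneg _)
  · have := (hm n).1
    have := hm'.1
    have := measurable_coe f
    fun_prop
  · refine ae_of_all _ fun ξ => ?_
    dsimp only
    rw [enorm_mul, mul_pow]
    gcongr
    rw [← ofReal_norm, Complex.norm_real]
    apply ENNReal.ofReal_le_ofReal
    refine (abs_sub _ _).trans ?_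
    linarith [hC n ξ, hC' ξ]
  · refine ae_of_all _ fun ξ => ?_
    have h1 : Tendsto (fun n => ((m n ξ - m' ξ : ℝ) : ℂ) * f ξ) atTop (𝓝 0) := by
      have := (Complex.continuous_ofReal.tendsto _).comp ((hlim ξ).sub_const (m' ξ))
      simpa using this.mul_const (f ξ)
    have h2 := (ENNReal.continuous_pow 2).tendsto _ |>.comp h1.enorm
    simpa [Function.comp_def] using h2

theorem tendsto_cut (ξ : Plane) : Tendsto (fun n : ℕ => cut n ξ) atTop (𝓝 1) := by
  apply tendsto_const_nhds.congr'
  filter_upwards [eventually_ge_atTop ⌈freq ξ⌉₊] with n hn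
  have : freq ξ ≤ n := (Nat.le_ceil _).trans (by exact_mod_cast hn)
  simp [cut, this]

theorem tendsto_mulL_cut {z : ℕ → H} {z' : H} (hz : Tendsto z atTop (𝓝 z')) :
    Tendsto (fun n : ℕ => mulL (cut n) (z n)) atTop (𝓝 z') := by
  have h1 : IsMultiplier fun _ : Plane => (1 : ℝ) := ⟨measurable_const, 1, fun _ => by simp⟩
  have h2 := tendsto_mulL (fun n : ℕ => isMultiplier_cut n) h1 (fun n => abs_cut_le n) tendsto_cut z'
  rw [mulL_one] at h2
  have h3 : Tendsto (fun n : ℕ => mulL (cut n) (z n - z')) atTop (𝓝 0) := by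
    rw [tendsto_zero_iff_norm_tendsto_zero]
    refine squeeze_zero (fun _ => norm_nonneg _) (fun n => Params.norm_cut_le n _) ?_
    rwa [← tendsto_iff_norm_sub_tendsto_zero]
  have := h3.add h2
  rw [zero_add] at this
  refine this.congr fun n => ?_
  rw [map_sub, sub_add_cancel]

/-- Limits of solutions of differential equations. -/
theorem hasDerivWithinAt_of_tendsto {E : Type*} [NormedAddCommGroup E] [NormedSpace ℝ E]
    [CompleteSpace E] {x y : ℕ → ℝ → E} {x' y' : ℝ → E} {S C : ℝ}
    (hd : ∀ n, ∀ t ∈ Set.Icc 0 S, HasDerivWithinAt (x n) (y n t) (Set.Icc 0 S) t)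
    (hy : ∀ n, ContinuousOn (y n) (Set.Icc 0 S)) (hC : ∀ n, ∀ t ∈ Set.Icc 0 S, ‖y n t‖ ≤ C)
    (hx' : ∀ t ∈ Set.Icc 0 S, Tendsto (fun n => x n t) atTop (𝓝 (x' t)))
    (hy' : ∀ t ∈ Set.Icc 0 S, Tendsto (fun n => y n t) atTop (𝓝 (y' t)))
    (hc : ContinuousOn y' (Set.Icc 0 S)) :
    ∀ t ∈ Set.Icc 0 S, HasDerivWithinAt x' (y' t) (Set.Icc 0 S) t := by
  intro t ht
  have hS : 0 ≤ S := ht.1.trans ht.2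
  -- Clamping the time to `[0, S]` extends `y'` to a continuous function on the line, so that the
  -- fundamental theorem of calculus applies also at the end points.
  let z : ℝ → E := fun τ => y' (max 0 (min τ S))
  have hmem : ∀ τ : ℝ, max 0 (min τ S) ∈ Set.Icc 0 S := fun τ =>
    ⟨le_max_left _ _, max_le hS (min_le_right _ _)⟩
  have hz : Continuous z := hc.comp_continuous (by fun_prop) hmem
  have hzy : ∀ τ ∈ Set.Icc 0 S, z τ = y' τ := by
    intro τ hτ
    simp only [z]
    rw [min_eq_left hτ.2, max_eq_right hτ.1]
  -- The integral form of the equations passes to the limit by dominated convergence.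
  have key : ∀ τ ∈ Set.Icc 0 S, x' τ = x' 0 + ∫ r in (0:ℝ)..τ, z r := by
    intro τ hτ
    have hsub : Set.Icc 0 τ ⊆ Set.Icc 0 S := Set.Icc_subset_Icc_right hτ.2
    have huI : Set.uIoc 0 τ ⊆ Set.Icc 0 S := by
      rw [Set.uIoc_of_le hτ.1]
      exact Set.Ioc_subset_Icc_self.trans hsub
    have hi : ∀ n, ∫ r in (0:ℝ)..τ, y n r = x n τ - x n 0 := by
      intro n
      apply intervalIntegral.integral_eq_sub_of_hasDerivAt_of_le hτ.1
      · exact fun r hr => ((hd n r (hsub hr)).continuousWithinAt).mono hsub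
      · intro r hr
        exact (hd n r ⟨hr.1.le, hr.2.le.trans hτ.2⟩).hasDerivAt
          (Icc_mem_nhds hr.1 (hr.2.trans_le hτ.2))
      · apply ContinuousOn.intervalIntegrable
        rw [Set.uIcc_of_le hτ.1]
        exact (hy n).mono hsub
    have hl : Tendsto (fun n => ∫ r in (0:ℝ)..τ, y n r) atTop (𝓝 (∫ r in (0:ℝ)..τ, z r)) := by
      apply intervalIntegral.tendsto_integral_filter_of_dominated_convergence (fun _ => C)
      · refine Eventually.of_forall fun n => ?_
        exact ((hy n).mono huI).aestronglyMeasurable measurableSet_uIoc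
      · exact Eventually.of_forall fun n => ae_of_all _ fun r hr => hC n r (huI hr)
      · exact intervalIntegrable_const
      · refine ae_of_all _ fun r hr => ?_
        rw [hzy r (huI hr)]
        exact hy' r (huI hr)
    simp only [hi] at hl
    have h0 : (0:ℝ) ∈ Set.Icc 0 S := ⟨le_rfl, hS⟩
    have := tendsto_nhds_unique hl ((hx' τ hτ).sub (hx' 0 h0))
    rw [this]
    abel
  have h := ((hz.integral_hasStrictDerivAt 0 t).hasDerivAt.const_add (x' 0)).hasDerivWithinAt
    (s := Set.Icc 0 S)
  rw [hzy t ht] at h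
  exact h.congr key (key t ht)

end LimitTools

/-! ### Capped weights: membership in H^s and continuity in H^s -/

section Cap

/-- The weight `⟨ξ⟩^s` capped at `N`. -/
def capJap (s N : ℝ) (ξ : Plane) : ℝ := min (jap ξ ^ s) N

theorem isEnergyWeight_capJap (s : ℝ) {N : ℝ} (hN : 0 ≤ N) : IsEnergyWeight s (capJap s N) :=
  isEnergyWeight_min s hN

theorem isMultiplier_capJap (s : ℝ) {N : ℝ} (hN : 0 ≤ N) : IsMultiplier (capJap s N) :=
  ⟨(isEnergyWeight_capJap s hN).measurable, N, fun ξ => by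
    rw [abs_of_nonneg ((isEnergyWeight_capJap s hN).nonneg ξ)]
    exact min_le_right _ _⟩

theorem tendsto_capJap (s : ℝ) (ξ : Plane) :
    Tendsto (fun N : ℕ => capJap s N ξ) atTop (𝓝 (jap ξ ^ s)) := by
  apply tendsto_const_nhds.congr'
  filter_upwards [eventually_ge_atTop ⌈jap ξ ^ s⌉₊] with N hN
  have : jap ξ ^ s ≤ N := (Nat.le_ceil _).trans (by exact_mod_cast hN)
  exact (min_eq_left this).symm

namespace Params

variable {P : Params} {ε : ℝ}

theorem abs_capJap_smooth_le (N : ℕ) (ξ : Plane) :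
    |capJap P.s N ξ * jap ξ ^ (-P.s)| ≤ 1 := by
  have h := isEnergyWeight_capJap P.s N.cast_nonneg
  have h1 := jap_rpow_pos (-P.s) ξ
  rw [abs_of_nonneg (mul_nonneg (h.nonneg ξ) h1.le), ← jap_rpow_neg_mul P.s ξ, mul_comm]
  exact mul_le_mul_of_nonneg_left (h.le ξ) h1.le

theorem tendsto_capJap_smooth (f : H) :
    Tendsto (fun N : ℕ => mulL (capJap P.s N) (P.smooth f)) atTop (𝓝 f) := by
  have h1 : IsMultiplier fun _ : Plane => (1 : ℝ) := ⟨measurable_const, 1, fun _ => by simp⟩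
  have hc : ∀ N : ℕ, IsMultiplier (capJap P.s N) := fun N => isMultiplier_capJap _ N.cast_nonneg
  have h := tendsto_mulL (fun N => (hc N).mul isMultiplier_smooth) h1
    (abs_capJap_smooth_le (P := P)) (fun ξ => by
      have := (tendsto_capJap P.s ξ).mul_const (jap ξ ^ (-P.s))
      rwa [mul_comm (jap ξ ^ P.s), jap_rpow_neg_mul] at this) f
  rw [mulL_one] at h
  exact h.congr fun N => (mulL_mulL (hc N) isMultiplier_smooth f).symm

/-- A function whose capped `H^s` norms are bounded is in `H^s`. -/
theorem exists_smooth_eq {x : H} {B : ℝ} (hB : 0 ≤ B)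
    (h : ∀ N : ℕ, ‖mulL (capJap P.s N) x‖ ≤ B) : ∃ f : H, P.smooth f = x ∧ ‖f‖ ≤ B := by
  let F : Plane → ℂ := fun ξ => ((jap ξ ^ P.s : ℝ) : ℂ) * x ξ
  -- Fatou's lemma as the cap tends to infinity.
  have hle : eLpNorm F 2 volume ≤ ENNReal.ofReal B := by
    refine (Lp.eLpNorm_lim_le_liminf_eLpNorm (f := fun N : ℕ => (mulL (capJap P.s N) x : Plane → ℂ))
      (fun N => Lp.aestronglyMeasurable _) F ?_).trans ?_
    · have : ∀ᵐ ξ : Plane, ∀ N : ℕ, mulL (capJap P.s N) x ξ = (capJap P.s N ξ : ℂ) * x ξ :=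
        ae_all_iff.2 fun N => mulL_coe (isMultiplier_capJap _ N.cast_nonneg) x
      filter_upwards [this] with ξ hξ
      simp only [hξ]
      exact ((Complex.continuous_ofReal.tendsto _).comp (tendsto_capJap P.s ξ)).mul_const _
    · refine (liminf_le_liminf (Eventually.of_forall fun N => ?_)).trans_eq
        (liminf_const (ENNReal.ofReal B))
      rw [← Lp.enorm_def, ← ofReal_norm]
      exact ENNReal.ofReal_le_ofReal (h N)
  have hmeas : AEStronglyMeasurable F volume :=
    ((Complex.measurable_ofReal.comp (measurable_jap_rpow P.s)).mul
      (measurable_coe x)).aestronglyMeasurable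
  have hmem : MemLp F 2 volume := ⟨hmeas, hle.trans_lt ENNReal.ofReal_lt_top⟩
  refine ⟨hmem.toLp, ?_, ?_⟩
  · apply Lp.ext
    filter_upwards [mulL_coe (isMultiplier_smooth (P := P)) hmem.toLp, hmem.coeFn_toLp] with ξ h1 h2
    rw [h1, h2, ← mul_assoc, ← Complex.ofReal_mul, jap_rpow_neg_mul, Complex.ofReal_one, one_mul]
  · rw [Lp.norm_toLp]
    exact ENNReal.toReal_le_of_le_ofReal hB hle

theorem smooth_injective {f g : H} (h : P.smooth f = P.smooth g) : f = g :=
  mulL_injective isMultiplier_smooth (fun ξ => (jap_rpow_pos _ ξ).ne') h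

/-- Bounded functions with values in `H^s` that are continuous in `L²` are weakly continuous. -/
theorem tendsto_inner_of_smooth {F : ℝ → H} {s : Set ℝ} {t B : ℝ} (hB : ∀ τ ∈ s, ‖F τ‖ ≤ B)
    (ht : t ∈ s) (hc : ContinuousWithinAt (fun τ => P.smooth (F τ)) s t) (e : H) :
    Tendsto (fun τ => inner ℝ (F τ) e) (𝓝[s] t) (𝓝 (inner ℝ (F t) e)) := by
  rw [Metric.tendsto_nhds]
  intro δ hδ
  have hB0 : 0 ≤ B := (norm_nonneg _).trans (hB t ht)
  -- The functional `e` is approximated by one of the form `P.smooth y`, whose pairing with `F` is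
  -- the pairing of `P.smooth (F ·)` with `y` and hence continuous. The tolerance makes the error at
  -- most `δ / 2` against a difference of norm at most `2 * B`; the `+ 1` covers `B = 0`.
  obtain ⟨N, hN⟩ := ((Metric.tendsto_nhds.1 (tendsto_capJap_smooth (P := P) e))
    (δ / (2 * (2 * B + 1))) (by positivity)).exists
  set y := mulL (capJap P.s N) e with hy
  have hys : P.smooth y = mulL (capJap P.s N) (P.smooth e) := by
    rw [hy, mulL_mulL isMultiplier_smooth (isMultiplier_capJap _ N.cast_nonneg),
      mulL_mulL (isMultiplier_capJap _ N.cast_nonneg) isMultiplier_smooth]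
    exact mulL_congr (fun ξ => mul_comm _ _) e
  rw [← hys, dist_eq_norm] at hN
  have hc2 : Tendsto (fun τ => inner ℝ (P.smooth (F τ)) y) (𝓝[s] t)
      (𝓝 (inner ℝ (P.smooth (F t)) y)) := Tendsto.inner hc tendsto_const_nhds
  filter_upwards [Metric.tendsto_nhds.1 hc2 (δ / 2) (by positivity), self_mem_nhdsWithin]
    with τ h1 hτ
  rw [Real.dist_eq] at h1 ⊢
  rw [inner_mulL isMultiplier_smooth, inner_mulL isMultiplier_smooth] at h1
  have e1 : inner ℝ (F τ) e - inner ℝ (F t) e = inner ℝ (F τ) (P.smooth y) -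
      inner ℝ (F t) (P.smooth y) - inner ℝ (F τ - F t) (P.smooth y - e) := by
    simp only [inner_sub_left, inner_sub_right]
    ring
  have h2 : |inner ℝ (F τ - F t) (P.smooth y - e)| ≤ (2 * B) * (δ / (2 * (2 * B + 1))) := by
    refine (abs_real_inner_le_norm _ _).trans ?_
    gcongr
    refine (norm_sub_le _ _).trans ?_
    linarith [hB τ hτ, hB t ht]
  have h3 : (2 * B) * (δ / (2 * (2 * B + 1))) ≤ δ / 2 := by
    have : (2 * B) * (δ / (2 * (2 * B + 1))) = (δ / 2) * ((2 * B) / (2 * B + 1)) := by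
      field_simp
    rw [this]
    have : (2 * B) / (2 * B + 1) ≤ 1 := by rw [div_le_one (by positivity)]; linarith
    nlinarith
  rw [e1]
  calc _ ≤ _ := abs_sub _ _
    _ < δ / 2 + δ / 2 := by linarith
    _ = δ := by ring

/-- Weak continuity and continuity of the norm imply strong continuity. -/
theorem continuousOn_of_norm_of_inner {F G : ℝ → H} {s : Set ℝ}
    (hE : ContinuousOn (fun τ => ‖F τ‖ ^ 2 + ‖G τ‖ ^ 2) s)
    (hF : ∀ t ∈ s, ∀ e, Tendsto (fun τ => inner ℝ (F τ) e) (𝓝[s] t) (𝓝 (inner ℝ (F t) e)))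
    (hG : ∀ t ∈ s, ∀ e, Tendsto (fun τ => inner ℝ (G τ) e) (𝓝[s] t) (𝓝 (inner ℝ (G t) e))) :
    ContinuousOn F s ∧ ContinuousOn G s := by
  have key : ∀ t ∈ s, Tendsto (fun τ => ‖F τ - F t‖ ^ 2 + ‖G τ - G t‖ ^ 2) (𝓝[s] t) (𝓝 0) := by
    intro t ht
    have h := ((Tendsto.add_const (‖F t‖ ^ 2 + ‖G t‖ ^ 2) (hE t ht)).sub
      ((hF t ht (F t)).const_mul 2)).sub
      ((hG t ht (G t)).const_mul 2)
    rw [real_inner_self_eq_norm_sq, real_inner_self_eq_norm_sq] at h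
    have e0 : (‖F t‖ ^ 2 + ‖G t‖ ^ 2 + (‖F t‖ ^ 2 + ‖G t‖ ^ 2) - 2 * ‖F t‖ ^ 2 - 2 * ‖G t‖ ^ 2 : ℝ)
        = 0 := by ring
    rw [e0] at h
    refine h.congr fun τ => ?_
    rw [norm_sub_sq_real, norm_sub_sq_real]
    ring
  have fin : ∀ (u : ℝ → H) (v : ℝ → ℝ) (t : ℝ), Tendsto v (𝓝[s] t) (𝓝 0) →
      (∀ τ, ‖u τ - u t‖ ^ 2 ≤ v τ) → ContinuousWithinAt u s t := by
    intro u v t hv huv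
    have h1 := squeeze_zero (fun τ => sq_nonneg ‖u τ - u t‖) huv hv
    have h2 := h1.sqrt
    rw [Real.sqrt_zero] at h2
    exact tendsto_iff_norm_sub_tendsto_zero.2 (h2.congr fun τ => Real.sqrt_sq (norm_nonneg _))
  exact ⟨fun t ht => fin F _ t (key t ht) fun τ => by linarith [sq_nonneg ‖G τ - G t‖],
    fun t ht => fin G _ t (key t ht) fun τ => by linarith [sq_nonneg ‖F τ - F t‖]⟩

end Params

end Cap

/-! ### Existence and uniqueness for the system in Fourier variables -/

namespace Params

/-- `(h, w)` solves the system in Fourier variables, and it is bounded by `R` in `H^s`. -/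
structure FourierSolution (P : Params) (ε S R : ℝ) (h w : ℝ → H) : Prop where
  rep : ∀ t ∈ Set.Icc 0 S, ∃ f g : H, reflect f = f ∧ reflect g = g ∧
    h t = P.smooth f ∧ w t = P.smooth g ∧ ‖f‖ ≤ R ∧ ‖g‖ ≤ R
  deriv_h : ∀ t ∈ Set.Icc 0 S, HasDerivWithinAt (fun τ => mulL damp (h τ))
    (P.fieldH ε (h t) (w t)) (Set.Icc 0 S) t
  deriv_w : ∀ t ∈ Set.Icc 0 S, HasDerivWithinAt (fun τ => mulL damp (w τ))
    (P.fieldW ε (h t) (w t)) (Set.Icc 0 S) t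

variable {P : Params} {ε : ℝ}

theorem cutQuartic_damp (n : ℝ) (x : H) : mulL (cutQuartic n) (mulL damp x) = mulL (cut n) x := by
  rw [mulL_mulL (isMultiplier_cutQuartic n) isMultiplier_damp]
  exact mulL_congr (fun ξ => by rw [mul_comm, cutQuartic_mul_damp]) x

/-- `cutQuartic` inverts the damping below frequency `n`. Exact solutions thus fall under the same
stability estimate as the Galerkin approximations. -/
theorem FourierSolution.cutSolution {S R : ℝ} {h w : ℝ → H} (hs : FourierSolution P ε S R h w)
    (n : ℝ) : CutSolution P ε S R n h w := by
  refine ⟨hs.rep, fun t ht => ?_, fun t ht => ?_⟩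
  · have := (mulL (cutQuartic n)).hasFDerivAt.comp_hasDerivWithinAt t (hs.deriv_h t ht)
    exact this.congr (fun τ _ => (cutQuartic_damp n _).symm) (cutQuartic_damp n _).symm
  · have := (mulL (cutQuartic n)).hasFDerivAt.comp_hasDerivWithinAt t (hs.deriv_w t ht)
    exact this.congr (fun τ _ => (cutQuartic_damp n _).symm) (cutQuartic_damp n _).symm

theorem tendsto_natCast_rpow : Tendsto (fun n : ℕ => ((n + 1 : ℕ) : ℝ) ^ (1 - P.s)) atTop (𝓝 0) := by
  have h := (tendsto_rpow_neg_atTop (y := P.s - 1) (by linarith [P.two_lt_s])).comp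
    ((tendsto_natCast_atTop_atTop (R := ℝ)).comp (tendsto_add_atTop_nat 1))
  refine h.congr fun n => ?_
  simp only [Function.comp]
  congr 1
  ring

/-- With equal data the stability estimate bounds the difference by a constant times n^{1-s} for
every level n, and this tends to zero. -/
theorem FourierSolution.unique (hε : 0 < ε) (hε1 : ε ≤ 1) {S R : ℝ} (hR : 0 ≤ R)
    {h w h' w' : ℝ → H} (H1 : FourierSolution P ε S R h w) (H2 : FourierSolution P ε S R h' w')
    (h0 : h 0 = h' 0) (w0 : w 0 = w' 0) {t : ℝ} (ht : t ∈ Set.Icc 0 S) :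
    h t = h' t ∧ w t = w' t := by
  have key : ‖h t - h' t‖ ^ 2 + ‖w t - w' t‖ ^ 2 ≤ 0 := by
    have hl := (tendsto_natCast_rpow (P := P)).const_mul
      (2 * (Real.exp (P.diffConst R * S) * (P.diffConst R * S)) + 16 * R ^ 2)
    rw [mul_zero] at hl
    refine ge_of_tendsto hl (Eventually.of_forall fun n => ?_)
    exact norm_sub_sq_le hε hε1 (by exact_mod_cast Nat.le_add_left 1 n) hR (H1.cutSolution _)
      (H2.cutSolution _) (by rw [h0]) (by rw [w0]) ht
  have h1 : ‖h t - h' t‖ ^ 2 = 0 := by nlinarith [sq_nonneg ‖h t - h' t‖, sq_nonneg ‖w t - w' t‖]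
  have h2 : ‖w t - w' t‖ ^ 2 = 0 := by nlinarith [sq_nonneg ‖h t - h' t‖, sq_nonneg ‖w t - w' t‖]
  exact ⟨sub_eq_zero.1 (norm_eq_zero.1 (pow_eq_zero_iff two_ne_zero |>.1 h1)),
    sub_eq_zero.1 (norm_eq_zero.1 (pow_eq_zero_iff two_ne_zero |>.1 h2))⟩

/-- The Galerkin approximation, with the weight of `H^s` and its energy. -/
structure Galerkin (P : Params) (ε S R n : ℝ) (f g : ℝ → H) : Prop where
  reflect_f : ∀ t ∈ Set.Icc 0 S, reflect (f t) = f t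
  reflect_g : ∀ t ∈ Set.Icc 0 S, reflect (g t) = g t
  cut_f : ∀ t ∈ Set.Icc 0 S, mulL (cut n) (f t) = f t
  cut_g : ∀ t ∈ Set.Icc 0 S, mulL (cut n) (g t) = g t
  bound : ∀ t ∈ Set.Icc 0 S, ‖f t‖ ^ 2 + ‖g t‖ ^ 2 ≤ R ^ 2
  deriv_f : ∀ t ∈ Set.Icc 0 S, HasDerivWithinAt f (P.undamp n (P.fieldH ε
    (mulL (cutJap P.s n) (f t)) (mulL (cutJap P.s n) (g t)))) (Set.Icc 0 S) t
  deriv_g : ∀ t ∈ Set.Icc 0 S, HasDerivWithinAt g (P.undamp n (P.fieldW ε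
    (mulL (cutJap P.s n) (f t)) (mulL (cutJap P.s n) (g t)))) (Set.Icc 0 S) t

theorem cutJap_eq_smooth (n : ℝ) (x : H) :
    mulL (cutJap P.s n) x = P.smooth (mulL (cut n) x) := by
  rw [mulL_mulL isMultiplier_smooth (isMultiplier_cut n)]
  exact mulL_congr (fun ξ => mul_comm _ _) x

theorem energySym_jap_mul (s n : ℝ) (ξ : Plane) :
    energySym s n (fun ξ => jap ξ ^ s) ξ * jap ξ ^ (-s) = cutQuartic n ξ := by
  rw [energySym, cutQuartic]
  have h := jap_rpow_neg_mul s ξ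
  calc _ = cut n ξ * jap ξ ^ 4 * (jap ξ ^ (-s) * jap ξ ^ s) ^ 2 := by ring
    _ = _ := by rw [h]; ring

theorem cut_smooth_undamp {m n : ℝ} (hmn : m ≤ n) (x : H) :
    mulL (cut m) (P.smooth (P.undamp n x)) = mulL (cutQuartic m) x := by
  have hq := isMultiplier_energySym (by linarith [P.two_lt_s] : 0 ≤ P.s) n (isEnergyWeight_jap P.s)
  rw [undamp, mulL_mulL isMultiplier_smooth hq,
    mulL_mulL (isMultiplier_cut m) (isMultiplier_smooth.mul hq)]
  refine mulL_congr (fun ξ => ?_) x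
  have h := energySym_jap_mul P.s n ξ
  have h2 := cut_mul_cut hmn ξ
  rw [cutQuartic] at h ⊢
  linear_combination cut m ξ * h + jap ξ ^ 4 * h2

theorem Galerkin.norm_le {S R n : ℝ} (hR : 0 ≤ R) {f g : ℝ → H} (hG : Galerkin P ε S R n f g)
    {t : ℝ} (ht : t ∈ Set.Icc 0 S) : ‖f t‖ ≤ R ∧ ‖g t‖ ≤ R :=
  ⟨le_of_sq_le_sq (by nlinarith [hG.bound t ht, sq_nonneg ‖g t‖]) hR,
    le_of_sq_le_sq (by nlinarith [hG.bound t ht, sq_nonneg ‖f t‖]) hR⟩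

theorem Galerkin.field_eq {S R n : ℝ} {f g : ℝ → H} (hG : Galerkin P ε S R n f g)
    {t : ℝ} (ht : t ∈ Set.Icc 0 S) : mulL (cutJap P.s n) (f t) = P.smooth (f t) ∧
      mulL (cutJap P.s n) (g t) = P.smooth (g t) := by
  rw [cutJap_eq_smooth, cutJap_eq_smooth, hG.cut_f t ht, hG.cut_g t ht]
  exact ⟨rfl, rfl⟩

/-- The truncation at level `n` is invisible below any `m ≤ n`, because `cut m` absorbs `cut n`.
Approximations of different levels can therefore be compared as solutions of the same cut system. -/
theorem Galerkin.cutSolution {S R m n : ℝ} (hR : 0 ≤ R) (hmn : m ≤ n) {f g : ℝ → H}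
    (hG : Galerkin P ε S R n f g) :
    CutSolution P ε S R m (fun t => P.smooth (f t)) (fun t => P.smooth (g t)) := by
  refine ⟨fun t ht => ⟨f t, g t, hG.reflect_f t ht, hG.reflect_g t ht, rfl, rfl,
    (hG.norm_le hR ht).1, (hG.norm_le hR ht).2⟩, fun t ht => ?_, fun t ht => ?_⟩
  · have := ((mulL (cut m)).comp P.smooth).hasFDerivAt.comp_hasDerivWithinAt t (hG.deriv_f t ht)
    rw [(hG.field_eq ht).1, (hG.field_eq ht).2] at this
    exact this.congr_deriv (cut_smooth_undamp hmn _)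
  · have := ((mulL (cut m)).comp P.smooth).hasFDerivAt.comp_hasDerivWithinAt t (hG.deriv_g t ht)
    rw [(hG.field_eq ht).1, (hG.field_eq ht).2] at this
    exact this.congr_deriv (cut_smooth_undamp hmn _)

theorem damp_smooth_undamp (n : ℝ) (x : H) :
    mulL damp (P.smooth (P.undamp n x)) = mulL (cut n) x := by
  have hq := isMultiplier_energySym (by linarith [P.two_lt_s] : 0 ≤ P.s) n (isEnergyWeight_jap P.s)
  rw [undamp, mulL_mulL isMultiplier_smooth hq,
    mulL_mulL isMultiplier_damp (isMultiplier_smooth.mul hq)]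
  refine mulL_congr (fun ξ => ?_) x
  have h := energySym_jap_mul P.s n ξ
  have h2 := cutQuartic_mul_damp n ξ
  linear_combination damp ξ * h + h2

/-- The capped energies of the Galerkin approximations are uniformly Lipschitz in time. -/
theorem Galerkin.abs_energy_sub_le (hε : 0 < ε) (hε1 : ε ≤ 1) {S R n N : ℝ} (hR : 0 ≤ R)
    (hn : 0 ≤ n) (hN : 0 ≤ N) {f g : ℝ → H} (hG : Galerkin P ε S R n f g)
    {t τ : ℝ} (ht : t ∈ Set.Icc 0 S) (hτ : τ ∈ Set.Icc 0 S) :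
    |(‖mulL (capJap P.s N) (P.smooth (f τ))‖ ^ 2 + ‖mulL (capJap P.s N) (P.smooth (g τ))‖ ^ 2) -
      (‖mulL (capJap P.s N) (P.smooth (f t))‖ ^ 2 + ‖mulL (capJap P.s N) (P.smooth (g t))‖ ^ 2)| ≤
      2 * (P.energyConst * Real.sqrt ε * R ^ 3) * |τ - t| := by
  have hp := isEnergyWeight_capJap P.s hN
  have hc := isMultiplier_capJap P.s hN
  have hq := isMultiplier_energySym (by linarith [P.two_lt_s] : 0 ≤ P.s) n (isEnergyWeight_jap P.s)
  have hq' := isMultiplier_energySym (by linarith [P.two_lt_s] : 0 ≤ P.s) n hp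
  -- With this identity the derivative of the capped energy becomes the pairing estimated in
  -- `abs_inner_field_le`, for the energy weight `capJap`; the constant there depends neither on `n`
  -- nor on `N`.
  have hinner : ∀ x y : H, mulL (cut n) y = y →
      inner ℝ (mulL (capJap P.s N) (P.smooth y)) (mulL (capJap P.s N) (P.smooth (P.undamp n x))) =
        inner ℝ (mulL (energySym P.s n (capJap P.s N)) x) y := by
    intro x y hy
    rw [real_inner_comm, ← inner_mulL hc, ← inner_mulL isMultiplier_smooth, undamp,
      mulL_mulL isMultiplier_smooth hq, mulL_mulL hc (isMultiplier_smooth.mul hq),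
      mulL_mulL hc (hc.mul (isMultiplier_smooth.mul hq)), mulL_mulL isMultiplier_smooth
        (hc.mul (hc.mul (isMultiplier_smooth.mul hq)))]
    congr 1
    refine mulL_congr (fun ξ => ?_) x
    have h := energySym_jap_mul P.s n ξ
    have e : energySym P.s n (capJap P.s N) ξ =
        cut n ξ * (capJap P.s N ξ ^ 2 * jap ξ ^ (-P.s) * jap ξ ^ 4) := rfl
    rw [e]
    rw [cutQuartic] at h
    linear_combination (capJap P.s N ξ ^ 2 * jap ξ ^ (-P.s)) * h
  have hd : ∀ x ∈ Set.Icc 0 S, HasDerivWithinAt (fun τ =>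
      ‖mulL (capJap P.s N) (P.smooth (f τ))‖ ^ 2 + ‖mulL (capJap P.s N) (P.smooth (g τ))‖ ^ 2)
      (2 * (inner ℝ (mulL (energySym P.s n (capJap P.s N))
        (P.fieldH ε (mulL (cutJap P.s n) (f x)) (mulL (cutJap P.s n) (g x)))) (f x) +
        inner ℝ (mulL (energySym P.s n (capJap P.s N))
        (P.fieldW ε (mulL (cutJap P.s n) (f x)) (mulL (cutJap P.s n) (g x)))) (g x)))
      (Set.Icc 0 S) x := by
    intro x hx
    have d1 := (((mulL (capJap P.s N)).comp P.smooth).hasFDerivAt.comp_hasDerivWithinAt x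
      (hG.deriv_f x hx)).norm_sq
    have d2 := (((mulL (capJap P.s N)).comp P.smooth).hasFDerivAt.comp_hasDerivWithinAt x
      (hG.deriv_g x hx)).norm_sq
    refine (d1.add d2).congr_deriv ?_
    rw [← hinner _ _ (hG.cut_f x hx), ← hinner _ _ (hG.cut_g x hx), mul_add]
    rfl
  have hb : ∀ x ∈ Set.Icc 0 S, ‖2 * (inner ℝ (mulL (energySym P.s n (capJap P.s N))
        (P.fieldH ε (mulL (cutJap P.s n) (f x)) (mulL (cutJap P.s n) (g x)))) (f x) +
        inner ℝ (mulL (energySym P.s n (capJap P.s N))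
        (P.fieldW ε (mulL (cutJap P.s n) (f x)) (mulL (cutJap P.s n) (g x)))) (g x))‖ ≤
      2 * (P.energyConst * Real.sqrt ε * R ^ 3) := by
    intro x hx
    rw [Real.norm_eq_abs, abs_mul, abs_two]
    refine mul_le_mul_of_nonneg_left ?_ zero_le_two
    refine (abs_inner_field_le hε hε1 hp hn (f x) (hG.reflect_g x hx)).trans ?_
    have h1 := hG.bound x hx
    have h2 := (hG.norm_le hR hx).2
    have h3 := P.energyConst_nonneg
    calc _ ≤ P.energyConst * Real.sqrt ε * (R ^ 2 * R) := by gcongr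
      _ = _ := by ring
  exact Convex.norm_image_sub_le_of_norm_hasDerivWithin_le hd hb (convex_Icc 0 S) ht hτ

/-- The bound comes from operator norms and depends on ε. It serves only as the dominating constant
in the passage to the limit. -/
theorem exists_norm_field_le (hε : 0 < ε) (R : ℝ) : ∃ C, ∀ h w : H, ‖h‖ ≤ R → ‖w‖ ≤ R →
    ‖P.fieldH ε h w‖ ≤ C ∧ ‖P.fieldW ε h w‖ ≤ C := by
  let L := mulL (fun ξ => damp ξ * P.symΩ ε ξ)
  let B1 := conv (fun ξ ζ => damp ξ * P.kerH ε ξ ζ)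
  let B2 := conv (fun ξ ζ => damp ξ * kerW ξ ζ)
  refine ⟨‖L‖ * R + ε * (‖B1‖ * R * R) + ε * (‖B2‖ * R * R), fun h w hh hw => ?_⟩
  have hR : 0 ≤ R := (norm_nonneg _).trans hh
  have l1 : ‖L w‖ ≤ ‖L‖ * R := (L.le_opNorm w).trans (by gcongr)
  have l2 : ‖L h‖ ≤ ‖L‖ * R := (L.le_opNorm h).trans (by gcongr)
  have l3 : ‖ε • B1 h w‖ ≤ ε * (‖B1‖ * R * R) := by
    rw [norm_smul, Real.norm_of_nonneg hε.le]
    refine mul_le_mul_of_nonneg_left ((B1.le_opNorm₂ h w).trans ?_) hε.le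
    gcongr
  have l4 : ‖ε • B2 w w‖ ≤ ε * (‖B2‖ * R * R) := by
    rw [norm_smul, Real.norm_of_nonneg hε.le]
    refine mul_le_mul_of_nonneg_left ((B2.le_opNorm₂ w w).trans ?_) hε.le
    gcongr
  have p1 : 0 ≤ ε * (‖B1‖ * R * R) := by positivity
  have p2 : 0 ≤ ε * (‖B2‖ * R * R) := by positivity
  have n1 : ‖P.fieldH ε h w‖ ≤ ‖L w‖ + ‖ε • B1 h w‖ := norm_add_le _ _
  have n2 : ‖P.fieldW ε h w‖ ≤ ‖L h‖ + ‖ε • B2 w w‖ := by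
    have := norm_add_le (-L h) (ε • B2 w w)
    rwa [norm_neg] at this
  constructor <;> linarith

end Params

theorem tendsto_mulL_cut_succ {z : ℕ → H} {z' : H} (hz : Tendsto z atTop (𝓝 z')) :
    Tendsto (fun n : ℕ => mulL (cut (n + 1 : ℕ)) (z n)) atTop (𝓝 z') := by
  have h : Tendsto (fun n : ℕ => z (n - 1)) atTop (𝓝 z') := hz.comp (tendsto_sub_atTop_nat 1)
  refine ((tendsto_mulL_cut h).comp (tendsto_add_atTop_nat 1)).congr fun n => ?_
  simp

namespace Params

variable {P : Params} {ε : ℝ}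

theorem reflect_of_smooth {f : H} (h : reflect (P.smooth f) = P.smooth f) : reflect f = f :=
  smooth_injective (by rw [← reflect_smooth, h])

theorem tendsto_fieldH {α : Type*} {l : Filter α} {h w : α → H} {h' w' : H}
    (hh : Tendsto h l (𝓝 h')) (hw : Tendsto w l (𝓝 w')) :
    Tendsto (fun n => P.fieldH ε (h n) (w n)) l (𝓝 (P.fieldH ε h' w')) := by
  have h1 := (continuous_fieldH (P := P) (ε := ε)).tendsto (h', w')
  have h2 := hh.prodMk_nhds hw
  have h3 := h1.comp h2
  exact h3

theorem continuousOn_fieldH {h w : ℝ → H} {s : Set ℝ} (hh : ContinuousOn h s)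
    (hw : ContinuousOn w s) : ContinuousOn (fun t => P.fieldH ε (h t) (w t)) s :=
  fun t ht => tendsto_fieldH (hh t ht) (hw t ht)

theorem tendsto_fieldW {α : Type*} {l : Filter α} {h w : α → H} {h' w' : H}
    (hh : Tendsto h l (𝓝 h')) (hw : Tendsto w l (𝓝 w')) :
    Tendsto (fun n => P.fieldW ε (h n) (w n)) l (𝓝 (P.fieldW ε h' w')) := by
  have h1 := (continuous_fieldW (P := P) (ε := ε)).tendsto (h', w')
  have h2 := hh.prodMk_nhds hw
  have h3 := h1.comp h2
  exact h3

theorem continuousOn_fieldW {h w : ℝ → H} {s : Set ℝ} (hh : ContinuousOn h s)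
    (hw : ContinuousOn w s) : ContinuousOn (fun t => P.fieldW ε (h t) (w t)) s :=
  fun t ht => tendsto_fieldW (hh t ht) (hw t ht)

theorem Galerkin.continuousOn_f {S R n : ℝ} {f g : ℝ → H} (hG : Galerkin P ε S R n f g) :
    ContinuousOn (fun t => P.smooth (f t)) (Set.Icc 0 S) :=
  P.smooth.continuous.comp_continuousOn fun t ht => (hG.deriv_f t ht).continuousWithinAt

theorem Galerkin.continuousOn_g {S R n : ℝ} {f g : ℝ → H} (hG : Galerkin P ε S R n f g) :
    ContinuousOn (fun t => P.smooth (g t)) (Set.Icc 0 S) :=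
  P.smooth.continuous.comp_continuousOn fun t ht => (hG.deriv_g t ht).continuousWithinAt

/-- The limit of the Galerkin approximations solves the system. -/
theorem hasDerivWithinAt_damp_of_galerkin (hε : 0 < ε) {S R : ℝ} (hR : 0 ≤ R) {f g : ℕ → ℝ → H}
    {F G : ℝ → H} (hG : ∀ n, Galerkin P ε S R (n + 1 : ℕ) (f n) (g n))
    (hF : ∀ t ∈ Set.Icc 0 S, Tendsto (fun n => P.smooth (f n t)) atTop (𝓝 (P.smooth (F t))))
    (hGl : ∀ t ∈ Set.Icc 0 S, Tendsto (fun n => P.smooth (g n t)) atTop (𝓝 (P.smooth (G t))))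
    (hFc : ContinuousOn (fun t => P.smooth (F t)) (Set.Icc 0 S))
    (hGc : ContinuousOn (fun t => P.smooth (G t)) (Set.Icc 0 S)) :
    (∀ t ∈ Set.Icc 0 S, HasDerivWithinAt (fun τ => mulL damp (P.smooth (F τ)))
      (P.fieldH ε (P.smooth (F t)) (P.smooth (G t))) (Set.Icc 0 S) t) ∧
    ∀ t ∈ Set.Icc 0 S, HasDerivWithinAt (fun τ => mulL damp (P.smooth (G τ)))
      (P.fieldW ε (P.smooth (F t)) (P.smooth (G t))) (Set.Icc 0 S) t := by
  obtain ⟨C, hC⟩ := exists_norm_field_le (P := P) hε R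
  have hsb : ∀ {x : H}, ‖x‖ ≤ R → ‖P.smooth x‖ ≤ R := fun hx => (norm_smooth_le _).trans hx
  constructor
  · refine hasDerivWithinAt_of_tendsto (x := fun n t => mulL damp (P.smooth (f n t)))
      (y := fun n t => mulL (cut (n + 1 : ℕ)) (P.fieldH ε (P.smooth (f n t)) (P.smooth (g n t))))
      (C := C) ?_ ?_ ?_ ?_ ?_ ?_
    · intro n t ht
      have := ((mulL damp).comp P.smooth).hasFDerivAt.comp_hasDerivWithinAt t ((hG n).deriv_f t ht)
      rw [((hG n).field_eq ht).1, ((hG n).field_eq ht).2] at this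
      exact this.congr_deriv (damp_smooth_undamp _ _)
    · intro n
      exact (mulL (cut (n + 1 : ℕ))).continuous.comp_continuousOn
        (continuousOn_fieldH (hG n).continuousOn_f (hG n).continuousOn_g)
    · intro n t ht
      exact (norm_cut_le _ _).trans (hC _ _ (hsb ((hG n).norm_le hR ht).1)
        (hsb ((hG n).norm_le hR ht).2)).1
    · intro t ht
      exact ((mulL damp).continuous.tendsto _).comp (hF t ht)
    · intro t ht
      exact tendsto_mulL_cut_succ (tendsto_fieldH (hF t ht) (hGl t ht))
    · exact continuousOn_fieldH hFc hGc
  · refine hasDerivWithinAt_of_tendsto (x := fun n t => mulL damp (P.smooth (g n t)))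
      (y := fun n t => mulL (cut (n + 1 : ℕ)) (P.fieldW ε (P.smooth (f n t)) (P.smooth (g n t))))
      (C := C) ?_ ?_ ?_ ?_ ?_ ?_
    · intro n t ht
      have := ((mulL damp).comp P.smooth).hasFDerivAt.comp_hasDerivWithinAt t ((hG n).deriv_g t ht)
      rw [((hG n).field_eq ht).1, ((hG n).field_eq ht).2] at this
      exact this.congr_deriv (damp_smooth_undamp _ _)
    · intro n
      exact (mulL (cut (n + 1 : ℕ))).continuous.comp_continuousOn
        (continuousOn_fieldW (hG n).continuousOn_f (hG n).continuousOn_g)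
    · intro n t ht
      exact (norm_cut_le _ _).trans (hC _ _ (hsb ((hG n).norm_le hR ht).1)
        (hsb ((hG n).norm_le hR ht).2)).2
    · intro t ht
      exact ((mulL damp).continuous.tendsto _).comp (hGl t ht)
    · intro t ht
      exact tendsto_mulL_cut_succ (tendsto_fieldW (hF t ht) (hGl t ht))
    · exact continuousOn_fieldW hFc hGc

/-- The Fourier form of the system has solutions that are bounded in `H^s` and continuous with
values in `H^s`, on the long time interval. -/
theorem exists_fourierSolution (hε : 0 < ε) (hε1 : ε ≤ 1) {R S : ℝ} (hR : 0 < R)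
    (hS : 0 ≤ S) (hT : 4 * (P.energyConst * Real.sqrt ε) * R * S ≤ Real.log 4) {f₀ g₀ : H}
    (hf₀ : reflect f₀ = f₀) (hg₀ : reflect g₀ = g₀) (hfg : ‖f₀‖ ^ 2 + ‖g₀‖ ^ 2 ≤ R ^ 2) :
    ∃ F G : ℝ → H, F 0 = f₀ ∧ G 0 = g₀ ∧ ContinuousOn F (Set.Icc 0 S) ∧
      ContinuousOn G (Set.Icc 0 S) ∧
      (∀ t ∈ Set.Icc 0 S, ‖F t‖ ≤ 2 * R ∧ ‖G t‖ ≤ 2 * R) ∧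
      FourierSolution P ε S (2 * R) (fun t => P.smooth (F t)) (fun t => P.smooth (G t)) := by
  have hR2 : 0 ≤ 2 * R := by positivity
  have ex : ∀ n : ℕ, ∃ f g : ℝ → H, f 0 = mulL (cut (n + 1 : ℕ)) f₀ ∧
      g 0 = mulL (cut (n + 1 : ℕ)) g₀ ∧ Galerkin P ε S (2 * R) (n + 1 : ℕ) f g := by
    intro n
    obtain ⟨f, g, h1, h2, h3⟩ := exists_galerkin (P := P) hε hε1 (n := (n + 1 : ℕ))
      (Nat.cast_nonneg _) hR hS hT hf₀ hg₀ hfg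
    exact ⟨f, g, h1, h2, fun t ht => (h3 t ht).1, fun t ht => (h3 t ht).2.1,
      fun t ht => (h3 t ht).2.2.1, fun t ht => (h3 t ht).2.2.2.1, fun t ht => (h3 t ht).2.2.2.2.1,
      fun t ht => (h3 t ht).2.2.2.2.2.1, fun t ht => (h3 t ht).2.2.2.2.2.2⟩
  choose f g hf0 hg0 hG using ex
  have h0S : (0:ℝ) ∈ Set.Icc 0 S := ⟨le_rfl, hS⟩
  -- the approximations are uniformly Cauchy in `L²`
  let K : ℝ := 2 * (Real.exp (P.diffConst (2 * R) * S) * (P.diffConst (2 * R) * S)) +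
    16 * (2 * R) ^ 2
  let β : ℕ → ℝ := fun N => Real.sqrt (K * ((N + 1 : ℕ) : ℝ) ^ (1 - P.s))
  have hβ : Tendsto β atTop (𝓝 0) := by
    have := ((tendsto_natCast_rpow (P := P)).const_mul K).sqrt
    rwa [mul_zero, Real.sqrt_zero] at this
  have hle : ∀ {a b : ℕ}, a ≤ b → ((a + 1 : ℕ) : ℝ) ≤ ((b + 1 : ℕ) : ℝ) := by
    intro a b hab
    exact_mod_cast Nat.succ_le_succ hab
  -- The truncated initial data of two levels agree below the lower level, so the stability estimate
  -- starts from zero.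
  have hinit : ∀ {a b : ℕ} (x : H), a ≤ b → mulL (cut (a + 1 : ℕ)) (P.smooth
      (mulL (cut (b + 1 : ℕ)) x)) = mulL (cut (a + 1 : ℕ)) (P.smooth x) := by
    intro a b x hab
    have hm := isMultiplier_smooth (P := P)
    rw [mulL_mulL hm (isMultiplier_cut _), mulL_mulL (isMultiplier_cut _)
      (hm.mul (isMultiplier_cut _)), mulL_mulL (isMultiplier_cut _) hm]
    refine mulL_congr (fun ξ => ?_) x
    linear_combination jap ξ ^ (-P.s) * cut_mul_cut (hle hab) ξ
  have hdist : ∀ n m N : ℕ, N ≤ n → N ≤ m → ∀ t ∈ Set.Icc 0 S,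
      dist (P.smooth (f n t)) (P.smooth (f m t)) ≤ β N ∧
        dist (P.smooth (g n t)) (P.smooth (g m t)) ≤ β N := by
    intro n m N hn hm t ht
    have h := norm_sub_sq_le hε hε1 (n := (N + 1 : ℕ)) (by exact_mod_cast Nat.le_add_left 1 N) hR2
      ((hG n).cutSolution hR2 (hle hn)) ((hG m).cutSolution hR2 (hle hm))
      (by simp only [hf0]; rw [hinit _ hn, hinit _ hm])
      (by simp only [hg0]; rw [hinit _ hn, hinit _ hm]) ht
    constructor
    · rw [dist_eq_norm]
      exact Real.le_sqrt_of_sq_le (by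
        nlinarith [sq_nonneg ‖P.smooth (g n t) - P.smooth (g m t)‖])
    · rw [dist_eq_norm]
      exact Real.le_sqrt_of_sq_le (by
        nlinarith [sq_nonneg ‖P.smooth (f n t) - P.smooth (f m t)‖])
  have exlim : ∀ t : ℝ, ∃ x y : H, t ∈ Set.Icc 0 S →
      Tendsto (fun n => P.smooth (f n t)) atTop (𝓝 x) ∧
      Tendsto (fun n => P.smooth (g n t)) atTop (𝓝 y) := by
    intro t
    by_cases ht : t ∈ Set.Icc 0 S
    · obtain ⟨x, hx⟩ := cauchySeq_tendsto_of_complete (cauchySeq_of_le_tendsto_0 β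
        (fun n m N hn hm => (hdist n m N hn hm t ht).1) hβ)
      obtain ⟨y, hy⟩ := cauchySeq_tendsto_of_complete (cauchySeq_of_le_tendsto_0 β
        (fun n m N hn hm => (hdist n m N hn hm t ht).2) hβ)
      exact ⟨x, y, fun _ => ⟨hx, hy⟩⟩
    · exact ⟨0, 0, fun h => absurd h ht⟩
  choose h w hlim using exlim
  -- the limits are bounded in `H^s`
  have hcap : ∀ N : ℕ, IsMultiplier (capJap P.s N) := fun N => isMultiplier_capJap _ N.cast_nonneg
  have hcapb : ∀ (N : ℕ) (x : H), ‖mulL (capJap P.s N) (P.smooth x)‖ ≤ ‖x‖ := by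
    intro N x
    rw [mulL_mulL (hcap N) isMultiplier_smooth]
    simpa using norm_mulL_le ((hcap N).mul isMultiplier_smooth) (abs_capJap_smooth_le N) x
  have exrep : ∀ t : ℝ, ∃ x y : H, t ∈ Set.Icc 0 S → P.smooth x = h t ∧ P.smooth y = w t ∧
      ‖x‖ ≤ 2 * R ∧ ‖y‖ ≤ 2 * R := by
    intro t
    by_cases ht : t ∈ Set.Icc 0 S
    · obtain ⟨x, hx, hx'⟩ := exists_smooth_eq (P := P) (x := h t) hR2 (fun N =>
        le_of_tendsto (((mulL (capJap P.s N)).continuous.tendsto _).comp (hlim t ht).1).norm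
          (Eventually.of_forall fun n => (hcapb N _).trans ((hG n).norm_le hR2 ht).1))
      obtain ⟨y, hy, hy'⟩ := exists_smooth_eq (P := P) (x := w t) hR2 (fun N =>
        le_of_tendsto (((mulL (capJap P.s N)).continuous.tendsto _).comp (hlim t ht).2).norm
          (Eventually.of_forall fun n => (hcapb N _).trans ((hG n).norm_le hR2 ht).2))
      exact ⟨x, y, fun _ => ⟨hx, hy, hx', hy'⟩⟩
    · exact ⟨0, 0, fun h => absurd h ht⟩
  choose F G hFG using exrep
  have hF : ∀ t ∈ Set.Icc 0 S, Tendsto (fun n => P.smooth (f n t)) atTop (𝓝 (P.smooth (F t))) :=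
    fun t ht => by rw [(hFG t ht).1]; exact (hlim t ht).1
  have hGl : ∀ t ∈ Set.Icc 0 S, Tendsto (fun n => P.smooth (g n t)) atTop (𝓝 (P.smooth (G t))) :=
    fun t ht => by rw [(hFG t ht).2.1]; exact (hlim t ht).2
  have hFb : ∀ t ∈ Set.Icc 0 S, ‖F t‖ ≤ 2 * R := fun t ht => (hFG t ht).2.2.1
  have hGb : ∀ t ∈ Set.Icc 0 S, ‖G t‖ ≤ 2 * R := fun t ht => (hFG t ht).2.2.2
  have hFr : ∀ t ∈ Set.Icc 0 S, reflect (F t) = F t := fun t ht => reflect_of_smooth (P := P)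
    (tendsto_nhds_unique (((reflect.continuous.tendsto _).comp (hF t ht)).congr fun n => by
      rw [Function.comp, reflect_smooth, (hG n).reflect_f t ht]) (hF t ht))
  have hGr : ∀ t ∈ Set.Icc 0 S, reflect (G t) = G t := fun t ht => reflect_of_smooth (P := P)
    (tendsto_nhds_unique (((reflect.continuous.tendsto _).comp (hGl t ht)).congr fun n => by
      rw [Function.comp, reflect_smooth, (hG n).reflect_g t ht]) (hGl t ht))
  -- continuity in `L²`
  have cont : ∀ (u : ℕ → ℝ → H) (v : ℝ → H), (∀ n, ContinuousOn (u n) (Set.Icc 0 S)) →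
      (∀ t ∈ Set.Icc 0 S, Tendsto (fun n => u n t) atTop (𝓝 (v t))) →
      (∀ n m N : ℕ, N ≤ n → N ≤ m → ∀ t ∈ Set.Icc 0 S, dist (u n t) (u m t) ≤ β N) →
      ContinuousOn v (Set.Icc 0 S) := by
    intro u v hu huv hd
    have hunif : TendstoUniformlyOn u v atTop (Set.Icc 0 S) := by
      rw [Metric.tendstoUniformlyOn_iff]
      intro δ hδ
      filter_upwards [hβ.eventually (gt_mem_nhds hδ)] with n hn t ht
      refine lt_of_le_of_lt ?_ hn
      rw [dist_comm]
      refine le_of_tendsto (tendsto_const_nhds.dist (huv t ht)) ?_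
      filter_upwards [eventually_ge_atTop n] with m hm
      exact hd n m n le_rfl hm t ht
    exact hunif.continuousOn (Frequently.of_forall hu)
  have hfc := fun n => (hG n).continuousOn_f
  have hgc := fun n => (hG n).continuousOn_g
  have hFc := cont (fun n t => P.smooth (f n t)) (fun t => P.smooth (F t)) hfc hF
    (fun n m N hn hm t ht => (hdist n m N hn hm t ht).1)
  have hGc := cont (fun n t => P.smooth (g n t)) (fun t => P.smooth (G t)) hgc hGl
    (fun n m N hn hm t ht => (hdist n m N hn hm t ht).2)
  -- the energy is Lipschitz in time
  set Λ := 2 * (P.energyConst * Real.sqrt ε * (2 * R) ^ 3)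
  have hlip : ∀ t ∈ Set.Icc 0 S, ∀ τ ∈ Set.Icc 0 S,
      |(‖F τ‖ ^ 2 + ‖G τ‖ ^ 2) - (‖F t‖ ^ 2 + ‖G t‖ ^ 2)| ≤ Λ * |τ - t| := by
    intro t ht τ hτ
    have e1 : ∀ N : ℕ, ∀ r ∈ Set.Icc 0 S, Tendsto (fun n =>
        ‖mulL (capJap P.s N) (P.smooth (f n r))‖ ^ 2 +
          ‖mulL (capJap P.s N) (P.smooth (g n r))‖ ^ 2) atTop
        (𝓝 (‖mulL (capJap P.s N) (P.smooth (F r))‖ ^ 2 +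
          ‖mulL (capJap P.s N) (P.smooth (G r))‖ ^ 2)) := fun N r hr =>
      ((((mulL (capJap P.s N)).continuous.tendsto _).comp (hF r hr)).norm.pow 2).add
        ((((mulL (capJap P.s N)).continuous.tendsto _).comp (hGl r hr)).norm.pow 2)
    have e2 : ∀ N : ℕ, _ := fun N : ℕ => le_of_tendsto ((e1 N τ hτ).sub (e1 N t ht)).abs
      (Eventually.of_forall fun n => (hG n).abs_energy_sub_le hε hε1 hR2 (Nat.cast_nonneg _)
        N.cast_nonneg ht hτ)
    have e3 : ∀ r, Tendsto (fun N : ℕ => ‖mulL (capJap P.s N) (P.smooth (F r))‖ ^ 2 +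
          ‖mulL (capJap P.s N) (P.smooth (G r))‖ ^ 2) atTop (𝓝 (‖F r‖ ^ 2 + ‖G r‖ ^ 2)) :=
      fun r => ((tendsto_capJap_smooth (F r)).norm.pow 2).add
        ((tendsto_capJap_smooth (G r)).norm.pow 2)
    -- The order of the limits matters: the approximations are only known to converge after
    -- smoothing, so the level goes to infinity at fixed cap `N`, and `N` afterwards.
    exact le_of_tendsto ((e3 τ).sub (e3 t)).abs (Eventually.of_forall e2)
  have hE : ContinuousOn (fun τ => ‖F τ‖ ^ 2 + ‖G τ‖ ^ 2) (Set.Icc 0 S) := by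
    have hΛ : 0 ≤ Λ := by have := P.energyConst_nonneg; positivity
    refine (LipschitzOnWith.of_dist_le_mul (K := ⟨Λ, hΛ⟩) fun x hx y hy => ?_).continuousOn
    rw [Real.dist_eq, Real.dist_eq]
    exact hlip y hy x hx
  obtain ⟨cF, cG⟩ := continuousOn_of_norm_of_inner hE
    (fun t ht e => tendsto_inner_of_smooth hFb ht (hFc t ht) e)
    (fun t ht e => tendsto_inner_of_smooth hGb ht (hGc t ht) e)
  -- the equations
  obtain ⟨dH, dW⟩ := hasDerivWithinAt_damp_of_galerkin hε hR2 hG hF hGl hFc hGc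
  -- the initial data
  have init : ∀ x : H, Tendsto (fun n : ℕ => P.smooth (mulL (cut (n + 1 : ℕ)) x)) atTop
      (𝓝 (P.smooth x)) := fun x =>
    (P.smooth.continuous.tendsto _).comp (tendsto_mulL_cut_succ tendsto_const_nhds)
  refine ⟨F, G, smooth_injective (P := P) (tendsto_nhds_unique (hF 0 h0S) ?_),
    smooth_injective (P := P) (tendsto_nhds_unique (hGl 0 h0S) ?_), cF, cG,
    fun t ht => ⟨hFb t ht, hGb t ht⟩, fun t ht => ⟨F t, G t, hFr t ht, hGr t ht, rfl, rfl, hFb t ht,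
    hGb t ht⟩, dH, dW⟩
  · simp only [hf0]; exact init f₀
  · simp only [hg0]; exact init g₀

end Params

/-! ### Fourier transform of real functions and of test functions -/

/-- A real function of `L²` as a complex one. -/
def complexify : L2 →L[ℝ] H := Complex.ofRealCLM.compLpL 2 volume

theorem complexify_coe (u : L2) : complexify u =ᵐ[volume] fun x => ((u x : ℝ) : ℂ) :=
  Complex.ofRealCLM.coeFn_compLpL u

/-- Complex conjugation on `L²`. -/
def conjL : H →L[ℝ] H := (Complex.conjCLE : ℂ →L[ℝ] ℂ).compLpL 2 volume

theorem conjL_coe (f : H) : conjL f =ᵐ[volume] fun x => (starRingEnd ℂ) (f x) :=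
  (Complex.conjCLE : ℂ →L[ℝ] ℂ).coeFn_compLpL f

/-- The Fourier transform as a real-linear isometry. -/
def fourierIso : H →ₗᵢ[ℝ] H where
  toFun f := 𝓕 f
  map_add' f g := FourierTransform.fourier_add f g
  map_smul' c f := by
    have := (Lp.fourierTransformₗᵢ Plane ℂ).map_smul (c : ℂ) f
    exact this
  norm_map' f := Lp.norm_fourier_eq f

/-- `fourierL2` as a continuous linear map. -/
def fourierR : L2 →L[ℝ] H := fourierIso.toContinuousLinearMap.comp complexify

theorem fourierR_apply (u : L2) : fourierR u = fourierL2 u := rfl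

theorem norm_complexify (u : L2) : ‖complexify u‖ = ‖u‖ := by
  rw [Lp.norm_def, Lp.norm_def]
  congr 1
  apply eLpNorm_congr_norm_ae
  filter_upwards [complexify_coe u] with x hx
  rw [hx, Complex.norm_real]

theorem norm_fourierR (u : L2) : ‖fourierR u‖ = ‖u‖ := by
  rw [← norm_complexify u]
  exact fourierIso.norm_map _

theorem fourierR_injective {u v : L2} (h : fourierR u = fourierR v) : u = v := by
  rw [← sub_eq_zero, ← norm_eq_zero, ← norm_fourierR, map_sub, h, sub_self, norm_zero]

theorem inner_fourierR (u v : L2) : inner ℝ (fourierR u) (fourierR v) = ∫ x, u x * v x := by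
  have h : inner ℝ (fourierR u) (fourierR v) = inner ℝ (complexify u) (complexify v) :=
    fourierIso.inner_map_map _ _
  rw [h, inner_eq_integral]
  apply integral_congr_ae
  filter_upwards [complexify_coe u, complexify_coe v] with x h1 h2
  rw [h1, h2, Complex.conj_ofReal, ← Complex.ofReal_mul, Complex.ofReal_re]

theorem fourier_conj_apply (f : 𝓢(Plane, ℂ)) (ξ : Plane) :
    (𝓕 (SchwartzMap.postcompCLM (Complex.conjCLE : ℂ →L[ℝ] ℂ) f) : 𝓢(Plane, ℂ)) ξ =
      (starRingEnd ℂ) ((𝓕 f : 𝓢(Plane, ℂ)) (-ξ)) := by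
  rw [SchwartzMap.fourier_coe, SchwartzMap.fourier_coe, Real.fourier_eq', Real.fourier_eq',
    ← integral_conj]
  congr 1 with x
  rw [SchwartzMap.postcompCLM_apply]
  change _ * (starRingEnd ℂ) (f x) = (starRingEnd ℂ) (_ * f x)
  rw [map_mul, ← Complex.exp_conj]
  congr 2
  rw [map_mul, Complex.conj_I, Complex.conj_ofReal, inner_neg_right]
  push_cast
  ring

/-- Both sides are continuous in `f` and agree on Schwartz functions, which are dense. -/
theorem fourier_conjL (f : H) : 𝓕 (conjL f) = reflect (𝓕 f) := by
  have hc : Continuous fun f : H => 𝓕 (conjL f) := fourierIso.continuous.comp conjL.continuous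
  have hc' : Continuous fun f : H => reflect (𝓕 f) := reflect.continuous.comp fourierIso.continuous
  have hd := SchwartzMap.denseRange_toLpCLM (E := Plane) (F := ℂ) (p := 2)
    (μ := (volume : Measure Plane)) ENNReal.ofNat_ne_top
  refine congrFun (DenseRange.equalizer hd hc hc' ?_) f
  funext g
  simp only [Function.comp, SchwartzMap.toLpCLM_apply]
  have e : conjL (g.toLp 2 volume) =
      (SchwartzMap.postcompCLM (Complex.conjCLE : ℂ →L[ℝ] ℂ) g).toLp 2 volume := by
    apply Lp.ext
    filter_upwards [conjL_coe (g.toLp 2 volume), g.coeFn_toLp 2 volume,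
      (SchwartzMap.postcompCLM (Complex.conjCLE : ℂ →L[ℝ] ℂ) g).coeFn_toLp 2 volume] with x h1 h2 h3
    rw [h1, h2, h3]
    rfl
  rw [e, SchwartzMap.toLp_fourier_eq, SchwartzMap.toLp_fourier_eq]
  apply Lp.ext
  have h0 := (𝓕 g : 𝓢(Plane, ℂ)).coeFn_toLp 2 (volume : Measure Plane)
  filter_upwards [(𝓕 (SchwartzMap.postcompCLM (Complex.conjCLE : ℂ →L[ℝ] ℂ) g) :
    𝓢(Plane, ℂ)).coeFn_toLp 2 (volume : Measure Plane), reflect_coe ((𝓕 g : 𝓢(Plane, ℂ)).toLp 2 volume),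
    ae_comp_neg h0] with x h1 h2 h3
  rw [h1, h2, h3, fourier_conj_apply]

theorem conjL_complexify (u : L2) : conjL (complexify u) = complexify u := by
  apply Lp.ext
  filter_upwards [conjL_coe (complexify u), complexify_coe u] with x h1 h2
  rw [h1, h2, Complex.conj_ofReal]

theorem reflect_fourierR (u : L2) : reflect (fourierR u) = fourierR u := by
  change reflect (𝓕 (complexify u)) = 𝓕 (complexify u)
  rw [← fourier_conjL, conjL_complexify]

/-- Symmetric functions are Fourier transforms of real ones. -/
theorem exists_fourierR_eq {f : H} (hf : reflect f = f) : ∃ u : L2, fourierR u = f := by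
  set g : H := 𝓕⁻ f
  have hg : 𝓕 g = f := FourierTransform.fourier_fourierInv_eq f
  have hconj : conjL g = g := by
    apply fourierIso.injective
    change 𝓕 (conjL g) = 𝓕 g
    rw [fourier_conjL, hg, hf]
  refine ⟨Complex.reCLM.compLpL 2 volume g, ?_⟩
  have : complexify (Complex.reCLM.compLpL 2 volume g) = g := by
    apply Lp.ext
    have h3 : (conjL g : Plane → ℂ) =ᵐ[volume] g := by rw [hconj]
    filter_upwards [complexify_coe (Complex.reCLM.compLpL 2 volume g),
      Complex.reCLM.coeFn_compLpL g, conjL_coe g, h3] with x h1 h2 h4 h5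
    rw [h1, h2]
    rw [h4] at h5
    exact Complex.conj_eq_iff_re.1 h5
  change 𝓕 (complexify (Complex.reCLM.compLpL 2 volume g)) = f
  rw [this, hg]

/-- The Fourier transform of a real Schwartz function. -/
def hatS (φ : 𝓢(Plane, ℝ)) : 𝓢(Plane, ℂ) := 𝓕 (SchwartzMap.postcompCLM Complex.ofRealCLM φ)

/-- The Fourier transform of a real Schwartz function, in `L²`. -/
def hat (φ : 𝓢(Plane, ℝ)) : H := fourierR (φ.toLp 2 volume)

theorem hat_eq (φ : 𝓢(Plane, ℝ)) : hat φ = (hatS φ).toLp 2 volume := by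
  have e : complexify (φ.toLp 2 volume) =
      (SchwartzMap.postcompCLM Complex.ofRealCLM φ).toLp 2 volume := by
    apply Lp.ext
    filter_upwards [complexify_coe (φ.toLp 2 volume), φ.coeFn_toLp 2 volume,
      (SchwartzMap.postcompCLM Complex.ofRealCLM φ).coeFn_toLp 2 volume] with x h1 h2 h3
    rw [h1, h2, h3]
    rfl
  change 𝓕 (complexify (φ.toLp 2 volume)) = _
  rw [e, SchwartzMap.toLp_fourier_eq]
  rfl

theorem hat_coe (φ : 𝓢(Plane, ℝ)) : hat φ =ᵐ[volume] hatS φ := by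
  rw [hat_eq]
  exact (hatS φ).coeFn_toLp 2 volume

theorem integral_mul_eq_inner (u : L2) (φ : 𝓢(Plane, ℝ)) :
    ∫ x, u x * φ x = inner ℝ (fourierR u) (hat φ) := by
  rw [hat, inner_fourierR]
  apply integral_congr_ae
  filter_upwards [φ.coeFn_toLp 2 volume] with x hx
  rw [hx]

theorem hatS_pd (j : Fin 2) (φ : 𝓢(Plane, ℝ)) (ξ : Plane) :
    hatS (pd j φ) ξ = 2 * Real.pi * Complex.I * (ξ j : ℂ) * hatS φ ξ := by
  have e : SchwartzMap.postcompCLM Complex.ofRealCLM (pd j φ) =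
      ∂_{(EuclideanSpace.single j (1 : ℝ) : Plane)} (SchwartzMap.postcompCLM Complex.ofRealCLM φ) := by
    ext x
    rw [SchwartzMap.postcompCLM_apply, pd, SchwartzMap.lineDerivOp_apply_eq_fderiv,
      SchwartzMap.lineDerivOp_apply_eq_fderiv]
    have h : HasFDerivAt (SchwartzMap.postcompCLM Complex.ofRealCLM φ)
        (Complex.ofRealCLM.comp (fderiv ℝ φ x)) x :=
      Complex.ofRealCLM.hasFDerivAt.comp x φ.differentiableAt.hasFDerivAt
    rw [h.fderiv]
    rfl
  rw [hatS, e, SchwartzMap.fourier_lineDerivOp_eq]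
  have ht : (inner ℝ · (EuclideanSpace.single j (1 : ℝ) : Plane)).HasTemperateGrowth :=
    ((innerSL ℝ).flip (EuclideanSpace.single j (1 : ℝ) : Plane)).hasTemperateGrowth
  rw [smul_apply, SchwartzMap.smulLeftCLM_apply_apply ht, hatS,
    EuclideanSpace.inner_single_right]
  simp only [one_mul, conj_trivial, smul_eq_mul, Complex.real_smul]
  ring

theorem laplacian_eq (φ : 𝓢(Plane, ℝ)) : Δ φ = pd 0 (pd 0 φ) + pd 1 (pd 1 φ) := by
  rw [SchwartzMap.laplacian_eq_sum (EuclideanSpace.basisFun (Fin 2) ℝ), Fin.sum_univ_two]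
  simp [pd]

theorem hatS_add (φ ψ : 𝓢(Plane, ℝ)) (ξ : Plane) : hatS (φ + ψ) ξ = hatS φ ξ + hatS ψ ξ := by
  rw [hatS, map_add, FourierTransform.fourier_add]
  rfl

theorem hatS_smul (c : ℝ) (φ : 𝓢(Plane, ℝ)) (ξ : Plane) : hatS (c • φ) ξ = c * hatS φ ξ := by
  have e : SchwartzMap.postcompCLM Complex.ofRealCLM (c • φ) =
      (c : ℂ) • SchwartzMap.postcompCLM Complex.ofRealCLM φ := by
    ext x
    simp
  rw [hatS, e, FourierTransform.fourier_smul]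
  rfl

theorem freq_sq (ξ : Plane) : freq ξ ^ 2 = (2 * Real.pi) ^ 2 * (ξ 0 ^ 2 + ξ 1 ^ 2) := by
  rw [freq, mul_pow, EuclideanSpace.norm_sq_eq, Fin.sum_univ_two]
  simp

theorem hatS_laplacian (φ : 𝓢(Plane, ℝ)) (ξ : Plane) :
    hatS (Δ φ) ξ = -((freq ξ ^ 2 : ℝ) : ℂ) * hatS φ ξ := by
  rw [laplacian_eq, hatS_add, hatS_pd, hatS_pd, hatS_pd, hatS_pd, freq_sq]
  push_cast
  linear_combination (2 * Real.pi) ^ 2 * ((ξ 0 : ℂ) ^ 2 + (ξ 1 : ℂ) ^ 2) * hatS φ ξ * Complex.I_sq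

/-- On the Fourier side the derivatives are multiplications, which commute. -/
theorem pd_comm (i j : Fin 2) (φ : 𝓢(Plane, ℝ)) : pd i (pd j φ) = pd j (pd i φ) := by
  apply SchwartzMap.injective_toLp 2 (volume : Measure Plane)
  apply fourierR_injective
  change hat _ = hat _
  apply Lp.ext
  filter_upwards [hat_coe (pd i (pd j φ)), hat_coe (pd j (pd i φ))] with ξ h1 h2
  rw [h1, h2, hatS_pd, hatS_pd, hatS_pd, hatS_pd]
  ring

/-- `(1 - Δ)² φ`. -/
def quartic (φ : 𝓢(Plane, ℝ)) : 𝓢(Plane, ℝ) := φ + (-2 : ℝ) • Δ φ + Δ (Δ φ)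

theorem hatS_quartic (φ : 𝓢(Plane, ℝ)) (ξ : Plane) :
    hatS (quartic φ) ξ = ((jap ξ ^ 4 : ℝ) : ℂ) * hatS φ ξ := by
  rw [quartic, hatS_add, hatS_add, hatS_smul, hatS_laplacian (Δ φ), hatS_laplacian φ]
  rw [show jap ξ ^ 4 = (jap ξ ^ 2) ^ 2 by ring, jap_sq]
  push_cast
  ring

/-- The transfer between the two formulations: the damping on the equations is compensated by (1-Δ)²
on the test function. -/
theorem mulL_damp_hat_quartic (φ : 𝓢(Plane, ℝ)) : mulL damp (hat (quartic φ)) = hat φ := by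
  apply Lp.ext
  filter_upwards [mulL_coe isMultiplier_damp (hat (quartic φ)), hat_coe (quartic φ), hat_coe φ]
    with ξ h1 h2 h3
  rw [h1, h2, h3, hatS_quartic, ← mul_assoc, ← Complex.ofReal_mul, damp_mul_jap_pow,
    Complex.ofReal_one, one_mul]

theorem isMultiplier_schwartz (φ : 𝓢(Plane, ℝ)) : IsMultiplier φ :=
  ⟨φ.continuous.measurable, SchwartzMap.seminorm ℝ 0 0 φ, fun x => SchwartzMap.norm_le_seminorm ℝ φ x⟩

theorem isConvKernel_damp : IsConvKernel fun ξ _ => damp ξ :=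
  ⟨measurable_damp.comp measurable_fst, damp, isWeight_jap (by norm_num), fun ξ _ => by
    rw [abs_of_pos (damp_pos ξ)]⟩

theorem fourier_fourier_apply (f : 𝓢(Plane, ℂ)) (x : Plane) :
    (𝓕 (𝓕 f : 𝓢(Plane, ℂ)) : 𝓢(Plane, ℂ)) x = f (-x) := by
  have h : (𝓕⁻ (𝓕 f : 𝓢(Plane, ℂ)) : 𝓢(Plane, ℂ)) = f := FourierTransform.fourierInv_fourier_eq f
  conv_rhs => rw [← h, SchwartzMap.fourierInv_apply_eq]
  simp

/-- The Fourier transform of a product of Schwartz functions is a convolution. -/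
theorem fourier_mul_eq_convolution (F G : 𝓢(Plane, ℂ)) :
    (𝓕 (SchwartzMap.pairing (ContinuousLinearMap.mul ℂ ℂ) F G) : 𝓢(Plane, ℂ)) =
      SchwartzMap.convolution (ContinuousLinearMap.mul ℂ ℂ) (𝓕 F : 𝓢(Plane, ℂ))
        (𝓕 G : 𝓢(Plane, ℂ)) := by
  -- One more Fourier transform is applied to both sides. The transform of a convolution is known,
  -- and the transform applied twice is the reflection.
  have hinj : Function.Injective fun f : 𝓢(Plane, ℂ) => (𝓕 f : 𝓢(Plane, ℂ)) :=
    Function.LeftInverse.injective (g := fun f : 𝓢(Plane, ℂ) => (𝓕⁻ f : 𝓢(Plane, ℂ)))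
      FourierTransform.fourierInv_fourier_eq
  apply hinj
  dsimp only
  rw [SchwartzMap.fourier_convolution]
  ext x
  rw [fourier_fourier_apply, SchwartzMap.pairing_apply_apply, SchwartzMap.pairing_apply_apply,
    fourier_fourier_apply, fourier_fourier_apply]

/-- The product of real Schwartz functions. -/
def mulS (f g : 𝓢(Plane, ℝ)) : 𝓢(Plane, ℝ) :=
  SchwartzMap.pairing (ContinuousLinearMap.mul ℝ ℝ) f g

theorem mulS_apply (f g : 𝓢(Plane, ℝ)) (x : Plane) : mulS f g x = f x * g x := rfl

theorem hatS_mulS (f g : 𝓢(Plane, ℝ)) (ξ : Plane) :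
    hatS (mulS f g) ξ = ∫ ζ, hatS f (ξ - ζ) * hatS g ζ := by
  have e : SchwartzMap.postcompCLM Complex.ofRealCLM (mulS f g) =
      SchwartzMap.pairing (ContinuousLinearMap.mul ℂ ℂ)
        (SchwartzMap.postcompCLM Complex.ofRealCLM g)
        (SchwartzMap.postcompCLM Complex.ofRealCLM f) := by
    ext x
    simp [mulS_apply, mul_comm]
  rw [hatS, e, fourier_mul_eq_convolution, SchwartzMap.convolution_apply]
  change ∫ ζ, hatS g ζ * hatS f (ξ - ζ) = _
  congr 1 with ζ
  ring

theorem conv_damp_hat (f g : 𝓢(Plane, ℝ)) :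
    conv (fun ξ _ => damp ξ) (hat f) (hat g) = mulL damp (hat (mulS f g)) := by
  apply Lp.ext
  filter_upwards [conv_coe isConvKernel_damp (hat f) (hat g),
    mulL_coe isMultiplier_damp (hat (mulS f g)), hat_coe (mulS f g)] with ξ h1 h2 h3
  rw [h1, h2, h3, hatS_mulS, convFun_congr_left _ (hat_coe f), convFun_congr_right _ _ (hat_coe g),
    convFun, integral_const_mul]

theorem integral_mul_mul_eq (u v : L2) (φ : 𝓢(Plane, ℝ)) : ∫ x, u x * v x * φ x =
    inner ℝ (mulL φ (complexify u)) (complexify v) := by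
  rw [inner_eq_integral]
  apply integral_congr_ae
  filter_upwards [mulL_coe (isMultiplier_schwartz φ) (complexify u), complexify_coe u,
    complexify_coe v] with x h1 h2 h3
  rw [h1, h2, h3, Complex.conj_ofReal, ← Complex.ofReal_mul, ← Complex.ofReal_mul,
    Complex.ofReal_re]
  ring

/-- The integral of a product against a test function, in Fourier variables. -/
theorem integral_mul_mul (u v : L2) (φ : 𝓢(Plane, ℝ)) : ∫ x, u x * v x * φ x =
    inner ℝ (conv (fun ξ _ => damp ξ) (fourierR u) (fourierR v)) (hat (quartic φ)) := by
  rw [integral_mul_mul_eq]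
  have hd := SchwartzMap.denseRange_toLpCLM (E := Plane) (F := ℝ) (p := 2)
    (μ := (volume : Measure Plane)) ENNReal.ofNat_ne_top
  -- For Schwartz functions this is the convolution theorem. It extends by density in one factor at
  -- a time; the damping keeps the right side continuous on L², although the product of two L²
  -- functions is only integrable.
  have step1 : ∀ f g : 𝓢(Plane, ℝ), inner ℝ (mulL φ (complexify (f.toLp 2 volume)))
      (complexify (g.toLp 2 volume)) = inner ℝ (conv (fun ξ _ => damp ξ)
        (fourierR (f.toLp 2 volume)) (fourierR (g.toLp 2 volume))) (hat (quartic φ)) := by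
    intro f g
    change _ = inner ℝ (conv (fun ξ _ => damp ξ) (hat f) (hat g)) (hat (quartic φ))
    rw [← integral_mul_mul_eq, conv_damp_hat, inner_mulL isMultiplier_damp, mulL_damp_hat_quartic,
      hat, ← integral_mul_eq_inner]
    apply integral_congr_ae
    filter_upwards [f.coeFn_toLp 2 volume, g.coeFn_toLp 2 volume,
      (mulS f g).coeFn_toLp 2 volume] with x h1 h2 h3
    rw [h1, h2, h3, mulS_apply]
  have step2 : ∀ (u : L2) (g : 𝓢(Plane, ℝ)), inner ℝ (mulL φ (complexify u))
      (complexify (g.toLp 2 volume)) = inner ℝ (conv (fun ξ _ => damp ξ)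
        (fourierR u) (fourierR (g.toLp 2 volume))) (hat (quartic φ)) := by
    intro u g
    have c1 : Continuous fun u => inner ℝ (mulL φ (complexify u)) (complexify (g.toLp 2 volume)) :=
      ((mulL φ).continuous.comp complexify.continuous).inner continuous_const
    have c2 : Continuous fun u => inner ℝ (conv (fun ξ _ => damp ξ) (fourierR u)
        (fourierR (g.toLp 2 volume))) (hat (quartic φ)) :=
      (((conv fun ξ _ => damp ξ).flip (fourierR (g.toLp 2 volume))).continuous.comp
        fourierR.continuous).inner continuous_const
    exact congrFun (DenseRange.equalizer hd c1 c2 (funext fun f => step1 f g)) u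
  have c1 : Continuous fun v => inner ℝ (mulL φ (complexify u)) (complexify v) :=
    continuous_const.inner complexify.continuous
  have c2 : Continuous fun v => inner ℝ (conv (fun ξ _ => damp ξ) (fourierR u)
      (fourierR v)) (hat (quartic φ)) :=
    (((conv fun ξ _ => damp ξ) (fourierR u)).continuous.comp
      fourierR.continuous).inner continuous_const
  exact congrFun (DenseRange.equalizer hd c1 c2 (funext fun g => step2 u g)) v

/-- The Fourier transform of the real part of the inverse Fourier transform. -/
theorem hatS_re_fourierInv (ψ : 𝓢(Plane, ℂ)) (ξ : Plane) :
    hatS (SchwartzMap.postcompCLM Complex.reCLM (𝓕⁻ ψ : 𝓢(Plane, ℂ))) ξ =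
      1 / 2 * (ψ ξ + (starRingEnd ℂ) (ψ (-ξ))) := by
  set F : 𝓢(Plane, ℂ) := 𝓕⁻ ψ with hF
  have h : (𝓕 F : 𝓢(Plane, ℂ)) = ψ := FourierTransform.fourier_fourierInv_eq ψ
  have e : SchwartzMap.postcompCLM Complex.ofRealCLM (SchwartzMap.postcompCLM Complex.reCLM F) =
      (1 / 2 : ℂ) • (F + SchwartzMap.postcompCLM (Complex.conjCLE : ℂ →L[ℝ] ℂ) F) := by
    ext x
    have := Complex.add_conj (F x)
    simp only [SchwartzMap.postcompCLM_apply, smul_apply, add_apply, smul_eq_mul]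
    change ((F x).re : ℂ) = 1 / 2 * (F x + (starRingEnd ℂ) (F x))
    rw [this]
    push_cast
    ring
  rw [hatS, e, FourierTransform.fourier_smul, FourierTransform.fourier_add, h]
  simp only [smul_apply, add_apply, smul_eq_mul, fourier_conj_apply, h]

/-- Symmetric functions that vanish against Fourier transforms of real test functions vanish. -/
theorem eq_zero_of_integral_hatS {X : H} (hX : reflect X = X) {q : Plane → ℝ} (hq : Continuous q)
    (hqe : ∀ ξ, q (-ξ) = q ξ) (hq0 : ∀ ξ, ξ ≠ 0 → q ξ ≠ 0)
    (h : ∀ φ, ∫ ξ, (X ξ * (starRingEnd ℂ) ((q ξ : ℂ) * hatS φ ξ)).re = 0) : X = 0 := by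
  have hY : LocallyIntegrable (fun ξ => (q ξ : ℂ) * X ξ) volume := by
    have h1 : LocallyIntegrable X volume := (Lp.memLp X).locallyIntegrable (by norm_num)
    exact h1.continuous_mul (Complex.continuous_ofReal.comp hq)
  have key : ∀ ψ : 𝓢(Plane, ℂ), HasCompactSupport ψ →
      ∫ ξ, (((q ξ : ℂ) * X ξ) * (starRingEnd ℂ) (ψ ξ)).re = 0 := by
    intro ψ hψ
    have hψ' : HasCompactSupport fun ξ => (starRingEnd ℂ) (ψ ξ) :=
      hψ.comp_left (map_zero (starRingEnd ℂ))
    have hi : Integrable fun ξ => ((q ξ : ℂ) * X ξ) * (starRingEnd ℂ) (ψ ξ) :=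
      hY.integrable_smul_right_of_hasCompactSupport
        (Complex.continuous_conj.comp ψ.continuous) hψ'
    have hir : Integrable fun ξ => (((q ξ : ℂ) * X ξ) * (starRingEnd ℂ) (ψ ξ)).re := hi.re
    -- The real part of the inverse transform of `ψ` is an admissible test function, with transform
    -- the Hermitian part of `ψ`. As `X` is Hermitian and `q` even, passing to the Hermitian part
    -- loses nothing.
    have h2 := h (SchwartzMap.postcompCLM Complex.reCLM (𝓕⁻ ψ : 𝓢(Plane, ℂ)))
    have e1 : ∀ᵐ ξ : Plane, (X ξ * (starRingEnd ℂ) ((q ξ : ℂ) *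
        hatS (SchwartzMap.postcompCLM Complex.reCLM (𝓕⁻ ψ : 𝓢(Plane, ℂ))) ξ)).re =
        1 / 2 * (((q ξ : ℂ) * X ξ) * (starRingEnd ℂ) (ψ ξ)).re +
          1 / 2 * (((q (-ξ) : ℂ) * X (-ξ)) * (starRingEnd ℂ) (ψ (-ξ))).re := by
      filter_upwards [(reflect_eq_iff X).1 hX] with ξ hξ
      rw [hatS_re_fourierInv, hqe, hξ]
      simp
      ring
    rw [integral_congr_ae e1, integral_add (hir.const_mul _) (hir.comp_neg.const_mul _),
      integral_const_mul, integral_const_mul,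
      integral_neg_eq_self (fun ξ => (((q ξ : ℂ) * X ξ) * (starRingEnd ℂ) (ψ ξ)).re)] at h2
    linarith
  have hz : ∀ᵐ ξ : Plane, (q ξ : ℂ) * X ξ = 0 := by
    apply ae_eq_zero_of_integral_contDiff_smul_eq_zero hY
    intro g hg hgc
    have hg' : ContDiff ℝ ((⊤ : ℕ∞) : WithTop ℕ∞) fun ξ => (g ξ : ℂ) := Complex.ofRealCLM.contDiff.comp hg
    have hgc' : HasCompactSupport fun ξ => (g ξ : ℂ) :=
      hgc.comp_left (g := fun x : ℝ => (x : ℂ)) Complex.ofReal_zero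
    have hi : Integrable fun ξ => g ξ • ((q ξ : ℂ) * X ξ) :=
      hY.integrable_smul_left_of_hasCompactSupport hg.continuous hgc
    have hgI : ContDiff ℝ ((⊤ : ℕ∞) : WithTop ℕ∞) fun ξ => Complex.I * (g ξ : ℂ) := contDiff_const.mul hg'
    have hgcI : HasCompactSupport fun ξ => Complex.I * (g ξ : ℂ) := hgc'.mul_left
    -- Testing with `g` and with `I g` recovers the real and the imaginary part.
    have k1 := key (hgc'.toSchwartzMap hg') hgc'
    have k2 := key (hgcI.toSchwartzMap hgI) hgcI
    apply Complex.ext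
    · have := integral_re hi
      simp only [RCLike.re_eq_complex_re] at this
      rw [← this, Complex.zero_re, ← k1]
      congr 1 with ξ
      change _ = (((q ξ : ℂ) * X ξ) * (starRingEnd ℂ) (g ξ : ℂ)).re
      rw [Complex.conj_ofReal, Complex.real_smul]
      congr 1
      ring
    · have := integral_im hi
      simp only [RCLike.im_eq_complex_im] at this
      rw [← this, Complex.zero_im, ← k2]
      congr 1 with ξ
      change _ = (((q ξ : ℂ) * X ξ) * (starRingEnd ℂ) (Complex.I * (g ξ : ℂ))).re
      rw [map_mul, Complex.conj_ofReal, Complex.conj_I, Complex.real_smul]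
      simp
      ring
  apply Lp.ext
  have h0 : ∀ᵐ ξ : Plane, ξ ≠ 0 := by
    simp [ae_iff]
  filter_upwards [hz, h0, Lp.coeFn_zero ℂ 2 (volume : Measure Plane)] with ξ h1 h2 h3
  rw [h3, Pi.zero_apply]
  exact (mul_eq_zero.1 h1).resolve_left (Complex.ofReal_ne_zero.2 (hq0 ξ h2))

/-! ### Translation of the weak formulation into Fourier variables -/

/-- The components of `ξ / ‖ξ‖`. -/
def rho (j : Fin 2) (ξ : Plane) : ℝ := ξ j / ‖ξ‖

theorem measurable_rho (j : Fin 2) : Measurable (rho j) := by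
  unfold rho
  fun_prop

theorem isMultiplier_rho (j : Fin 2) : IsMultiplier (rho j) := by
  refine ⟨measurable_rho j, 1, fun ξ => ?_⟩
  rw [rho, abs_div, abs_norm]
  exact div_le_one_of_le₀ (PiLp.norm_apply_le ξ j) (norm_nonneg _)

theorem rho_neg (j : Fin 2) (ξ : Plane) : rho j (-ξ) = -rho j ξ := by
  simp [rho, neg_div]

theorem two_pi_mul_eq (j : Fin 2) (ξ : Plane) : 2 * Real.pi * ξ j = freq ξ * rho j ξ := by
  by_cases h : ξ = 0
  · simp [h, freq]
  · have := norm_ne_zero_iff.2 h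
    rw [freq, rho]
    field_simp

theorem inner_eq_sum (ξ ζ : Plane) : inner ℝ ξ ζ = ξ 0 * ζ 0 + ξ 1 * ζ 1 := by
  rw [PiLp.inner_apply, Fin.sum_univ_two]
  simp [mul_comm]

theorem rho_mul_rho_add (ξ ζ : Plane) : rho 0 ξ * rho 0 ζ + rho 1 ξ * rho 1 ζ = cosine ξ ζ := by
  rw [cosine, inner_eq_sum, rho, rho, rho, rho]
  ring

theorem rho_sq_add {ξ : Plane} (h : ξ ≠ 0) : rho 0 ξ ^ 2 + rho 1 ξ ^ 2 = 1 := by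
  have := norm_ne_zero_iff.2 h
  have h2 : ‖ξ‖ ^ 2 = ξ 0 ^ 2 + ξ 1 ^ 2 := by
    rw [EuclideanSpace.norm_sq_eq, Fin.sum_univ_two]; simp
  rw [rho, rho]
  field_simp
  exact h2.symm

/-- At the origin, where `rho` takes the value zero, the factor `freq` vanishes too, so no exception
is needed. -/
theorem freq_mul_rho_sq_add (ξ : Plane) :
    freq ξ * (rho 0 ξ ^ 2 + rho 1 ξ ^ 2) = freq ξ := by
  by_cases h : ξ = 0
  · simp [h, freq]
  · rw [rho_sq_add h, mul_one]

theorem coe_smul_I (f : H) : (Complex.I • f : H) =ᵐ[volume] fun x => Complex.I * f x := by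
  filter_upwards [Lp.coeFn_smul Complex.I f] with x hx
  rw [hx]
  rfl

theorem integrable_mul_mul (u v : L2) (φ : 𝓢(Plane, ℝ)) : Integrable fun x => u x * v x * φ x := by
  have h : Integrable fun x => u x * v x := (Lp.memLp u).integrable_mul (Lp.memLp v)
  exact h.mul_bdd φ.continuous.aestronglyMeasurable
    (ae_of_all _ fun x => SchwartzMap.norm_le_seminorm ℝ φ x)

theorem integrable_mul_schwartz (u : L2) (φ : 𝓢(Plane, ℝ)) : Integrable fun x => u x * φ x :=
  (Lp.memLp u).integrable_mul (φ.memLp 2 volume)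

namespace Params

variable {P : Params} {ε : ℝ}

theorem isMultiplier_inv_symM (hε : 0 < ε) : IsMultiplier fun ξ => (P.symM ε ξ)⁻¹ := by
  refine ⟨measurable_symM.inv, (Real.sqrt P.cM)⁻¹, fun ξ => ?_⟩
  have h0 := Real.sqrt_pos.2 P.cM_pos
  rw [abs_of_pos (inv_pos.2 (symM_pos hε ξ))]
  exact inv_anti₀ h0 (sqrt_cM_le_symM hε ξ)

variable (P ε) in
/-- `(η, v)` in terms of the symmetrized variables in Fourier space. -/
structure Corresponds (η : L2) (v : Fin 2 → L2) (h w : H) : Prop where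
  eta : fourierR η = mulL (fun ξ => (P.symM ε ξ)⁻¹) h
  vel : ∀ j, fourierR (v j) = Complex.I • mulL (rho j) w

variable (P ε) in
/-- The test function `φ - ε b Δφ`. -/
def massTest (φ : 𝓢(Plane, ℝ)) : 𝓢(Plane, ℝ) := φ + (-(ε * P.b)) • Δ φ

theorem massTest_apply (φ : 𝓢(Plane, ℝ)) (x : Plane) :
    P.massTest ε φ x = φ x - ε * P.b * (Δ φ) x := by
  rw [massTest, add_apply, smul_apply, smul_eq_mul]
  ring

theorem hatS_massTest (φ : 𝓢(Plane, ℝ)) (ξ : Plane) :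
    hatS (P.massTest ε φ) ξ = ((1 + ε * P.b * freq ξ ^ 2 : ℝ) : ℂ) * hatS φ ξ := by
  rw [massTest, hatS_add, hatS_smul, hatS_laplacian]
  push_cast
  ring

variable (P ε) in
/-- The element of `L²` that corresponds to the test function `φ` in the first equation. -/
def testH (φ : 𝓢(Plane, ℝ)) : H :=
  mulL (fun ξ => (P.symM ε ξ)⁻¹) (hat (quartic (P.massTest ε φ)))

/-- The element of `L²` that corresponds to the test function `φ` in the second equation. -/
def _root_.Boussinesq.testW (j : Fin 2) (φ : 𝓢(Plane, ℝ)) : H :=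
  mulL (rho j) (-(Complex.I • hat (quartic φ)))

theorem testH_coe (hε : 0 < ε) (φ : 𝓢(Plane, ℝ)) : P.testH ε φ =ᵐ[volume] fun ξ =>
    (((P.symM ε ξ)⁻¹ * (jap ξ ^ 4 * (1 + ε * P.b * freq ξ ^ 2)) : ℝ) : ℂ) * hatS φ ξ := by
  filter_upwards [mulL_coe (isMultiplier_inv_symM (P := P) hε)
    (hat (quartic (P.massTest ε φ))), hat_coe (quartic (P.massTest ε φ))] with ξ h1 h2
  rw [testH, h1, h2, hatS_quartic, hatS_massTest]
  push_cast
  ring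

theorem _root_.Boussinesq.testW_coe (j : Fin 2) (φ : 𝓢(Plane, ℝ)) :
    testW j φ =ᵐ[volume] fun ξ =>
      -Complex.I * ((rho j ξ * jap ξ ^ 4 : ℝ) : ℂ) * hatS φ ξ := by
  filter_upwards [mulL_coe (isMultiplier_rho j) (-(Complex.I • hat (quartic φ))),
    Lp.coeFn_neg (Complex.I • hat (quartic φ)), coe_smul_I (hat (quartic φ)),
    hat_coe (quartic φ)] with ξ h1 h2 h3 h4
  rw [testW, h1, h2, Pi.neg_apply, h3, h4, hatS_quartic]
  push_cast
  ring

variable {η : L2} {v : Fin 2 → L2} {h w : H}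

theorem Corresponds.eta_coe (hε : 0 < ε) (H : P.Corresponds ε η v h w) :
    fourierR η =ᵐ[volume] fun ξ => (((P.symM ε ξ)⁻¹ : ℝ) : ℂ) * h ξ := by
  rw [H.eta]
  exact mulL_coe (isMultiplier_inv_symM hε) h

theorem Corresponds.vel_coe (H : P.Corresponds ε η v h w) (j : Fin 2) :
    fourierR (v j) =ᵐ[volume] fun ξ => Complex.I * ((rho j ξ : ℂ) * w ξ) := by
  rw [H.vel]
  filter_upwards [coe_smul_I (mulL (rho j) w), mulL_coe (isMultiplier_rho j) w] with ξ h1 h2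
  rw [h1, h2]

/-- The operator 1 - εbΔ, the inverse symmetrizer and the compensation of the damping are all
collected in the test element, which leaves the damped unknown alone on the left. -/
theorem Corresponds.integral_mass (hε : 0 < ε) (H : P.Corresponds ε η v h w)
    (φ : 𝓢(Plane, ℝ)) : ∫ x, η x * (φ x - ε * P.b * (Δ φ) x) =
      inner ℝ (mulL damp h) (P.testH ε φ) := by
  simp only [← massTest_apply]
  rw [integral_mul_eq_inner, H.eta, testH, ← mulL_damp_hat_quartic,
    inner_mulL (isMultiplier_inv_symM hε), inner_mulL isMultiplier_damp,
    mulL_mulL isMultiplier_damp (isMultiplier_inv_symM hε),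
    mulL_mulL (isMultiplier_inv_symM hε) isMultiplier_damp]
  congr 3
  funext ξ
  ring

theorem Corresponds.integral_vel (H : P.Corresponds ε η v h w) (j : Fin 2)
    (φ : 𝓢(Plane, ℝ)) : ∫ x, v j x * φ x = inner ℝ (mulL damp w) (testW j φ) := by
  rw [integral_mul_eq_inner, inner_eq_integral, inner_eq_integral]
  apply integral_congr_ae
  filter_upwards [H.vel_coe j, testW_coe j φ, hat_coe φ, mulL_coe isMultiplier_damp w]
    with ξ h1 h2 h3 h4
  rw [h1, h2, h3, h4]
  have hd : ((damp ξ : ℝ) : ℂ) * ((jap ξ ^ 4 : ℝ) : ℂ) = 1 := by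
    rw [← Complex.ofReal_mul, damp_mul_jap_pow, Complex.ofReal_one]
  congr 1
  simp only [map_mul, map_neg, Complex.conj_I, Complex.conj_ofReal]
  push_cast at hd ⊢
  linear_combination -(Complex.I * (rho j ξ) * w ξ * (starRingEnd ℂ) (hatS φ ξ)) * hd

end Params

theorem inner_smul_I (f g : H) : inner ℝ (Complex.I • f) g = inner ℝ f (-(Complex.I • g)) := by
  rw [inner_eq_integral, inner_eq_integral]
  apply integral_congr_ae
  filter_upwards [coe_smul_I f, coe_smul_I g, Lp.coeFn_neg (Complex.I • g)] with ξ h1 h2 h3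
  rw [h1, h3, Pi.neg_apply, h2]
  congr 1
  simp only [map_mul, map_neg, Complex.conj_I]
  ring

/-- The element of `L²` that corresponds to the test field `∇φ`. -/
def gradTest (φ : 𝓢(Plane, ℝ)) : H :=
  mulL (rho 0) (-(Complex.I • hat (pd 0 φ))) + mulL (rho 1) (-(Complex.I • hat (pd 1 φ)))

theorem mulL_rho_hat_pd_coe (j : Fin 2) (φ : 𝓢(Plane, ℝ)) :
    mulL (rho j) (-(Complex.I • hat (pd j φ))) =ᵐ[volume] fun ξ =>
      ((freq ξ * rho j ξ ^ 2 : ℝ) : ℂ) * hatS φ ξ := by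
  filter_upwards [mulL_coe (isMultiplier_rho j) (-(Complex.I • hat (pd j φ))),
    Lp.coeFn_neg (Complex.I • hat (pd j φ)), coe_smul_I (hat (pd j φ)),
    hat_coe (pd j φ)] with ξ h1 h2 h3 h4
  rw [h1, h2, Pi.neg_apply, h3, h4, hatS_pd]
  have e : (2 : ℂ) * Real.pi * (ξ j : ℂ) = freq ξ * rho j ξ := by exact_mod_cast two_pi_mul_eq j ξ
  push_cast
  linear_combination (-(2 * Real.pi * (ξ j : ℂ)) * rho j ξ * hatS φ ξ) * Complex.I_sq +
    rho j ξ * hatS φ ξ * e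

theorem gradTest_coe (φ : 𝓢(Plane, ℝ)) :
    gradTest φ =ᵐ[volume] fun ξ => (freq ξ : ℂ) * hatS φ ξ := by
  filter_upwards [Lp.coeFn_add (mulL (rho 0) (-(Complex.I • hat (pd 0 φ))))
    (mulL (rho 1) (-(Complex.I • hat (pd 1 φ)))), mulL_rho_hat_pd_coe 0 φ,
    mulL_rho_hat_pd_coe 1 φ] with ξ h1 h2 h3
  rw [gradTest, h1, Pi.add_apply, h2, h3]
  have e := congrArg (fun x : ℝ => (x : ℂ)) (freq_mul_rho_sq_add ξ)
  push_cast at e ⊢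
  linear_combination hatS φ ξ * e

namespace Params

variable {P : Params} {ε : ℝ}

/-- This identity and `symΩ_mul_eq` are what determines M and Ω: in the variable h = M η̂ the
coupling of h to w and that of w to h have opposite coefficients, and the linear part is skew. -/
theorem symΩ_mul_symM (hε : 0 < ε) (ξ : Plane) :
    P.symΩ ε ξ * P.symM ε ξ = freq ξ * (1 + ε * P.γ * freq ξ ^ 2) := by
  have h1 := one_add_pos hε P.γ_pos ξ
  have h2 := one_add_pos hε P.α_pos ξ
  have h3 := one_add_pos hε P.b_pos ξ
  rw [symΩ, symM, mul_assoc, ← Real.sqrt_mul (by positivity)]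
  congr 1
  rw [Real.sqrt_eq_iff_mul_self_eq (by positivity) (by positivity)]
  generalize 1 + ε * P.γ * freq ξ ^ 2 = x at *
  generalize 1 + ε * P.α * freq ξ ^ 2 = y at *
  generalize 1 + ε * P.b * freq ξ ^ 2 = z at *
  field_simp

theorem symΩ_mul_eq (hε : 0 < ε) (ξ : Plane) :
    P.symΩ ε ξ * (1 + ε * P.b * freq ξ ^ 2) =
      P.symM ε ξ * (freq ξ * (1 + ε * P.α * freq ξ ^ 2)) := by
  have h1 := one_add_pos hε P.γ_pos ξ
  have h2 := one_add_pos hε P.α_pos ξ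
  have h3 := one_add_pos hε P.b_pos ξ
  have hM := symM_pos (P := P) hε ξ
  have e := symM_sq (P := P) hε ξ
  have e' := symΩ_mul_symM (P := P) hε ξ
  have : (P.symΩ ε ξ * (1 + ε * P.b * freq ξ ^ 2)) * P.symM ε ξ =
      (P.symM ε ξ * (freq ξ * (1 + ε * P.α * freq ξ ^ 2))) * P.symM ε ξ := by
    have e2 : P.symM ε ξ ^ 2 * (1 + ε * P.α * freq ξ ^ 2) =
        (1 + ε * P.γ * freq ξ ^ 2) * (1 + ε * P.b * freq ξ ^ 2) := by
      rw [e, div_mul_cancel₀ _ h2.ne']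
    linear_combination (1 + ε * P.b * freq ξ ^ 2) * e' - freq ξ * e2
  exact mul_right_cancel₀ hM.ne' this

variable {η : L2} {v : Fin 2 → L2} {h w : H}

theorem Corresponds.integral_sum_vel (H : P.Corresponds ε η v h w) (φ : 𝓢(Plane, ℝ)) :
    ∫ x, ∑ j, v j x * pd j φ x = inner ℝ w (gradTest φ) := by
  simp only [Fin.sum_univ_two]
  rw [integral_add (integrable_mul_schwartz _ _) (integrable_mul_schwartz _ _),
    integral_mul_eq_inner, integral_mul_eq_inner, H.vel, H.vel, inner_smul_I, inner_smul_I,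
    inner_mulL (isMultiplier_rho 0), inner_mulL (isMultiplier_rho 1), ← inner_add_right]
  rfl

theorem mulL_testH (hε : 0 < ε) (hε1 : ε ≤ 1) (φ : 𝓢(Plane, ℝ)) :
    mulL (fun ξ => damp ξ * P.symΩ ε ξ) (P.testH ε φ) =
      gradTest φ + (ε * -P.α) • gradTest (Δ φ) := by
  apply Lp.ext
  filter_upwards [mulL_coe (isMultiplier_damp_symΩ hε hε1) (P.testH ε φ), testH_coe hε φ,
    Lp.coeFn_add (gradTest φ) ((ε * -P.α) • gradTest (Δ φ)),
    Lp.coeFn_smul (ε * -P.α) (gradTest (Δ φ)), gradTest_coe φ, gradTest_coe (Δ φ)]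
    with ξ h1 h2 h3 h4 h5 h6
  rw [h1, h2, h3, Pi.add_apply, h4, Pi.smul_apply, h5, h6, hatS_laplacian, Complex.real_smul]
  have e : damp ξ * P.symΩ ε ξ * ((P.symM ε ξ)⁻¹ * (jap ξ ^ 4 * (1 + ε * P.b * freq ξ ^ 2))) =
      freq ξ + ε * P.α * freq ξ ^ 3 := by
    have e1 := symΩ_mul_eq (P := P) hε ξ
    have e2 := damp_mul_jap_pow ξ
    have e3 := mul_inv_cancel₀ (symM_pos (P := P) hε ξ).ne'
    linear_combination (P.symΩ ε ξ * (P.symM ε ξ)⁻¹ * (1 + ε * P.b * freq ξ ^ 2)) * e2 +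
      (P.symM ε ξ)⁻¹ * e1 + (freq ξ * (1 + ε * P.α * freq ξ ^ 2)) * e3
  rw [← mul_assoc, ← Complex.ofReal_mul, e]
  push_cast
  ring

theorem mulL_testW (hε : 0 < ε) (hε1 : ε ≤ 1) (j : Fin 2) (φ : 𝓢(Plane, ℝ)) :
    -mulL (fun ξ => damp ξ * P.symΩ ε ξ) (testW j φ) =
      mulL (fun ξ => (P.symM ε ξ)⁻¹) (hat (pd j φ) + (ε * -P.γ) • hat (pd j (Δ φ))) := by
  apply Lp.ext
  filter_upwards [Lp.coeFn_neg (mulL (fun ξ => damp ξ * P.symΩ ε ξ) (testW j φ)),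
    mulL_coe (isMultiplier_damp_symΩ (P := P) hε hε1) (testW j φ), testW_coe j φ,
    mulL_coe (isMultiplier_inv_symM (P := P) hε) (hat (pd j φ) + (ε * -P.γ) • hat (pd j (Δ φ))),
    Lp.coeFn_add (hat (pd j φ)) ((ε * -P.γ) • hat (pd j (Δ φ))),
    Lp.coeFn_smul (ε * -P.γ) (hat (pd j (Δ φ))), hat_coe (pd j φ), hat_coe (pd j (Δ φ))]
    with ξ h1 h2 h3 h4 h5 h6 h7 h8
  rw [h1, Pi.neg_apply, h2, h3, h4, h5, Pi.add_apply, h6, Pi.smul_apply, h7, h8, hatS_pd, hatS_pd,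
    hatS_laplacian, Complex.real_smul]
  have e : damp ξ * P.symΩ ε ξ * (rho j ξ * jap ξ ^ 4) =
      (P.symM ε ξ)⁻¹ * (2 * Real.pi * ξ j * (1 + ε * P.γ * freq ξ ^ 2)) := by
    have e1 := symΩ_mul_symM (P := P) hε ξ
    have e2 := damp_mul_jap_pow ξ
    have e3 := mul_inv_cancel₀ (symM_pos (P := P) hε ξ).ne'
    have e4 := two_pi_mul_eq j ξ
    linear_combination P.symΩ ε ξ * rho j ξ * e2 + (P.symM ε ξ)⁻¹ * rho j ξ * e1 -
      P.symΩ ε ξ * rho j ξ * e3 - (P.symM ε ξ)⁻¹ * (1 + ε * P.γ * freq ξ ^ 2) * e4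
  have e' := congrArg (fun x : ℝ => (x : ℂ)) e
  push_cast at e' ⊢
  linear_combination Complex.I * hatS φ ξ * e'

theorem Corresponds.sum_integral_eta_vel (hε : 0 < ε) (H : P.Corresponds ε η v h w)
    (φ : 𝓢(Plane, ℝ)) : ∫ x, ∑ j, η x * v j x * pd j φ x =
      inner ℝ (conv (fun ξ ζ => damp ξ * P.kerH ε ξ ζ) h w) (P.testH ε φ) := by
  simp only [Fin.sum_univ_two]
  obtain ⟨hm, m, hw, hb⟩ := isConvKernel_damp
  have hi := integrable_triIntegrand zero_le_one (IsConvKernel.dominated hm hw hb) hw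
  rw [integral_add (integrable_mul_mul _ _ _) (integrable_mul_mul _ _ _),
    integral_mul_mul, integral_mul_mul, inner_conv isConvKernel_damp, inner_conv isConvKernel_damp,
    inner_conv (isConvKernel_damp_kerH hε), tri, tri, tri, ← integral_add (hi _ _ _) (hi _ _ _)]
  apply integral_congr_ae
  filter_upwards [ae_comp_sub (H.eta_coe hε), ae_comp_snd (H.vel_coe 0), ae_comp_snd (H.vel_coe 1),
    ae_comp_fst (hat_coe (quartic (pd 0 φ))), ae_comp_fst (hat_coe (quartic (pd 1 φ))),
    ae_comp_fst (testH_coe (P := P) hε φ)] with z h1 h2 h3 h4 h5 h6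
  simp only [triIntegrand]
  rw [h1, h2, h3, h4, h5, h6, hatS_quartic, hatS_quartic, hatS_pd, hatS_pd]
  -- The factor 1+εbk² of the mass test function cancels the denominator of `kerH`, and M(ξ) cancels
  -- its inverse in `testH`; what remains is the divergence of a product with a gradient field.
  have hk : P.kerH ε z.1 z.2 * ((P.symM ε z.1)⁻¹ * (jap z.1 ^ 4 * (1 + ε * P.b * freq z.1 ^ 2))) =
      (P.symM ε (z.1 - z.2))⁻¹ * jap z.1 ^ 4 *
        (2 * Real.pi * z.1 0 * rho 0 z.2 + 2 * Real.pi * z.1 1 * rho 1 z.2) := by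
    have e1 := (symM_pos (P := P) hε z.1).ne'
    have e2 := (one_add_pos hε P.b_pos z.1).ne'
    have e3 : 2 * Real.pi * z.1 0 * rho 0 z.2 + 2 * Real.pi * z.1 1 * rho 1 z.2 =
        freq z.1 * cosine z.1 z.2 := by
      rw [two_pi_mul_eq, two_pi_mul_eq, ← rho_mul_rho_add]
      ring
    rw [e3, kerH]
    field_simp
  have key : ∀ (x y c : ℂ) (a r J p : ℝ), (((a : ℂ) * x) * (Complex.I * (r * y)) *
      (starRingEnd ℂ) ((J : ℂ) * (2 * Real.pi * Complex.I * p * c))).re =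
        a * J * (2 * Real.pi * p * r) * (x * y * (starRingEnd ℂ) c).re := by
    intro x y c a r J p
    rw [← Complex.re_ofReal_mul]
    congr 1
    simp only [map_mul, Complex.conj_I, Complex.conj_ofReal, map_ofNat]
    push_cast
    linear_combination (-(a * J * (2 * Real.pi * p * r) * (x * y * (starRingEnd ℂ) c)) : ℂ) *
      Complex.I_sq
  have key' : ∀ (x y c : ℂ) (a : ℝ), (x * y * (starRingEnd ℂ) ((a : ℂ) * c)).re =
      a * (x * y * (starRingEnd ℂ) c).re := by
    intro x y c a
    rw [← Complex.re_ofReal_mul]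
    congr 1
    rw [map_mul, Complex.conj_ofReal]
    ring
  rw [key, key, key']
  linear_combination -(damp z.1 * (h (z.1 - z.2) * w z.2 * (starRingEnd ℂ) (hatS φ z.1)).re) * hk

/-- Summing the components of ρ(ξ-ζ) and ρ(ζ) produces the cosine in `kerW`. The two factors I of
the gradient form supply the sign that makes the kernel positive in front. -/
theorem Corresponds.integral_sum_vel_sq (H : P.Corresponds ε η v h w) (j : Fin 2)
    (φ : 𝓢(Plane, ℝ)) : 1 / 2 * ∫ x, (∑ k, v k x ^ 2) * pd j φ x =
      inner ℝ (conv (fun ξ ζ => damp ξ * kerW ξ ζ) w w) (testW j φ) := by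
  obtain ⟨hm, m, hw, hb⟩ := isConvKernel_damp
  have hi := integrable_triIntegrand zero_le_one (IsConvKernel.dominated hm hw hb) hw
  simp only [Fin.sum_univ_two, add_mul, sq]
  rw [integral_add (integrable_mul_mul _ _ _) (integrable_mul_mul _ _ _),
    integral_mul_mul, integral_mul_mul, inner_conv isConvKernel_damp, inner_conv isConvKernel_damp,
    inner_conv isConvKernel_damp_kerW, tri, tri, tri, ← integral_add (hi _ _ _) (hi _ _ _),
    ← integral_const_mul]
  apply integral_congr_ae
  filter_upwards [ae_comp_sub (H.vel_coe 0), ae_comp_sub (H.vel_coe 1), ae_comp_snd (H.vel_coe 0),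
    ae_comp_snd (H.vel_coe 1), ae_comp_fst (hat_coe (quartic (pd j φ))),
    ae_comp_fst (testW_coe j φ)] with z h1 h2 h3 h4 h5 h6
  simp only [triIntegrand]
  rw [h1, h2, h3, h4, h5, h6, hatS_quartic, hatS_pd]
  have key : ∀ (x y c : ℂ) (a r J p : ℝ), ((Complex.I * (a * x)) * (Complex.I * (r * y)) *
      (starRingEnd ℂ) ((J : ℂ) * (2 * Real.pi * Complex.I * p * c))).re =
        J * (2 * Real.pi * p) * (a * r) * (Complex.I * (x * y * (starRingEnd ℂ) c)).re := by
    intro x y c a r J p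
    rw [← Complex.re_ofReal_mul]
    congr 1
    simp only [map_mul, Complex.conj_I, Complex.conj_ofReal, map_ofNat]
    push_cast
    linear_combination (-(Complex.I * a * J * (2 * Real.pi * p * r) *
      (x * y * (starRingEnd ℂ) c)) : ℂ) * Complex.I_sq
  have key' : ∀ (x y c : ℂ) (a : ℝ), (x * y * (starRingEnd ℂ) (-Complex.I * (a : ℂ) * c)).re =
      a * (Complex.I * (x * y * (starRingEnd ℂ) c)).re := by
    intro x y c a
    rw [← Complex.re_ofReal_mul]
    congr 1
    simp only [map_mul, map_neg, Complex.conj_I, Complex.conj_ofReal]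
    ring
  rw [key, key, key', two_pi_mul_eq, kerW, ← rho_mul_rho_add]
  ring

/-- The right-hand side of the first equation in Fourier variables. -/
theorem Corresponds.mass_rhs (hε : 0 < ε) (hε1 : ε ≤ 1) (H : P.Corresponds ε η v h w)
    (φ : 𝓢(Plane, ℝ)) :
    (∫ x, ∑ j, v j x * pd j φ x) + ε * ((∫ x, ∑ j, η x * v j x * pd j φ x) +
      -P.α * ∫ x, ∑ j, v j x * pd j (Δ φ) x) = inner ℝ (P.fieldH ε h w) (P.testH ε φ) := by
  rw [H.integral_sum_vel, H.integral_sum_vel, H.sum_integral_eta_vel hε, fieldH, inner_add_left,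
    inner_mulL (isMultiplier_damp_symΩ hε hε1), mulL_testH hε hε1, inner_add_right,
    real_inner_smul_right, real_inner_smul_left]
  ring

/-- The right-hand side of the second equation in Fourier variables. -/
theorem Corresponds.momentum_rhs (hε : 0 < ε) (hε1 : ε ≤ 1) (H : P.Corresponds ε η v h w)
    (j : Fin 2) (φ : 𝓢(Plane, ℝ)) :
    (∫ x, η x * pd j φ x) + ε * (1 / 2 * (∫ x, (∑ k, v k x ^ 2) * pd j φ x) +
      -P.γ * ∫ x, η x * pd j (Δ φ) x) = inner ℝ (P.fieldW ε h w) (testW j φ) := by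
  rw [H.integral_sum_vel_sq, integral_mul_eq_inner, integral_mul_eq_inner, H.eta, fieldW,
    inner_add_left, inner_neg_left, inner_mulL (isMultiplier_damp_symΩ hε hε1), ← inner_neg_right,
    mulL_testW hε hε1, map_add, map_smul, inner_add_right, real_inner_smul_right,
    real_inner_smul_left, inner_mulL (isMultiplier_inv_symM hε),
    inner_mulL (isMultiplier_inv_symM hε)]
  ring

end Params

/-! ### From weak to strong differentiability in time -/

/-- A weakly differentiable curve of symmetric functions with a continuous weak derivative is
differentiable. -/
theorem hasDerivWithinAt_of_inner {X V : ℝ → H} {S : ℝ} (hV : ContinuousOn V (Set.Icc 0 S))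
    (hXr : ∀ t ∈ Set.Icc 0 S, reflect (X t) = X t) (hVr : ∀ t ∈ Set.Icc 0 S, reflect (V t) = V t)
    {Θ : Set H} (hΘ : ∀ Z, reflect Z = Z → (∀ θ ∈ Θ, inner ℝ Z θ = 0) → Z = 0)
    (h : ∀ θ ∈ Θ, ∀ t ∈ Set.Icc 0 S, HasDerivWithinAt (fun τ => inner ℝ (X τ) θ)
      (inner ℝ (V t) θ) (Set.Icc 0 S) t) :
    ∀ t ∈ Set.Icc 0 S, HasDerivWithinAt X (V t) (Set.Icc 0 S) t := by
  intro t ht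
  have hS : 0 ≤ S := ht.1.trans ht.2
  set V' : ℝ → H := Set.IccExtend hS ((Set.Icc 0 S).domRestrict V) with hV'
  have hVc : Continuous V' := hV.domRestrict.Icc_extend'
  have hVe : ∀ τ ∈ Set.Icc 0 S, V' τ = V τ := fun τ hτ => by
    rw [hV', Set.IccExtend_of_mem hS _ hτ]; rfl
  have hVr' : ∀ τ, reflect (V' τ) = V' τ := fun τ =>
    hVr _ (Set.projIcc 0 S hS τ).2
  have hY : ∀ τ, HasDerivAt (fun τ => ∫ x in (0 : ℝ)..τ, V' x) (V' τ) τ := fun τ =>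
    intervalIntegral.integral_hasDerivAt_right (hVc.intervalIntegrable _ _)
      (hVc.stronglyMeasurableAtFilter _ _) hVc.continuousAt
  have hYr : ∀ τ, reflect (∫ x in (0 : ℝ)..τ, V' x) = ∫ x in (0 : ℝ)..τ, V' x := fun τ => by
    rw [← ContinuousLinearMap.intervalIntegral_comp_comm _ (hVc.intervalIntegrable _ _)]
    congr 1
    exact funext hVr'
  -- The difference of the two sides is Hermitian, and its pairing with each element of `Θ` has zero
  -- derivative in time, so it vanishes because `Θ` separates Hermitian functions.
  have key : ∀ τ ∈ Set.Icc 0 S, X τ = X 0 + ∫ x in (0 : ℝ)..τ, V' x := by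
    intro τ hτ
    have h0 : (0 : ℝ) ∈ Set.Icc 0 S := ⟨le_rfl, hS⟩
    rw [← sub_eq_zero]
    apply hΘ
    · rw [map_sub, map_add, hXr _ hτ, hXr _ h0, hYr]
    · intro θ hθ
      have hd : ∀ x ∈ Set.Icc 0 S, HasDerivWithinAt
          (fun x => inner ℝ (X x) θ - inner ℝ (∫ y in (0 : ℝ)..x, V' y) θ) 0 (Set.Icc 0 S) x := by
        intro x hx
        have h1 := h θ hθ x hx
        have h2 : HasDerivWithinAt (fun x => inner ℝ (∫ y in (0 : ℝ)..x, V' y) θ)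
            (inner ℝ (V' x) θ) (Set.Icc 0 S) x := by
          have := ((innerSL ℝ).flip θ).hasFDerivAt.comp_hasDerivAt x (hY x)
          exact this.hasDerivWithinAt
        have h3 := h1.sub h2
        rwa [hVe x hx, sub_self] at h3
      have := constant_of_has_deriv_right_zero (fun x hx => (hd x hx).continuousWithinAt)
        (fun x hx => ((hd x (Set.Ico_subset_Icc_self hx)).mono_of_mem_nhdsWithin
          (Icc_mem_nhdsGE_of_mem hx))) τ hτ
      rw [intervalIntegral.integral_same, inner_zero_left, sub_zero] at this
      rw [inner_sub_left, inner_add_left, ← this]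
      ring
  have := ((hY t).hasDerivWithinAt (s := Set.Icc 0 S)).const_add (X 0)
  rw [hVe t ht] at this
  exact this.congr key (key t ht)

theorem reflect_rho_I (j : Fin 2) {f : H} (hf : reflect f = f) :
    reflect (Complex.I • mulL (rho j) f) = Complex.I • mulL (rho j) f := by
  rw [reflect_eq_iff]
  have h := coe_smul_I (mulL (rho j) f)
  have h' := mulL_coe (isMultiplier_rho j) f
  filter_upwards [h, ae_comp_neg h, h', ae_comp_neg h', (reflect_eq_iff f).1 hf]
    with ξ h1 h2 h3 h4 h5
  rw [h1, h2, h3, h4, h5, rho_neg]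
  simp

theorem continuous_freq : Continuous freq := by
  unfold freq
  fun_prop

theorem continuous_jap : Continuous jap := by
  have := continuous_freq
  unfold jap
  fun_prop

theorem freq_pos {ξ : Plane} (h : ξ ≠ 0) : 0 < freq ξ := by
  have := norm_pos_iff.2 h
  unfold freq
  positivity

/-- Testing the two components with the two partial derivatives of `φ` and adding gives ρ₀² + ρ₁² =
1, that is the symbol `freq ξ * jap ξ ^ 4`, which vanishes only at the origin. -/
theorem eq_zero_of_inner_testW {Z : H} (hZ : reflect Z = Z)
    (h : ∀ j φ, inner ℝ Z (testW j φ) = 0) : Z = 0 := by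
  refine eq_zero_of_integral_hatS hZ (q := fun ξ => freq ξ * jap ξ ^ 4)
    (continuous_freq.mul (continuous_jap.pow 4)) (fun ξ => by rw [freq_neg, jap_neg])
    (fun ξ hξ => mul_ne_zero (freq_pos hξ).ne' (pow_pos (jap_pos ξ) 4).ne') fun φ => ?_
  have h0 := h 0 (pd 0 φ)
  have h1 := h 1 (pd 1 φ)
  have h2 : inner ℝ Z (testW 0 (pd 0 φ) + testW 1 (pd 1 φ)) = 0 := by
    rw [inner_add_right, h0, h1, add_zero]
  rw [← h2, inner_eq_integral]
  apply integral_congr_ae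
  filter_upwards [Lp.coeFn_add (testW 0 (pd 0 φ)) (testW 1 (pd 1 φ)), testW_coe 0 (pd 0 φ),
    testW_coe 1 (pd 1 φ)] with ξ e1 e2 e3
  rw [e1, Pi.add_apply, e2, e3, hatS_pd, hatS_pd]
  congr 3
  have f0 : (2 : ℂ) * Real.pi * (ξ 0 : ℂ) = freq ξ * rho 0 ξ := by exact_mod_cast two_pi_mul_eq 0 ξ
  have f1 : (2 : ℂ) * Real.pi * (ξ 1 : ℂ) = freq ξ * rho 1 ξ := by exact_mod_cast two_pi_mul_eq 1 ξ
  have e := congrArg (fun x : ℝ => (x : ℂ)) (freq_mul_rho_sq_add ξ)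
  push_cast at e ⊢
  linear_combination (-(jap ξ : ℂ) ^ 4 * hatS φ ξ) * e +
    (-(rho 0 ξ * jap ξ ^ 4 * hatS φ ξ) : ℂ) * f0 + (-(rho 1 ξ * jap ξ ^ 4 * hatS φ ξ) : ℂ) * f1 +
    (jap ξ ^ 4 * hatS φ ξ * 2 * Real.pi * (rho 0 ξ * ξ 0 + rho 1 ξ * ξ 1) : ℂ) * Complex.I_sq

theorem ext_hatS {φ ψ : 𝓢(Plane, ℝ)} (h : ∀ ξ, hatS φ ξ = hatS ψ ξ) : φ = ψ := by
  apply SchwartzMap.injective_toLp 2 (volume : Measure Plane)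
  apply fourierR_injective
  change hat _ = hat _
  rw [hat_eq, hat_eq, SchwartzMap.ext h]

theorem pd_laplacian (j : Fin 2) (φ : 𝓢(Plane, ℝ)) : pd j (Δ φ) = Δ (pd j φ) := by
  refine ext_hatS fun ξ => ?_
  rw [hatS_pd, hatS_laplacian, hatS_laplacian, hatS_pd]
  ring

/-! ### Curl-free fields are gradients -/

/-- The curl does not depend on time. -/
theorem IsSolution.curlFree {a b c ε S : ℝ} {η : ℝ → L2} {v : ℝ → Fin 2 → L2}
    (H : IsSolution a b c ε S η v) (h0 : CurlFree (v 0)) : ∀ t ∈ Set.Icc 0 S, CurlFree (v t) := by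
  intro t ht φ
  have hd : ∀ x ∈ Set.Icc 0 S, HasDerivWithinAt
      (fun τ => (∫ x, v τ 1 x * pd 0 φ x) - ∫ x, v τ 0 x * pd 1 φ x) 0 (Set.Icc 0 S) x := by
    intro x hx
    -- The right side of the momentum equation sees the test function of component `j` only through
    -- its `j`-th derivative. For this pair of tests the two sides coincide because partial
    -- derivatives commute.
    have h3 := (H.momentum (pd 0 φ) 1 x hx).sub (H.momentum (pd 1 φ) 0 x hx)
    rw [pd_laplacian 1, pd_laplacian 0, pd_comm 1 0, sub_self] at h3
    exact h3
  have e : ∀ τ, ∫ x, (v τ 1 x * pd 0 φ x - v τ 0 x * pd 1 φ x) =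
      (∫ x, v τ 1 x * pd 0 φ x) - ∫ x, v τ 0 x * pd 1 φ x := fun τ =>
    integral_sub (integrable_mul_schwartz _ _) (integrable_mul_schwartz _ _)
  have := constant_of_has_deriv_right_zero (fun x hx => (hd x hx).continuousWithinAt)
    (fun x hx => ((hd x (Set.Ico_subset_Icc_self hx)).mono_of_mem_nhdsWithin
      (Icc_mem_nhdsGE_of_mem hx))) t ht
  rw [e, this, ← e]
  exact h0 φ

/-- The scalar amplitude of a curl-free field. -/
def amplitude (v : Fin 2 → L2) : H :=
  -(Complex.I • mulL (rho 0) (fourierR (v 0)) + Complex.I • mulL (rho 1) (fourierR (v 1)))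

theorem reflect_amplitude (v : Fin 2 → L2) : reflect (amplitude v) = amplitude v := by
  rw [amplitude, map_neg, map_add, reflect_rho_I 0 (reflect_fourierR _),
    reflect_rho_I 1 (reflect_fourierR _)]

/-- Multiplication by I makes the odd symbol `rho` preserve Hermitian symmetry. The curl then has
symbol `freq` times the Hermitian function `X`, and `freq` vanishes only at the origin. -/
theorem CurlFree.rho_mul_eq {v : Fin 2 → L2} (hv : CurlFree v) :
    ∀ᵐ ξ : Plane, (rho 0 ξ : ℂ) * fourierR (v 1) ξ = rho 1 ξ * fourierR (v 0) ξ := by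
  set X : H := Complex.I • mulL (rho 0) (fourierR (v 1)) - Complex.I • mulL (rho 1) (fourierR (v 0))
    with hX
  have hXc : X =ᵐ[volume] fun ξ => Complex.I * (rho 0 ξ * fourierR (v 1) ξ) -
      Complex.I * (rho 1 ξ * fourierR (v 0) ξ) := by
    filter_upwards [Lp.coeFn_sub (Complex.I • mulL (rho 0) (fourierR (v 1)))
      (Complex.I • mulL (rho 1) (fourierR (v 0))), coe_smul_I (mulL (rho 0) (fourierR (v 1))),
      coe_smul_I (mulL (rho 1) (fourierR (v 0))), mulL_coe (isMultiplier_rho 0) (fourierR (v 1)),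
      mulL_coe (isMultiplier_rho 1) (fourierR (v 0))] with ξ h1 h2 h3 h4 h5
    rw [hX, h1, Pi.sub_apply, h2, h3, h4, h5]
  have h0 : X = 0 := by
    refine eq_zero_of_integral_hatS ?_ continuous_freq freq_neg (fun ξ h => (freq_pos h).ne')
      fun φ => ?_
    · rw [map_sub, reflect_rho_I 0 (reflect_fourierR _), reflect_rho_I 1 (reflect_fourierR _)]
    · have h := hv φ
      rw [integral_sub (integrable_mul_schwartz _ _) (integrable_mul_schwartz _ _),
        integral_mul_eq_inner, integral_mul_eq_inner, inner_eq_integral, inner_eq_integral,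
        ← integral_sub (integrable_inner_re _ _) (integrable_inner_re _ _)] at h
      rw [← neg_eq_zero, ← integral_neg, ← h]
      apply integral_congr_ae
      filter_upwards [hXc, hat_coe (pd 0 φ), hat_coe (pd 1 φ)] with ξ h1 h2 h3
      rw [h1, h2, h3, hatS_pd, hatS_pd, ← Complex.sub_re, ← Complex.neg_re]
      congr 1
      have f0 : (2 : ℂ) * Real.pi * (ξ 0 : ℂ) = freq ξ * rho 0 ξ := by
        exact_mod_cast two_pi_mul_eq 0 ξ
      have f1 : (2 : ℂ) * Real.pi * (ξ 1 : ℂ) = freq ξ * rho 1 ξ := by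
        exact_mod_cast two_pi_mul_eq 1 ξ
      simp only [map_mul, Complex.conj_I, Complex.conj_ofReal, map_ofNat]
      linear_combination (Complex.I * fourierR (v 1) ξ * (starRingEnd ℂ) (hatS φ ξ)) * f0 -
        (Complex.I * fourierR (v 0) ξ * (starRingEnd ℂ) (hatS φ ξ)) * f1
  filter_upwards [hXc, Lp.coeFn_zero ℂ 2 (volume : Measure Plane)] with ξ h1 h2
  rw [h0, h2, Pi.zero_apply, ← mul_sub] at h1
  exact sub_eq_zero.1 ((mul_eq_zero.1 h1.symm).resolve_left Complex.I_ne_zero)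

theorem ae_ne_zero : ∀ᵐ ξ : Plane, ξ ≠ 0 := by
  simp [ae_iff]

/-- A curl-free field is a gradient field. -/
theorem CurlFree.fourierR_eq {v : Fin 2 → L2} (hv : CurlFree v) (j : Fin 2) :
    fourierR (v j) = Complex.I • mulL (rho j) (amplitude v) := by
  have hA : amplitude v =ᵐ[volume] fun ξ => -(Complex.I * (rho 0 ξ * fourierR (v 0) ξ) +
      Complex.I * (rho 1 ξ * fourierR (v 1) ξ)) := by
    filter_upwards [Lp.coeFn_neg (Complex.I • mulL (rho 0) (fourierR (v 0)) +
        Complex.I • mulL (rho 1) (fourierR (v 1))),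
      Lp.coeFn_add (Complex.I • mulL (rho 0) (fourierR (v 0)))
        (Complex.I • mulL (rho 1) (fourierR (v 1))), coe_smul_I (mulL (rho 0) (fourierR (v 0))),
      coe_smul_I (mulL (rho 1) (fourierR (v 1))), mulL_coe (isMultiplier_rho 0) (fourierR (v 0)),
      mulL_coe (isMultiplier_rho 1) (fourierR (v 1))] with ξ h0 h1 h2 h3 h4 h5
    rw [amplitude, h0, Pi.neg_apply, h1, Pi.add_apply, h2, h3, h4, h5]
  apply Lp.ext
  filter_upwards [hA, coe_smul_I (mulL (rho j) (amplitude v)),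
    mulL_coe (isMultiplier_rho j) (amplitude v), hv.rho_mul_eq, ae_ne_zero] with ξ h1 h2 h3 h4 h5
  rw [h2, h3, h1]
  have e := congrArg (fun x : ℝ => (x : ℂ)) (rho_sq_add h5)
  push_cast at e
  fin_cases j
  · simp only [Fin.zero_eta]
    linear_combination (-fourierR (v 0) ξ) * e - rho 1 ξ * h4 +
      rho 0 ξ * (rho 0 ξ * fourierR (v 0) ξ + rho 1 ξ * fourierR (v 1) ξ) * Complex.I_sq
  · simp only [Fin.mk_one]
    linear_combination (-fourierR (v 1) ξ) * e + rho 0 ξ * h4 +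
      rho 1 ξ * (rho 0 ξ * fourierR (v 0) ξ + rho 1 ξ * fourierR (v 1) ξ) * Complex.I_sq

/-! ### Equivalence of the two notions of solution -/

namespace Params

variable {P : Params} {ε : ℝ}

theorem continuous_symM (hε : 0 < ε) : Continuous (P.symM ε) := by
  have := continuous_freq
  unfold symM
  refine Continuous.sqrt (Continuous.div (by fun_prop) (by fun_prop) fun ξ => ?_)
  exact (one_add_pos hε P.α_pos ξ).ne'

theorem eq_zero_of_inner_testH (hε : 0 < ε) {Z : H} (hZ : reflect Z = Z)
    (h : ∀ φ, inner ℝ Z (P.testH ε φ) = 0) : Z = 0 := by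
  refine eq_zero_of_integral_hatS hZ
    (q := fun ξ => (P.symM ε ξ)⁻¹ * (jap ξ ^ 4 * (1 + ε * P.b * freq ξ ^ 2))) ?_
    (fun ξ => by rw [freq_neg, jap_neg, symM_neg])
    (fun ξ hξ => ?_) fun φ => ?_
  · exact ((continuous_symM hε).inv₀ fun ξ => (symM_pos hε ξ).ne').mul
      ((continuous_jap.pow 4).mul (continuous_const.add
        (continuous_const.mul (continuous_freq.pow 2))))
  · have h1 := symM_pos (P := P) hε ξ
    have h2 := one_add_pos hε P.b_pos ξ
    have h3 := jap_pos ξ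
    positivity
  · rw [← h φ, inner_eq_integral]
    apply integral_congr_ae
    filter_upwards [testH_coe (P := P) hε φ] with ξ e1
    rw [e1]

variable {S R : ℝ} {η : ℝ → L2} {v : ℝ → Fin 2 → L2} {h w : ℝ → H}

/-- Solutions in Fourier variables give solutions of the system. -/
theorem FourierSolution.isSolution (hε : 0 < ε) (hε1 : ε ≤ 1) (Hs : FourierSolution P ε S R h w)
    (Hc : ∀ t ∈ Set.Icc 0 S, P.Corresponds ε (η t) (v t) (h t) (w t)) :
    IsSolution (-P.α) P.b (-P.γ) ε S η v := by
  refine ⟨fun φ t ht => ?_, fun φ j t ht => ?_⟩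
  · rw [(Hc t ht).mass_rhs hε hε1]
    have := ((innerSL ℝ).flip (P.testH ε φ)).hasFDerivAt.comp_hasDerivWithinAt t (Hs.deriv_h t ht)
    exact this.congr (fun τ hτ => (Hc τ hτ).integral_mass hε φ) ((Hc t ht).integral_mass hε φ)
  · rw [(Hc t ht).momentum_rhs hε hε1]
    have := ((innerSL ℝ).flip (testW j φ)).hasFDerivAt.comp_hasDerivWithinAt t (Hs.deriv_w t ht)
    exact this.congr (fun τ hτ => (Hc τ hτ).integral_vel j φ) ((Hc t ht).integral_vel j φ)

/-- Solutions of the system give solutions in Fourier variables. -/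
theorem FourierSolution.of_isSolution (hε : 0 < ε) (hε1 : ε ≤ 1)
    (Hs : IsSolution (-P.α) P.b (-P.γ) ε S η v)
    (Hc : ∀ t ∈ Set.Icc 0 S, P.Corresponds ε (η t) (v t) (h t) (w t))
    (hh : ContinuousOn h (Set.Icc 0 S)) (hw : ContinuousOn w (Set.Icc 0 S))
    (hrep : ∀ t ∈ Set.Icc 0 S, ∃ f g : H, reflect f = f ∧ reflect g = g ∧
      h t = P.smooth f ∧ w t = P.smooth g ∧ ‖f‖ ≤ R ∧ ‖g‖ ≤ R) :
    FourierSolution P ε S R h w := by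
  have hr : ∀ t ∈ Set.Icc 0 S, reflect (h t) = h t ∧ reflect (w t) = w t := fun t ht => by
    obtain ⟨f, g, hf, hg, e1, e2, -⟩ := hrep t ht
    rw [e1, e2, reflect_smooth, reflect_smooth, hf, hg]
    exact ⟨rfl, rfl⟩
  refine ⟨hrep, ?_, ?_⟩
  · refine hasDerivWithinAt_of_inner (Θ := Set.range (P.testH ε)) (continuousOn_fieldH hh hw)
      (fun t ht => ?_) (fun t ht => reflect_fieldH hε hε1 (hr t ht).1 (hr t ht).2)
      (fun Z hZ hz => eq_zero_of_inner_testH hε hZ fun φ => hz _ ⟨φ, rfl⟩) ?_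
    · rw [reflect_mulL isMultiplier_damp damp_neg, (hr t ht).1]
    · rintro _ ⟨φ, rfl⟩ t ht
      rw [← (Hc t ht).mass_rhs hε hε1]
      exact (Hs.mass φ t ht).congr (fun τ hτ => ((Hc τ hτ).integral_mass hε φ).symm)
        ((Hc t ht).integral_mass hε φ).symm
  · refine hasDerivWithinAt_of_inner (Θ := Set.range fun p : Fin 2 × 𝓢(Plane, ℝ) => testW p.1 p.2)
      (continuousOn_fieldW hh hw)
      (fun t ht => ?_) (fun t ht => reflect_fieldW hε hε1 (hr t ht).1 (hr t ht).2)
      (fun Z hZ hz => eq_zero_of_inner_testW hZ fun j φ => hz _ ⟨(j, φ), rfl⟩) ?_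
    · rw [reflect_mulL isMultiplier_damp damp_neg, (hr t ht).2]
    · rintro _ ⟨⟨j, φ⟩, rfl⟩ t ht
      rw [← (Hc t ht).momentum_rhs hε hε1]
      exact (Hs.momentum φ j t ht).congr (fun τ hτ => ((Hc τ hτ).integral_vel j φ).symm)
        ((Hc t ht).integral_vel j φ).symm

end Params

/-! ### Sobolev norms as L² norms of lifts -/

/-- `u = ⟨D⟩^{-r} f` in Fourier variables. -/
def IsLift (r : ℝ) (u : L2) (f : H) : Prop := fourierR u = mulL (fun ξ => jap ξ ^ (-r)) f

section Lift

variable {r : ℝ} {u u' : L2} {f f' : H}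

theorem isMultiplier_jap_neg (hr : 0 ≤ r) : IsMultiplier fun ξ => jap ξ ^ (-r) :=
  isMultiplier_jap (by linarith)

theorem sobolev_weight_eq (r : ℝ) (ξ : Plane) :
    ENNReal.ofReal ((1 + (2 * Real.pi * ‖ξ‖) ^ 2) ^ r) = ‖jap ξ ^ r‖ₑ ^ 2 := by
  have h : 1 + (2 * Real.pi * ‖ξ‖) ^ 2 = jap ξ ^ (2 : ℝ) := by
    rw [Real.rpow_two, jap_sq, freq]
  rw [h, ← Real.rpow_mul (jap_pos ξ).le, mul_comm, Real.rpow_mul (jap_pos ξ).le, Real.rpow_two,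
    ENNReal.ofReal_pow (jap_rpow_pos r ξ).le, Real.enorm_eq_ofReal (jap_rpow_pos r ξ).le]

theorem IsLift.sobolevNormSq_eq (hr : 0 ≤ r) (h : IsLift r u f) :
    sobolevNormSq r u = ENNReal.ofReal (‖f‖ ^ 2) := by
  rw [norm_sq_eq_lintegral, sobolevNormSq]
  apply lintegral_congr_ae
  rw [← fourierR_apply, h]
  filter_upwards [mulL_coe (isMultiplier_jap_neg hr) f] with ξ hξ
  rw [hξ, sobolev_weight_eq, ← mul_pow, enorm_mul, ← mul_assoc]
  have e : ‖jap ξ ^ r‖ₑ * ‖((jap ξ ^ (-r) : ℝ) : ℂ)‖ₑ = 1 := by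
    rw [show ‖((jap ξ ^ (-r) : ℝ) : ℂ)‖ₑ = ‖jap ξ ^ (-r)‖ₑ by
      rw [← ofReal_norm, ← ofReal_norm, Complex.norm_real], ← enorm_mul, mul_comm,
      jap_rpow_neg_mul, enorm_one]
  rw [e, one_mul]

theorem ofReal_sq_rpow_half {x : ℝ} (hx : 0 ≤ x) :
    ENNReal.ofReal (x ^ 2) ^ (1 / 2 : ℝ) = ENNReal.ofReal x := by
  rw [ENNReal.ofReal_rpow_of_nonneg (by positivity) (by norm_num), ← Real.sqrt_eq_rpow,
    Real.sqrt_sq hx]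

theorem IsLift.sobolevNorm_eq (hr : 0 ≤ r) (h : IsLift r u f) :
    sobolevNorm r u = ENNReal.ofReal ‖f‖ := by
  rw [sobolevNorm, h.sobolevNormSq_eq hr, ofReal_sq_rpow_half (norm_nonneg f)]

theorem exists_isLift (hr : 0 ≤ r) (h : sobolevNormSq r u < ∞) : ∃ f, IsLift r u f := by
  set g : Plane → ℂ := fun ξ => ((jap ξ ^ r : ℝ) : ℂ) * fourierR u ξ with hg
  have hgm : AEStronglyMeasurable g volume :=
    ((Complex.measurable_ofReal.comp (measurable_jap_rpow r)).mul
      (measurable_coe (fourierR u))).aestronglyMeasurable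
  have hgL : MemLp g 2 volume := by
    refine ⟨hgm, ?_⟩
    rw [eLpNorm_lt_top_iff_lintegral_rpow_enorm_lt_top (by norm_num) (by norm_num)]
    refine lt_of_eq_of_lt ?_ h
    rw [sobolevNormSq]
    congr 1 with ξ
    rw [← fourierR_apply, sobolev_weight_eq, ENNReal.toReal_ofNat, ENNReal.rpow_two, hg,
      enorm_mul, mul_pow]
    congr 2
    rw [← ofReal_norm, ← ofReal_norm, Complex.norm_real]
  refine ⟨hgL.toLp g, ?_⟩
  apply Lp.ext
  filter_upwards [mulL_coe (isMultiplier_jap_neg hr) (hgL.toLp g), hgL.coeFn_toLp] with ξ h1 h2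
  rw [h1, h2, hg, ← mul_assoc, ← Complex.ofReal_mul, jap_rpow_neg_mul, Complex.ofReal_one, one_mul]

theorem exists_isLift_of_sobolevNorm (hr : 0 ≤ r) (h : sobolevNorm r u < ∞) :
    ∃ f, IsLift r u f := by
  refine exists_isLift hr ?_
  rw [sobolevNorm] at h
  exact (ENNReal.rpow_lt_top_iff_of_pos (by norm_num)).1 h

theorem IsLift.sub (h : IsLift r u f) (h' : IsLift r u' f') : IsLift r (u - u') (f - f') := by
  rw [IsLift, map_sub, map_sub, h, h']

theorem IsLift.reflect_eq (hr : 0 ≤ r) (h : IsLift r u f) : reflect f = f := by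
  refine mulL_injective (isMultiplier_jap_neg hr) (fun ξ => (jap_rpow_pos (-r) ξ).ne') ?_
  rw [← reflect_mulL (isMultiplier_jap_neg hr) fun ξ => by rw [jap_neg], ← h, reflect_fourierR]

theorem tendsto_ofReal_norm_iff {α : Type*} {l : Filter α} {e : α → H} :
    Tendsto (fun a => ENNReal.ofReal ‖e a‖) l (𝓝 0) ↔ Tendsto e l (𝓝 0) := by
  rw [tendsto_zero_iff_norm_tendsto_zero]
  constructor
  · intro h
    have := (ENNReal.tendsto_toReal ENNReal.zero_ne_top).comp h
    refine this.congr fun a => ?_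
    rw [Function.comp, ENNReal.toReal_ofReal (norm_nonneg _)]
  · intro h
    have := ENNReal.tendsto_ofReal h
    rwa [ENNReal.ofReal_zero] at this

/-- The Sobolev norm of a difference is the L² norm of the difference of the lifts, so continuity in
H^r is continuity of the lift in L². -/
theorem ContinuousInSobolev.exists_lift (hr : 0 ≤ r) {S : ℝ} {u : ℝ → L2}
    (h : ContinuousInSobolev r S u) :
    ∃ e : ℝ → H, ContinuousOn e (Set.Icc 0 S) ∧ ∀ t ∈ Set.Icc 0 S, IsLift r (u t) (e t) := by
  have h1 : ∀ t, ∃ f, t ∈ Set.Icc 0 S → IsLift r (u t) f := fun t => by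
    by_cases ht : t ∈ Set.Icc 0 S
    · obtain ⟨f, hf⟩ := exists_isLift_of_sobolevNorm hr (h t ht).1
      exact ⟨f, fun _ => hf⟩
    · exact ⟨0, fun h => absurd h ht⟩
  choose e he using h1
  refine ⟨e, fun t ht => ?_, he⟩
  have h2 := (h t ht).2
  have h3 : Tendsto (fun τ => ENNReal.ofReal ‖e τ - e t‖) (𝓝[Set.Icc 0 S] t) (𝓝 0) := by
    refine h2.congr' ?_
    filter_upwards [self_mem_nhdsWithin] with τ hτ
    exact ((he τ hτ).sub (he t ht)).sobolevNorm_eq hr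
  exact tendsto_sub_nhds_zero_iff.1 (tendsto_ofReal_norm_iff.1 h3)

theorem continuousInSobolev_of_lift (hr : 0 ≤ r) {S : ℝ} {u : ℝ → L2} {e : ℝ → H}
    (hc : ContinuousOn e (Set.Icc 0 S)) (he : ∀ t ∈ Set.Icc 0 S, IsLift r (u t) (e t)) :
    ContinuousInSobolev r S u := by
  intro t ht
  refine ⟨by rw [(he t ht).sobolevNorm_eq hr]; exact ENNReal.ofReal_lt_top, ?_⟩
  have h1 : Tendsto (fun τ => e τ - e t) (𝓝[Set.Icc 0 S] t) (𝓝 0) :=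
    tendsto_sub_nhds_zero_iff.2 (hc t ht)
  refine (tendsto_ofReal_norm_iff.2 h1).congr' ?_
  filter_upwards [self_mem_nhdsWithin] with τ hτ
  exact (((he τ hτ).sub (he t ht)).sobolevNorm_eq hr).symm

theorem sobolevNormVec_le (hr : 0 ≤ r) {v : Fin 2 → L2} {g : Fin 2 → H} {B : ℝ} (hB : 0 ≤ B)
    (h : ∀ j, IsLift r (v j) (g j)) (hg : ∀ j, ‖g j‖ ≤ B) :
    sobolevNormVec r v ≤ ENNReal.ofReal (2 * B) := by
  rw [sobolevNormVec, Fin.sum_univ_two, (h 0).sobolevNormSq_eq hr, (h 1).sobolevNormSq_eq hr,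
    ← ENNReal.ofReal_add (by positivity) (by positivity),
    ← ofReal_sq_rpow_half (by positivity : 0 ≤ 2 * B)]
  gcongr
  nlinarith [hg 0, hg 1, norm_nonneg (g 0), norm_nonneg (g 1)]

theorem sobolevNorm_le_vec (r : ℝ) (v : Fin 2 → L2) (j : Fin 2) :
    sobolevNorm r (v j) ≤ sobolevNormVec r v := by
  rw [sobolevNorm, sobolevNormVec]
  gcongr
  exact Finset.single_le_sum (f := fun j => sobolevNormSq r (v j)) (fun _ _ => zero_le)
    (Finset.mem_univ j)

theorem norm_smul_I_rho_le (j : Fin 2) (g : H) : ‖Complex.I • mulL (rho j) g‖ ≤ ‖g‖ := by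
  rw [norm_smul, Complex.norm_I, one_mul]
  refine (norm_mulL_le (isMultiplier_rho j) (C := 1) (fun ξ => ?_) g).trans (one_mul _).le
  rw [rho, abs_div, abs_norm]
  exact div_le_one_of_le₀ (PiLp.norm_apply_le ξ j) (norm_nonneg _)

theorem mulL_smul_I {m : Plane → ℝ} (hm : IsMultiplier m) (f : H) :
    mulL m (Complex.I • f) = Complex.I • mulL m f := by
  apply Lp.ext
  filter_upwards [mulL_coe hm (Complex.I • f), coe_smul_I f, coe_smul_I (mulL m f), mulL_coe hm f]
    with ξ h1 h2 h3 h4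
  rw [h1, h2, h3, h4]
  ring

theorem mulL_comm {m n : Plane → ℝ} (hm : IsMultiplier m) (hn : IsMultiplier n) (f : H) :
    mulL m (mulL n f) = mulL n (mulL m f) := by
  rw [mulL_mulL hm hn, mulL_mulL hn hm]
  exact mulL_congr (fun ξ => mul_comm _ _) f

/-- The amplitude of the field with the given lifts. -/
theorem amplitude_eq (hr : 0 ≤ r) {v : Fin 2 → L2} {g : Fin 2 → H} (h : ∀ j, IsLift r (v j) (g j)) :
    amplitude v = mulL (fun ξ => jap ξ ^ (-r))
      (-(Complex.I • mulL (rho 0) (g 0) + Complex.I • mulL (rho 1) (g 1))) := by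
  have hj := isMultiplier_jap_neg hr
  rw [amplitude, h 0, h 1, map_neg, map_add, mulL_smul_I hj, mulL_smul_I hj,
    mulL_comm hj (isMultiplier_rho 0), mulL_comm hj (isMultiplier_rho 1)]

theorem isLift_of_fourierR_eq (hr : 0 ≤ r) {j : Fin 2} {g : H}
    (h : fourierR u = Complex.I • mulL (rho j) (mulL (fun ξ => jap ξ ^ (-r)) g)) :
    IsLift r u (Complex.I • mulL (rho j) g) := by
  have hj := isMultiplier_jap_neg hr
  rw [IsLift, h, mulL_smul_I hj, mulL_comm hj (isMultiplier_rho j)]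

end Lift

/-! ### Comparison of the symmetrizer with the bracket -/

namespace Params

variable {P : Params} {ε : ℝ}

variable (P) in
/-- Upper constant in the comparison of `symM` with the Japanese bracket. -/
def symMUpper : ℝ := Real.sqrt (P.CM * (1 + P.b))

variable (P) in
/-- Lower constant in the comparison of `symM` with the Japanese bracket. -/
def symMLower : ℝ := Real.sqrt ((1 + 1 / P.b) / P.cM)

/-- Uniform in ε: initial elevations bounded in H^{s+1} give symmetrized data bounded in H^s. -/
theorem symM_le_jap (hε : 0 < ε) (hε1 : ε ≤ 1) (ξ : Plane) :
    P.symM ε ξ ≤ P.symMUpper * jap ξ := by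
  have hb := P.b_pos
  have hC := P.CM_pos
  rw [symMUpper, ← Real.sqrt_sq (jap_pos ξ).le, ← Real.sqrt_mul (by positivity)]
  refine Real.le_sqrt_of_sq_le ((symM_sq_le hε ξ).trans ?_)
  rw [jap_sq, mul_assoc ε, mul_assoc P.CM]
  refine mul_le_mul_of_nonneg_left ?_ hC.le
  have h1 : ε * (P.b * freq ξ ^ 2) ≤ 1 * (P.b * freq ξ ^ 2) :=
    mul_le_mul_of_nonneg_right hε1 (by positivity)
  nlinarith [sq_nonneg (freq ξ)]

/-- The converse comparison costs ε^{1/2}; this is the weight on the H^{s+1} norm of η in the final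
bound. -/
theorem sqrt_mul_jap_le (hε : 0 < ε) (hε1 : ε ≤ 1) (ξ : Plane) :
    Real.sqrt ε * jap ξ ≤ P.symMLower * P.symM ε ξ := by
  have hb := P.b_pos
  have hc := P.cM_pos
  rw [symMLower, ← Real.sqrt_sq (jap_pos ξ).le, ← Real.sqrt_sq (symM_pos hε ξ).le,
    ← Real.sqrt_mul hε.le, ← Real.sqrt_mul (by positivity)]
  apply Real.sqrt_le_sqrt
  calc ε * jap ξ ^ 2 ≤ (1 + 1 / P.b) * (1 + ε * P.b * freq ξ ^ 2) := by
        rw [jap_sq]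
        have e : (1 + 1 / P.b) * (1 + ε * P.b * freq ξ ^ 2) =
            1 + 1 / P.b + ε * P.b * freq ξ ^ 2 + ε * freq ξ ^ 2 := by
          field_simp
          ring
        have h1 : 0 ≤ 1 / P.b := by positivity
        have h2 : 0 ≤ ε * P.b * freq ξ ^ 2 := by positivity
        rw [e]
        linarith
    _ = (1 + 1 / P.b) / P.cM * (P.cM * (1 + ε * P.b * freq ξ ^ 2)) := by
        field_simp
    _ ≤ _ := mul_le_mul_of_nonneg_left (le_symM_sq hε ξ) (by positivity)

variable (P ε) in
/-- The multiplier `M / ⟨ξ⟩`. -/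
def symMJap (ξ : Plane) : ℝ := P.symM ε ξ * (jap ξ)⁻¹

variable (P ε) in
/-- The multiplier `⟨ξ⟩ / M`. -/
def japSymM (ξ : Plane) : ℝ := jap ξ * (P.symM ε ξ)⁻¹

theorem abs_symMJap_le (hε : 0 < ε) (hε1 : ε ≤ 1) (ξ : Plane) :
    |P.symMJap ε ξ| ≤ P.symMUpper := by
  have h1 := symM_pos (P := P) hε ξ
  have h2 := jap_pos ξ
  rw [symMJap, abs_of_pos (by positivity), ← div_eq_mul_inv, div_le_iff₀ h2]
  exact symM_le_jap hε hε1 ξ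

theorem isMultiplier_symMJap (hε : 0 < ε) (hε1 : ε ≤ 1) : IsMultiplier (P.symMJap ε) :=
  ⟨measurable_symM.mul measurable_jap.inv, P.symMUpper, abs_symMJap_le hε hε1⟩

theorem abs_sqrt_mul_japSymM_le (hε : 0 < ε) (hε1 : ε ≤ 1) (ξ : Plane) :
    |Real.sqrt ε * P.japSymM ε ξ| ≤ P.symMLower := by
  have h1 := symM_pos (P := P) hε ξ
  have h2 := jap_pos ξ
  rw [japSymM, abs_of_nonneg (by positivity), ← mul_assoc, ← div_eq_mul_inv, div_le_iff₀ h1]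
  exact sqrt_mul_jap_le hε hε1 ξ

theorem isMultiplier_japSymM (hε : 0 < ε) (hε1 : ε ≤ 1) : IsMultiplier (P.japSymM ε) := by
  refine ⟨measurable_jap.mul measurable_symM.inv, P.symMLower / Real.sqrt ε, fun ξ => ?_⟩
  have hs := Real.sqrt_pos.2 hε
  have h := abs_sqrt_mul_japSymM_le (P := P) hε hε1 ξ
  rw [abs_mul, abs_of_pos hs] at h
  rw [le_div_iff₀ hs, mul_comm]
  exact h

theorem isLift_eta (hε : 0 < ε) (hε1 : ε ≤ 1) {η : L2} {f : H} :
    IsLift (P.s + 1) η (mulL (P.japSymM ε) f) ↔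
      fourierR η = mulL (fun ξ => (P.symM ε ξ)⁻¹) (P.smooth f) := by
  have hs : 0 ≤ P.s + 1 := by linarith [P.two_lt_s]
  rw [IsLift, mulL_mulL (isMultiplier_jap_neg hs) (isMultiplier_japSymM hε hε1),
    mulL_mulL (isMultiplier_inv_symM hε) isMultiplier_smooth]
  have e : mulL (fun ξ => jap ξ ^ (-(P.s + 1)) * P.japSymM ε ξ) f =
      mulL (fun ξ => (P.symM ε ξ)⁻¹ * jap ξ ^ (-P.s)) f := by
    refine mulL_congr (fun ξ => ?_) f
    have h : jap ξ ^ (-P.s) = jap ξ ^ (-(P.s + 1)) * jap ξ := by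
      rw [← Real.rpow_add_one (jap_pos ξ).ne']
      congr 1
      ring
    rw [japSymM, h]
    ring
  rw [e]

theorem isLift_eta_low (hε : 0 < ε) {η : L2} {f : H}
    (h : fourierR η = mulL (fun ξ => (P.symM ε ξ)⁻¹) (P.smooth f)) :
    IsLift P.s η (mulL (fun ξ => (P.symM ε ξ)⁻¹) f) := by
  rw [IsLift, h, mulL_comm (isMultiplier_inv_symM hε) isMultiplier_smooth]

theorem japSymM_symMJap (hε : 0 < ε) (hε1 : ε ≤ 1) (f : H) :
    mulL (P.japSymM ε) (mulL (P.symMJap ε) f) = f := by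
  rw [mulL_mulL (isMultiplier_japSymM hε hε1) (isMultiplier_symMJap hε hε1)]
  conv_rhs => rw [← mulL_one f]
  refine mulL_congr (fun ξ => ?_) f
  have h1 := (symM_pos (P := P) hε ξ).ne'
  have h2 := (jap_pos ξ).ne'
  rw [japSymM, symMJap]
  field_simp

theorem symMJap_neg (ξ : Plane) : P.symMJap ε (-ξ) = P.symMJap ε ξ := by
  rw [symMJap, symMJap, symM_neg, jap_neg]

end Params

/-! ### Well-posedness of the original system -/

namespace Params

variable {P : Params} {ε S : ℝ}

theorem FourierSolution.mono {R R' : ℝ} {h w : ℝ → H} (H : FourierSolution P ε S R h w)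
    (hR : R ≤ R') : FourierSolution P ε S R' h w :=
  ⟨fun t ht => by
    obtain ⟨f, g, h1, h2, h3, h4, h5, h6⟩ := H.rep t ht
    exact ⟨f, g, h1, h2, h3, h4, h5.trans hR, h6.trans hR⟩, H.deriv_h, H.deriv_w⟩

/-- Solutions of the system in the energy class, in Fourier variables. -/
theorem exists_fourierSolution_of_isSobolevSolution (hε : 0 < ε) (hε1 : ε ≤ 1) {η₀ : L2}
    {v₀ : Fin 2 → L2} (hv₀ : CurlFree v₀) {η : ℝ → L2} {v : ℝ → Fin 2 → L2}
    (Hs : IsSobolevSolution (-P.α) P.b (-P.γ) ε S P.s η₀ v₀ η v) :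
    ∃ (R : ℝ) (h w : ℝ → H), FourierSolution P ε S R h w ∧
      ∀ t ∈ Set.Icc 0 S, P.Corresponds ε (η t) (v t) (h t) (w t) := by
  have hs : 0 ≤ P.s := by linarith [P.two_lt_s]
  have hs1 : 0 ≤ P.s + 1 := by linarith
  obtain ⟨e, hec, he⟩ := Hs.continuous_eta.exists_lift hs1
  choose g hgc hg using fun j => (Hs.continuous_v j).exists_lift hs
  set F : ℝ → H := fun t => mulL (P.symMJap ε) (e t) with hF
  set G : ℝ → H := fun t =>
    -(Complex.I • mulL (rho 0) (g 0 t) + Complex.I • mulL (rho 1) (g 1 t)) with hG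
  have hFc : ContinuousOn F (Set.Icc 0 S) := (mulL (P.symMJap ε)).continuous.comp_continuousOn hec
  have hGj : ∀ j, ContinuousOn (fun t => Complex.I • mulL (rho j) (g j t)) (Set.Icc 0 S) := fun j =>
    ((mulL (rho j)).continuous.comp_continuousOn (hgc j)).const_smul Complex.I
  have hGc : ContinuousOn G (Set.Icc 0 S) := ((hGj 0).add (hGj 1)).neg
  -- Compactness of the time interval provides some H^s bound; uniqueness does not need its size.
  obtain ⟨R₁, hR₁⟩ := isCompact_Icc.exists_bound_of_continuousOn hFc
  obtain ⟨R₂, hR₂⟩ := isCompact_Icc.exists_bound_of_continuousOn hGc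
  have hA : ∀ t ∈ Set.Icc 0 S, amplitude (v t) = P.smooth (G t) := fun t ht =>
    amplitude_eq hs fun j => hg j t ht
  have Hc : ∀ t ∈ Set.Icc 0 S, P.Corresponds ε (η t) (v t) (P.smooth (F t)) (P.smooth (G t)) := by
    intro t ht
    refine ⟨?_, fun j => ?_⟩
    · rw [← isLift_eta hε hε1, hF]
      dsimp only
      rw [japSymM_symMJap hε hε1]
      exact he t ht
    · rw [← hA t ht]
      exact (Hs.solves.curlFree (by rwa [Hs.initial_v]) t ht).fourierR_eq j
  refine ⟨max R₁ R₂, fun t => P.smooth (F t), fun t => P.smooth (G t), ?_, Hc⟩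
  refine FourierSolution.of_isSolution hε hε1 Hs.solves Hc
    (P.smooth.continuous.comp_continuousOn hFc) (P.smooth.continuous.comp_continuousOn hGc)
    fun t ht => ⟨F t, G t, ?_, ?_, rfl, rfl, (hR₁ t ht).trans (le_max_left _ _),
      (hR₂ t ht).trans (le_max_right _ _)⟩
  · rw [hF]
    dsimp only
    rw [reflect_mulL (isMultiplier_symMJap hε hε1) symMJap_neg, (he t ht).reflect_eq hs1]
  · apply reflect_of_smooth
    rw [← hA t ht, reflect_amplitude]

theorem Corresponds.amplitude_eq {η : L2} {v : Fin 2 → L2} {h w : H}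
    (hc : P.Corresponds ε η v h w) : amplitude v = w := by
  have e : amplitude v = -(Complex.I • mulL (rho 0) (Complex.I • mulL (rho 0) w) +
      Complex.I • mulL (rho 1) (Complex.I • mulL (rho 1) w)) := by
    rw [amplitude, hc.vel, hc.vel]
  rw [mulL_smul_I (isMultiplier_rho 0), mulL_smul_I (isMultiplier_rho 1), smul_smul, smul_smul,
    Complex.I_mul_I, neg_smul, neg_smul, one_smul, one_smul, neg_add, neg_neg, neg_neg] at e
  rw [e]
  apply Lp.ext
  filter_upwards [Lp.coeFn_add (mulL (rho 0) (mulL (rho 0) w)) (mulL (rho 1) (mulL (rho 1) w)),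
    mulL_coe (isMultiplier_rho 0) (mulL (rho 0) w), mulL_coe (isMultiplier_rho 1) (mulL (rho 1) w),
    mulL_coe (isMultiplier_rho 0) w, mulL_coe (isMultiplier_rho 1) w, ae_ne_zero]
    with ξ h1 h2 h3 h4 h5 h6
  rw [h1, Pi.add_apply, h2, h3, h4, h5]
  have e := congrArg (fun x : ℝ => (x : ℂ)) (rho_sq_add h6)
  push_cast at e
  linear_combination w ξ * e

/-- The solution is unique. -/
theorem isSobolevSolution_unique (hε : 0 < ε) (hε1 : ε ≤ 1) {η₀ : L2} {v₀ : Fin 2 → L2}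
    (hv₀ : CurlFree v₀) {η η' : ℝ → L2} {v v' : ℝ → Fin 2 → L2}
    (H : IsSobolevSolution (-P.α) P.b (-P.γ) ε S P.s η₀ v₀ η v)
    (H' : IsSobolevSolution (-P.α) P.b (-P.γ) ε S P.s η₀ v₀ η' v') :
    ∀ t ∈ Set.Icc 0 S, η' t = η t ∧ v' t = v t := by
  intro t ht
  obtain ⟨R, h, w, hF, hc⟩ := exists_fourierSolution_of_isSobolevSolution hε hε1 hv₀ H
  obtain ⟨R', h', w', hF', hc'⟩ := exists_fourierSolution_of_isSobolevSolution hε hε1 hv₀ H'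
  have h0 : (0 : ℝ) ∈ Set.Icc 0 S := ⟨le_rfl, ht.1.trans ht.2⟩
  have e0 : h' 0 = h 0 := by
    refine mulL_injective (isMultiplier_inv_symM (P := P) hε)
      (fun ξ => (inv_pos.2 (symM_pos hε ξ)).ne') ?_
    rw [← (hc' 0 h0).eta, ← (hc 0 h0).eta, H.initial_eta, H'.initial_eta]
  have e1 : w' 0 = w 0 := by
    rw [← (hc' 0 h0).amplitude_eq, ← (hc 0 h0).amplitude_eq, H.initial_v, H'.initial_v]
  have hR : 0 ≤ max R R' := by
    obtain ⟨f, -, -, -, -, -, hf, -⟩ := hF.rep 0 h0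
    exact ((norm_nonneg f).trans hf).trans (le_max_left _ _)
  have := (hF'.mono (le_max_right R R')).unique hε hε1 hR (hF.mono (le_max_left R R')) e0 e1 ht
  refine ⟨fourierR_injective ?_, funext fun j => fourierR_injective ?_⟩
  · rw [(hc' t ht).eta, (hc t ht).eta, this.1]
  · rw [(hc' t ht).vel, (hc t ht).vel, this.2]

/-- Existence of the solution with a bound, from the existence in Fourier variables. -/
theorem exists_isSobolevSolution (hε : 0 < ε) (hε1 : ε ≤ 1) {R : ℝ} (hR : 0 < R) (hS : 0 ≤ S)
    (hT : 4 * (P.energyConst * Real.sqrt ε) * R * S ≤ Real.log 4) {R₁ R₂ : ℝ≥0}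
    (hR₁ : P.symMUpper * R₁ + 2 * R₂ ≤ R) {η₀ : L2} {v₀ : Fin 2 → L2}
    (hη₀ : sobolevNorm (P.s + 1) η₀ ≤ R₁) (hv₀ : sobolevNormVec P.s v₀ ≤ R₂)
    (hc₀ : CurlFree v₀) :
    ∃ (η : ℝ → L2) (v : ℝ → Fin 2 → L2),
      IsSobolevSolution (-P.α) P.b (-P.γ) ε S P.s η₀ v₀ η v ∧
      ∀ t ∈ Set.Icc 0 S, sobolevNorm P.s (η t) +
        ENNReal.ofReal (Real.sqrt ε) * sobolevNorm (P.s + 1) (η t) + sobolevNormVec P.s (v t) ≤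
          ENNReal.ofReal (((Real.sqrt P.cM)⁻¹ + P.symMLower + 2) * (2 * R)) := by
  have hs : 0 ≤ P.s := by linarith [P.two_lt_s]
  have hs1 : 0 ≤ P.s + 1 := by linarith
  obtain ⟨e₀, he₀⟩ := exists_isLift_of_sobolevNorm hs1 (hη₀.trans_lt ENNReal.coe_lt_top)
  choose g₀ hg₀ using fun j => exists_isLift_of_sobolevNorm hs
    ((sobolevNorm_le_vec P.s v₀ j).trans_lt (hv₀.trans_lt ENNReal.coe_lt_top))
  have be : ‖e₀‖ ≤ R₁ := by
    rw [he₀.sobolevNorm_eq hs1, ← ENNReal.ofReal_coe_nnreal] at hη₀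
    exact (ENNReal.ofReal_le_ofReal_iff R₁.2).1 hη₀
  have bg : ∀ j, ‖g₀ j‖ ≤ R₂ := fun j => by
    have := (sobolevNorm_le_vec P.s v₀ j).trans hv₀
    rw [(hg₀ j).sobolevNorm_eq hs, ← ENNReal.ofReal_coe_nnreal] at this
    exact (ENNReal.ofReal_le_ofReal_iff R₂.2).1 this
  have hU : 0 ≤ P.symMUpper := Real.sqrt_nonneg _
  set F₀ : H := mulL (P.symMJap ε) e₀ with hF₀
  set G₀ : H := -(Complex.I • mulL (rho 0) (g₀ 0) + Complex.I • mulL (rho 1) (g₀ 1)) with hG₀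
  have hA : amplitude v₀ = P.smooth G₀ := amplitude_eq hs hg₀
  have rF : reflect F₀ = F₀ := by
    rw [hF₀, reflect_mulL (isMultiplier_symMJap hε hε1) symMJap_neg, he₀.reflect_eq hs1]
  have rG : reflect G₀ = G₀ := by
    apply reflect_of_smooth
    rw [← hA, reflect_amplitude]
  have bF : ‖F₀‖ ≤ P.symMUpper * R₁ :=
    (norm_mulL_le (isMultiplier_symMJap hε hε1) (abs_symMJap_le hε hε1) e₀).trans
      (mul_le_mul_of_nonneg_left be hU)
  have bG : ‖G₀‖ ≤ 2 * R₂ := by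
    rw [hG₀, norm_neg]
    refine (norm_add_le _ _).trans ?_
    linarith [(norm_smul_I_rho_le 0 (g₀ 0)).trans (bg 0), (norm_smul_I_rho_le 1 (g₀ 1)).trans (bg 1)]
  have hb : ‖F₀‖ ^ 2 + ‖G₀‖ ^ 2 ≤ R ^ 2 := by
    have h1 : ‖F₀‖ + ‖G₀‖ ≤ R := by linarith
    have h2 := mul_nonneg (norm_nonneg F₀) (norm_nonneg G₀)
    have h3 : (‖F₀‖ + ‖G₀‖) ^ 2 ≤ R ^ 2 := pow_le_pow_left₀ (by positivity) h1 2
    linarith [add_sq ‖F₀‖ ‖G₀‖]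
  obtain ⟨F, G, hF0, hG0, hFc, hGc, hFG, hsol⟩ := exists_fourierSolution hε hε1 hR hS hT rF rG hb
  have hη : ∀ t, ∃ u : L2, t ∈ Set.Icc 0 S →
      fourierR u = mulL (fun ξ => (P.symM ε ξ)⁻¹) (P.smooth (F t)) := fun t => by
    by_cases ht : t ∈ Set.Icc 0 S
    · obtain ⟨f, g, hf, -, e, -⟩ := hsol.rep t ht
      have : reflect (mulL (fun ξ => (P.symM ε ξ)⁻¹) (P.smooth (F t))) =
          mulL (fun ξ => (P.symM ε ξ)⁻¹) (P.smooth (F t)) := by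
        rw [reflect_mulL (isMultiplier_inv_symM hε) fun ξ => by rw [symM_neg]]
        rw [e, reflect_smooth, hf]
      obtain ⟨u, hu⟩ := exists_fourierR_eq this
      exact ⟨u, fun _ => hu⟩
    · exact ⟨0, fun h => absurd h ht⟩
  have hv : ∀ t, ∀ j, ∃ u : L2, t ∈ Set.Icc 0 S →
      fourierR u = Complex.I • mulL (rho j) (P.smooth (G t)) := fun t j => by
    by_cases ht : t ∈ Set.Icc 0 S
    · obtain ⟨f, g, -, hg, -, e, -⟩ := hsol.rep t ht
      have : reflect (P.smooth (G t)) = P.smooth (G t) := by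
        rw [e, reflect_smooth, hg]
      obtain ⟨u, hu⟩ := exists_fourierR_eq (reflect_rho_I j this)
      exact ⟨u, fun _ => hu⟩
    · exact ⟨0, fun h => absurd h ht⟩
  choose η hη using hη
  choose v hv using hv
  have h0 : (0 : ℝ) ∈ Set.Icc 0 S := ⟨le_rfl, hS⟩
  have lη : ∀ t ∈ Set.Icc 0 S, IsLift (P.s + 1) (η t) (mulL (P.japSymM ε) (F t)) := fun t ht =>
    (isLift_eta hε hε1).2 (hη t ht)
  have lv : ∀ t ∈ Set.Icc 0 S, ∀ j, IsLift P.s (v t j) (Complex.I • mulL (rho j) (G t)) :=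
    fun t ht j => isLift_of_fourierR_eq hs (hv t j ht)
  refine ⟨η, v, ⟨?_, fun j => ?_, ?_, ?_, ?_⟩, fun t ht => ?_⟩
  · exact continuousInSobolev_of_lift hs1
      ((mulL (P.japSymM ε)).continuous.comp_continuousOn hFc) lη
  · exact continuousInSobolev_of_lift hs
      (((mulL (rho j)).continuous.comp_continuousOn hGc).const_smul Complex.I)
      fun t ht => lv t ht j
  · exact hsol.isSolution hε hε1 fun t ht => ⟨hη t ht, fun j => hv t j ht⟩
  · apply fourierR_injective
    rw [lη 0 h0, hF0, hF₀, japSymM_symMJap hε hε1, he₀]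
  · funext j
    apply fourierR_injective
    rw [hv 0 j h0, hG0, ← hA, hc₀.fourierR_eq]
  -- The three summands of the constant belong to the three norms: the lower bound of M for η in
  -- H^s, the comparison ε^{1/2}⟨ξ⟩ ≤ C M for η in H^{s+1}, and the two components of the velocity.
  · have hL : 0 ≤ P.symMLower := Real.sqrt_nonneg _
    have hc : 0 < (Real.sqrt P.cM)⁻¹ := inv_pos.2 (Real.sqrt_pos.2 P.cM_pos)
    have b1 : ‖mulL (fun ξ => (P.symM ε ξ)⁻¹) (F t)‖ ≤ (Real.sqrt P.cM)⁻¹ * (2 * R) := by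
      refine (norm_mulL_le (isMultiplier_inv_symM hε) (fun ξ => ?_) (F t)).trans
        (mul_le_mul_of_nonneg_left (hFG t ht).1 hc.le)
      rw [abs_of_pos (inv_pos.2 (symM_pos hε ξ))]
      exact inv_anti₀ (Real.sqrt_pos.2 P.cM_pos) (sqrt_cM_le_symM hε ξ)
    have b2 : Real.sqrt ε * ‖mulL (P.japSymM ε) (F t)‖ ≤ P.symMLower * (2 * R) := by
      have hm := isMultiplier_japSymM (P := P) hε hε1
      have hq := Real.sqrt_pos.2 hε
      have := norm_mulL_le hm (C := P.symMLower / Real.sqrt ε) (fun ξ => by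
        have h := abs_sqrt_mul_japSymM_le (P := P) hε hε1 ξ
        rw [abs_mul, abs_of_pos hq] at h
        rw [le_div_iff₀ hq, mul_comm]
        exact h) (F t)
      calc _ ≤ Real.sqrt ε * (P.symMLower / Real.sqrt ε * ‖F t‖) :=
            mul_le_mul_of_nonneg_left this hq.le
        _ = P.symMLower * ‖F t‖ := by field_simp
        _ ≤ _ := mul_le_mul_of_nonneg_left (hFG t ht).1 hL
    rw [(isLift_eta_low hε (hη t ht)).sobolevNorm_eq hs, (lη t ht).sobolevNorm_eq hs1,
      ← ENNReal.ofReal_mul (Real.sqrt_nonneg ε), ← ENNReal.ofReal_add (norm_nonneg _) (by positivity)]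
    have b3 := sobolevNormVec_le hs (B := 2 * R) (by positivity) (lv t ht)
      fun j => (norm_smul_I_rho_le j (G t)).trans (hFG t ht).2
    refine (add_le_add le_rfl b3).trans ?_
    rw [← ENNReal.ofReal_add (by positivity) (by positivity)]
    apply ENNReal.ofReal_le_ofReal
    linarith

/-- Well-posedness on the time scale `ε^{-1/2}`. -/
theorem wellPosed (P : Params) (R₁ R₂ : ℝ≥0) : ∃ T : ℝ, 0 < T ∧ ∃ C : ℝ≥0, ∀ ε : ℝ, 0 < ε → ε ≤ 1 →
    ∀ (η₀ : L2) (v₀ : Fin 2 → L2),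
      sobolevNorm (P.s + 1) η₀ ≤ R₁ → sobolevNormVec P.s v₀ ≤ R₂ → CurlFree v₀ →
      ∃ (η : ℝ → L2) (v : ℝ → Fin 2 → L2),
        IsSobolevSolution (-P.α) P.b (-P.γ) ε (T * ε ^ (-(1 / 2) : ℝ)) P.s η₀ v₀ η v ∧
        (∀ (η' : ℝ → L2) (v' : ℝ → Fin 2 → L2),
          IsSobolevSolution (-P.α) P.b (-P.γ) ε (T * ε ^ (-(1 / 2) : ℝ)) P.s η₀ v₀ η' v' →
          ∀ t ∈ Set.Icc 0 (T * ε ^ (-(1 / 2) : ℝ)), η' t = η t ∧ v' t = v t) ∧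
        ∀ t ∈ Set.Icc 0 (T * ε ^ (-(1 / 2) : ℝ)),
          sobolevNorm P.s (η t) + ENNReal.ofReal (Real.sqrt ε) * sobolevNorm (P.s + 1) (η t) +
            sobolevNormVec P.s (v t) ≤ C := by
  -- The summand 1 keeps the radius positive when both bounds on the data vanish.
  set R : ℝ := P.symMUpper * R₁ + 2 * R₂ + 1 with hRdef
  have hU : 0 ≤ P.symMUpper := Real.sqrt_nonneg _
  have hR : 0 < R := by positivity
  have hE := P.energyConst_nonneg
  have hlog : 0 < Real.log 4 := Real.log_pos (by norm_num)
  -- Chosen so that the growth exponent stays below log 4 once ε^{1/2} cancels ε^{-1/2}. Since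
  -- `energyConst` is only known to be nonnegative, 1 is added to it in the denominator.
  set T : ℝ := Real.log 4 / (4 * (P.energyConst + 1) * R) with hTdef
  have hT : 0 < T := by positivity
  refine ⟨T, hT, (((Real.sqrt P.cM)⁻¹ + P.symMLower + 2) * (2 * R)).toNNReal,
    fun ε hε hε1 η₀ v₀ h1 h2 h3 => ?_⟩
  have hS : 0 ≤ T * ε ^ (-(1 / 2) : ℝ) := by positivity
  have hq : Real.sqrt ε * ε ^ (-(1 / 2) : ℝ) = 1 := by
    rw [Real.sqrt_eq_rpow, ← Real.rpow_add hε]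
    norm_num
  have hTS : 4 * (P.energyConst * Real.sqrt ε) * R * (T * ε ^ (-(1 / 2) : ℝ)) ≤ Real.log 4 := by
    have e : 4 * (P.energyConst * Real.sqrt ε) * R * (T * ε ^ (-(1 / 2) : ℝ)) =
        4 * P.energyConst * R * T * (Real.sqrt ε * ε ^ (-(1 / 2) : ℝ)) := by ring
    have e2 : 4 * (P.energyConst + 1) * R * T = Real.log 4 := by
      rw [hTdef]
      field_simp
    rw [e, hq, mul_one]
    have : 0 < 4 * R * T := by positivity
    linarith
  obtain ⟨η, v, hs, hb⟩ := exists_isSobolevSolution hε hε1 hR hS hTS (by linarith) h1 h2 h3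
  exact ⟨η, v, hs, fun η' v' h' => isSobolevSolution_unique hε hε1 h3 hs h', hb⟩

end Params

end

end Boussinesq

theorem theorem4p5 (a b c s : ℝ) (ha : a < 0) (hc : c < 0) (hb : 0 < b) (hs : 2 < s) :
    (a = c →
      ∀ R₁ R₂ : ℝ≥0, ∃ T : ℝ, 0 < T ∧ ∃ C : ℝ≥0, ∀ ε : ℝ, 0 < ε → ε ≤ 1 →
        ∀ (η₀ : L2) (v₀ : Fin 2 → L2),
          sobolevNorm (s + 1) η₀ ≤ R₁ → sobolevNormVec s v₀ ≤ R₂ → CurlFree v₀ →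
          ∃ (η : ℝ → L2) (v : ℝ → Fin 2 → L2),
            IsSobolevSolution a b c ε (T * ε ^ (-(1 / 2) : ℝ)) s η₀ v₀ η v ∧
            (∀ (η' : ℝ → L2) (v' : ℝ → Fin 2 → L2),
              IsSobolevSolution a b c ε (T * ε ^ (-(1 / 2) : ℝ)) s η₀ v₀ η' v' →
              ∀ t ∈ Set.Icc 0 (T * ε ^ (-(1 / 2) : ℝ)), η' t = η t ∧ v' t = v t) ∧
            ∀ t ∈ Set.Icc 0 (T * ε ^ (-(1 / 2) : ℝ)),
              sobolevNorm s (η t) + ENNReal.ofReal (Real.sqrt ε) * sobolevNorm (s + 1) (η t) +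
                sobolevNormVec s (v t) ≤ C) ∧
    (a ≠ c →
      ∀ R₁ R₂ : ℝ≥0, ∃ T : ℝ, 0 < T ∧ ∃ C : ℝ≥0, ∀ ε : ℝ, 0 < ε → ε ≤ 1 →
        ∀ (η₀ : L2) (v₀ : Fin 2 → L2),
          sobolevNorm (s + 2) η₀ ≤ R₁ → sobolevNormVec (s + 1) v₀ ≤ R₂ → CurlFree v₀ →
          ∃ (η : ℝ → L2) (v : ℝ → Fin 2 → L2),
            IsSobolevSolution a b c ε (T * ε ^ (-(1 / 2) : ℝ)) (s + 1) η₀ v₀ η v ∧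
            (∀ (η' : ℝ → L2) (v' : ℝ → Fin 2 → L2),
              IsSobolevSolution a b c ε (T * ε ^ (-(1 / 2) : ℝ)) (s + 1) η₀ v₀ η' v' →
              ∀ t ∈ Set.Icc 0 (T * ε ^ (-(1 / 2) : ℝ)), η' t = η t ∧ v' t = v t) ∧
            ∀ t ∈ Set.Icc 0 (T * ε ^ (-(1 / 2) : ℝ)),
              sobolevNorm (s + 1) (η t) +
                ENNReal.ofReal (Real.sqrt ε) * sobolevNorm (s + 2) (η t) +
                sobolevNormVec (s + 1) (v t) ≤ C) := by
  constructor
  · rintro -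
    have := Params.wellPosed ⟨-a, -c, b, s, by linarith, by linarith, hb, hs⟩
    simpa only [neg_neg] using this
  · rintro -
    -- The extra derivative is obtained by running the argument with exponent `s + 1`, which is
    -- again greater than 2.
    have := Params.wellPosed ⟨-a, -c, b, s + 1, by linarith, by linarith, hb, by linarith⟩
    have e : s + 1 + 1 = s + 2 := by ring
    simpa only [neg_neg, e] using this
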